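/- **Exotic Strichartz estimate.** Let $d\ge 9$ be an integer and $p>0$ real, with $s_c:=\frac d2-\frac4p\ge 1$. Put $$q_0=\frac{4p(p+2)}{p^2-p(d-4)+8},\qquad r_0=\frac{d(p+2)}{d-p+s_c(p+2)},\qquad r_1=\frac{2r_0d}{2d-r_0(2s_c-p)},\qquad \frac1{r_1}+\frac1{r_1'}=1,$$ and assume that $2<r_0<\frac d{s_c}$ and $\frac{d+4}4\,p<q_0<\infty$. For a compact interval $I\subset\mathbb R$ and a map $u$ from $I$ to the tempered distributions on $\mathbb R^d$, let $$\|u\|_{X(I)}=\big\||\nabla|^{p/2}u\big\|_{L_t^{q_0}L_x^{r_1}(I\times\mathbb R^d)},\qquad \|F\|_{Y(I)}=\big\||\nabla|^{p/2}F\big\|_{L_t^{q_0/(1+p)}L_x^{r_1'}(I\times\mathbb R^d)}.$$ Here $|\nabla|^{\sigma}$ $(\sigma>0)$ is the Fourier multiplier $|\xi|^{\sigma}$, applied to tempered distributions whose Fourier transform is a function (absolutely integrable against every Schwartz function), and a norm is $+\infty$ if $|\nabla|^{p/2}u(t)$ is not, for almost every $t\in I$, given by a measurable function on $I\times\mathbb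 R^d$. Let $e^{it\Delta^2}$ be the Fourier multiplier $e^{it|\xi|^4}$ on tempered distributions. Then there is a finite constant $C=C(d,p)$ such that for every compact interval $I$, every $t_0\in I$ and every $F$ with $\|F\|_{Y(I)}<\infty$, the integral $\int_{t_0}^t e^{i(t-s)\Delta^2}F(s)\,ds$ converges for every $t\in I$ to a tempered distribution (weakly, that is, after pairing with any Schwartz function the integrand is Lebesgue integrable in $s$), and $$\Big\|\int_{t_0}^t e^{i(t-s)\Delta^2}F(s)\,ds\Big\|_{X(I)}\le C\,\|F\|_{Y(I)}.$$ -/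

import Mathlib

open MeasureTheory Set
open scoped ENNReal NNReal SchwartzMap FourierTransform

/-! ### Exponents -/

/-- The critical regularity `s_c = d/2 - 4/p`. -/
noncomputable def critIndex (d : ℕ) (p : ℝ) : ℝ := d / 2 - 4 / p

/-- `q₀ = 4p(p+2) / (p² - p(d-4) + 8)`. -/
noncomputable def expQ0 (d : ℕ) (p : ℝ) : ℝ := 4 * p * (p + 2) / (p ^ 2 - p * (d - 4) + 8)

/-- `r₀ = d(p+2) / (d - p + s_c (p+2))`. -/
noncomputable def expR0 (d : ℕ) (p : ℝ) : ℝ := d * (p + 2) / (d - p + critIndex d p * (p + 2))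

/-- `r₁ = 2 r₀ d / (2d - r₀ (2 s_c - p))`. -/
noncomputable def expR1 (d : ℕ) (p : ℝ) : ℝ :=
  2 * expR0 d p * d / (2 * d - expR0 d p * (2 * critIndex d p - p))

/-- `r₁'`, the exponent conjugate to `r₁`: `1/r₁ + 1/r₁' = 1`. -/
noncomputable def expR1' (d : ℕ) (p : ℝ) : ℝ := (1 - (expR1 d p)⁻¹)⁻¹

/-! ### The propagator `e^{itΔ²}`

Mathlib's Fourier transform uses the kernel `e^{-2πi x·ξ}`, so that `|∇|` has symbol `2π‖ξ‖`. -/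

/-- The symbol `e^{it|2πξ|⁴}` of `e^{itΔ²}`. -/
noncomputable def biharmonicSymbol (d : ℕ) (t : ℝ) (ξ : EuclideanSpace ℝ (Fin d)) : ℂ :=
  Complex.exp (((t * (2 * Real.pi * ‖ξ‖) ^ 4 : ℝ) : ℂ) * Complex.I)

theorem hasTemperateGrowth_exp_mul_I :
    (fun x : ℝ ↦ Complex.exp ((x : ℂ) * Complex.I)).HasTemperateGrowth := by
  have hd : ∀ n : ℕ, iteratedDeriv n (fun x : ℝ ↦ Complex.exp ((x : ℂ) * Complex.I)) =
      fun x : ℝ ↦ Complex.I ^ n * Complex.exp ((x : ℂ) * Complex.I) := by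
    intro n
    induction n with
    | zero => simp
    | succ n ih =>
      rw [iteratedDeriv_succ, ih]
      funext x
      have h1 : HasDerivAt (fun y : ℝ ↦ (y : ℂ) * Complex.I) (1 * Complex.I) x :=
        (Complex.ofRealCLM.hasDerivAt (x := x)).mul_const Complex.I
      have h2 := (h1.cexp).const_mul (Complex.I ^ n)
      rw [h2.deriv]
      ring
  refine ⟨(Complex.ofRealCLM.contDiff.mul contDiff_const).cexp, fun n ↦ ⟨0, 1, fun x ↦ ?_⟩⟩
  rw [norm_iteratedFDeriv_eq_norm_iteratedDeriv, hd n]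
  simp [Complex.norm_exp_ofReal_mul_I]

/-- The symbol of `e^{itΔ²}` is smooth with derivatives of polynomial growth, so it does multiply
every tempered distribution. -/
theorem biharmonicSymbol_hasTemperateGrowth (d : ℕ) (t : ℝ) :
    (biharmonicSymbol d t).HasTemperateGrowth := by
  have h : (fun ξ : EuclideanSpace ℝ (Fin d) ↦
      t * (2 * Real.pi) ^ 4 * ((‖ξ‖ ^ 2) * (‖ξ‖ ^ 2))).HasTemperateGrowth := by
    have h2 : (fun ξ : EuclideanSpace ℝ (Fin d) ↦ ‖ξ‖ ^ 2).HasTemperateGrowth :=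
      Function.hasTemperateGrowth_norm_sq _
    exact (Function.HasTemperateGrowth.const _).mul (h2.mul h2)
  have h' := hasTemperateGrowth_exp_mul_I.comp h
  convert h' using 1
  funext ξ
  simp only [biharmonicSymbol, Function.comp]
  congr 3
  ring

/-- `e^{itΔ²}` on tempered distributions: the Fourier multiplier `e^{it|2πξ|⁴}`. -/
noncomputable def biharmonicPropagator (d : ℕ) (t : ℝ) :
    𝓢'(EuclideanSpace ℝ (Fin d), ℂ) →L[ℂ] 𝓢'(EuclideanSpace ℝ (Fin d), ℂ) :=
  TemperedDistribution.fourierMultiplierCLM ℂ (biharmonicSymbol d t)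

/-! ### Fractional derivatives and mixed norms -/

/-- The tempered distribution `T` is the function `w`. -/
def IsGivenBy {d : ℕ} (T : 𝓢'(EuclideanSpace ℝ (Fin d), ℂ))
    (w : EuclideanSpace ℝ (Fin d) → ℂ) : Prop :=
  ∀ φ : 𝓢(EuclideanSpace ℝ (Fin d), ℂ),
    Integrable (fun x ↦ φ x * w x) ∧ T φ = ∫ x, φ x * w x

/-- `|∇|^σ f = g` for a tempered distribution `f` and a function `g`: the Fourier transform of `f`
is a function `w`, and that of `g` is the function `|2πξ|^σ w(ξ)`. -/
def IsFracDeriv {d : ℕ} (σ : ℝ) (f : 𝓢'(EuclideanSpace ℝ (Fin d), ℂ))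
    (g : EuclideanSpace ℝ (Fin d) → ℂ) : Prop :=
  ∃ (w : EuclideanSpace ℝ (Fin d) → ℂ) (T : 𝓢'(EuclideanSpace ℝ (Fin d), ℂ)),
    IsGivenBy (𝓕 f) w ∧
    IsGivenBy (𝓕 T) (fun ξ ↦ (((2 * Real.pi * ‖ξ‖) ^ σ : ℝ) : ℂ) * w ξ) ∧
    IsGivenBy T g

/-- The mixed norm `‖G‖_{L_t^q L_x^r(I × ℝ^d)}`. -/
noncomputable def mixedNorm {d : ℕ} (q r : ℝ) (I : Set ℝ)
    (G : ℝ → EuclideanSpace ℝ (Fin d) → ℂ) : ℝ≥0∞ :=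
  eLpNorm (fun t ↦ eLpNorm (G t) (ENNReal.ofReal r) volume) (ENNReal.ofReal q)
    (volume.restrict I)

/-- `G` is a measurable function on `I × ℝ^d` with `G(t) = |∇|^σ F(t)` for almost every `t ∈ I`. -/
def IsFracDerivPath {d : ℕ} (σ : ℝ) (I : Set ℝ)
    (F : ℝ → 𝓢'(EuclideanSpace ℝ (Fin d), ℂ))
    (G : ℝ → EuclideanSpace ℝ (Fin d) → ℂ) : Prop :=
  AEStronglyMeasurable (Function.uncurry G) ((volume.restrict I).prod volume) ∧
    ∀ᵐ t ∂(volume.restrict I), IsFracDeriv σ (F t) (G t)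

/-- `‖|∇|^σ F‖_{L_t^q L_x^r(I × ℝ^d)}`, with value `∞` when `|∇|^σ F` is not a measurable function
on `I × ℝ^d`. (The function `G = |∇|^σ F` is unique up to null sets, so the infimum is over one
value or over none.) -/
noncomputable def fracMixedNorm {d : ℕ} (σ q r : ℝ) (I : Set ℝ)
    (F : ℝ → 𝓢'(EuclideanSpace ℝ (Fin d), ℂ)) : ℝ≥0∞ :=
  ⨅ (G : ℝ → EuclideanSpace ℝ (Fin d) → ℂ) (_ : IsFracDerivPath σ I F G), mixedNorm q r I G

/-- `‖u‖_{X(I)} = ‖|∇|^{p/2} u‖_{L_t^{q₀} L_x^{r₁}(I × ℝ^d)}`. -/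
noncomputable def XNorm (d : ℕ) (p : ℝ) (I : Set ℝ)
    (u : ℝ → 𝓢'(EuclideanSpace ℝ (Fin d), ℂ)) : ℝ≥0∞ :=
  fracMixedNorm (p / 2) (expQ0 d p) (expR1 d p) I u

/-- `‖F‖_{Y(I)} = ‖|∇|^{p/2} F‖_{L_t^{q₀/(1+p)} L_x^{r₁'}(I × ℝ^d)}`. -/
noncomputable def YNorm (d : ℕ) (p : ℝ) (I : Set ℝ)
    (F : ℝ → 𝓢'(EuclideanSpace ℝ (Fin d), ℂ)) : ℝ≥0∞ :=
  fracMixedNorm (p / 2) (expQ0 d p / (1 + p)) (expR1' d p) I F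

/-- `u(t) = ∫_{t₀}^t e^{i(t-s)Δ²} F(s) ds` for every `t ∈ I`, as a convergent weak integral of
tempered distributions. -/
def IsDuhamelIntegral {d : ℕ} (I : Set ℝ) (t₀ : ℝ)
    (F u : ℝ → 𝓢'(EuclideanSpace ℝ (Fin d), ℂ)) : Prop :=
  ∀ t ∈ I, ∀ φ : 𝓢(EuclideanSpace ℝ (Fin d), ℂ),
    IntervalIntegrable (fun s ↦ biharmonicPropagator d (t - s) (F s) φ) volume t₀ t ∧
    u t φ = ∫ s in t₀..t, biharmonicPropagator d (t - s) (F s) φ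

/-! ### The one-dimensional Hardy-Littlewood-Sobolev inequality -/

/-! The time integral is estimated in absolute value. The dispersive estimate maps L^{r₁'} to L^{r₁}
at the cost of |t-s|^{-α} with α = (d/4)(1-2/r₁). So ‖|∇|^{p/2}u(t)‖_{r₁} is at most a constant
times the fractional integral in time of ‖|∇|^{p/2}F(s)‖_{r₁'}. The exponents satisfy α = 1 - p/q₀,
which is the Hardy-Littlewood-Sobolev relation from L^{q₀/(1+p)} to L^{q₀}. Admissibility of the
pairs plays no role. `exists_duhamel_fracMixedNorm_le` is this argument for general exponents.

The L¹ → L^∞ decay |t|^{-d/4} comes without stationary phase, by subordination to the Schrödinger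
and heat flows. With λ a multiple of |ξ|², the Gaussian exp(-aλ²) is a superposition of exp(izλ)
along a contour in the upper half plane. Each exp(izλ) is itself a Gaussian multiplier with decay
|z|^{-d/2}, integrable at infinity for d ≥ 3, and the contour goes round the singularity at z = 0.
Letting a tend to ∓i gives `norm_integral_biharmonicSymbol_mul_fourier_le`. Interpolation with
Plancherel (`riesz_thorin`) and the converse of Hölder's inequality give
`exists_eLpNorm_biharmonic_le`.

It remains to give sense to the integral at every t, even where the fractional integral is infinite.
Everything is paired with test functions on the frequency side. There Hausdorff-Young gives a bound
without decay: the Fourier transform W of the Duhamel integral of G = |∇|^σ F lies in L^r for every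
t. Since σr' < d, the weight |2πξ|^{-σ} is locally in L^{r'}, and |2πξ|^{-σ}W is a tempered
distribution, the Fourier transform of u(t). Regularised Riesz potentials identify it with the weak
integral of F (`exists_duhamel_isFracDeriv`). For almost every t the dispersive bound supplies a
function in L^r equal to |∇|^σ u(t), and mollification makes the choice jointly measurable. -/

theorem lintegral_mul_ofReal_eq_lintegral_superlevel {Φ : ℝ → ℝ≥0∞} (hΦ : Measurable Φ)
    {f : ℝ → ℝ} (hf : Measurable f) (hf0 : ∀ t, 0 ≤ f t) :
    ∫⁻ t, Φ t * ENNReal.ofReal (f t) = ∫⁻ x in Ioi (0 : ℝ), ∫⁻ t in {t | x < f t}, Φ t := by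
  have h := lintegral_eq_lintegral_meas_lt (f := f) ((volume : Measure ℝ).withDensity Φ)
    (Filter.Eventually.of_forall hf0) hf.aemeasurable
  rw [lintegral_withDensity_eq_lintegral_mul _ hΦ hf.ennreal_ofReal] at h
  simp only [Pi.mul_apply] at h
  rw [h]
  refine lintegral_congr fun x ↦ ?_
  rw [withDensity_apply _ (measurableSet_lt measurable_const hf)]

theorem lintegral_rpow_Ioc_zero {e R : ℝ} (he : -1 < e) (hR : 0 ≤ R) :
    ∫⁻ y in Ioc 0 R, ENNReal.ofReal (y ^ e) = ENNReal.ofReal (R ^ (e + 1) / (e + 1)) := by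
  rw [← ofReal_integral_eq_lintegral_ofReal]
  · rw [← intervalIntegral.integral_of_le hR, integral_rpow (Or.inl he),
      Real.zero_rpow (by linarith), sub_zero]
  · exact (intervalIntegrable_iff_integrableOn_Ioc_of_le hR).1
      (intervalIntegral.intervalIntegrable_rpow' he)
  · exact (ae_restrict_iff' measurableSet_Ioc).2
      (Filter.Eventually.of_forall fun y hy ↦ Real.rpow_nonneg hy.1.le _)

theorem lintegral_abs_rpow_ball_le {α R : ℝ} (hα1 : α < 1) (hR : 0 ≤ R) (t : ℝ) :
    ∫⁻ s in {s | |t - s| ≤ R}, ENNReal.ofReal (|t - s| ^ (-α)) ≤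
      ENNReal.ofReal (2 * R ^ (1 - α) / (1 - α)) := by
  have h1 : ∫⁻ s in {s | |t - s| ≤ R}, ENNReal.ofReal (|t - s| ^ (-α)) =
      ∫⁻ s in {s : ℝ | |s| ≤ R}, ENNReal.ofReal (|s| ^ (-α)) := by
    have hm : MeasurableSet {s : ℝ | |s| ≤ R} := measurableSet_le (by fun_prop) (by fun_prop)
    have hm' : MeasurableSet {s : ℝ | |t - s| ≤ R} := measurableSet_le (by fun_prop) (by fun_prop)
    rw [← lintegral_indicator hm, ← lintegral_indicator hm',
      ← lintegral_sub_left_eq_self (fun s ↦ indicator {s : ℝ | |s| ≤ R}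
        (fun s ↦ ENNReal.ofReal (|s| ^ (-α))) s) t]
    rfl
  have h2 : {s : ℝ | |s| ≤ R} ⊆ Icc (-R) 0 ∪ Ioc 0 R := by
    intro s hs
    have := abs_le.1 (show |s| ≤ R from hs)
    rcases le_or_gt s 0 with h | h
    · exact Or.inl ⟨this.1, h⟩
    · exact Or.inr ⟨h, this.2⟩
  have h4 : ∫⁻ s in Ioc 0 R, ENNReal.ofReal (|s| ^ (-α)) =
      ENNReal.ofReal (R ^ (1 - α) / (1 - α)) := by
    have : ∫⁻ s in Ioc 0 R, ENNReal.ofReal (|s| ^ (-α)) =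
        ∫⁻ s in Ioc 0 R, ENNReal.ofReal (s ^ (-α)) :=
      setLIntegral_congr_fun measurableSet_Ioc fun s hs ↦ by
        simp only [abs_of_pos hs.1]
    rw [this, lintegral_rpow_Ioc_zero (by linarith) hR]
    ring_nf
  have h3 : ∫⁻ s in Icc (-R) 0, ENNReal.ofReal (|s| ^ (-α)) =
      ENNReal.ofReal (R ^ (1 - α) / (1 - α)) := by
    rw [setLIntegral_congr Ico_ae_eq_Icc.symm, ← h4, ← lintegral_indicator measurableSet_Ico,
      ← lintegral_indicator measurableSet_Ioc, ← lintegral_neg_eq_self]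
    refine lintegral_congr fun s ↦ ?_
    by_cases hs : s ∈ Ioc 0 R
    · rw [indicator_of_mem hs, indicator_of_mem (by constructor <;> linarith [hs.1, hs.2]), abs_neg]
    · rw [indicator_of_notMem hs, indicator_of_notMem]
      intro h
      exact hs ⟨by linarith [h.2], by linarith [h.1]⟩
  rw [h1]
  calc _ ≤ ∫⁻ s in Icc (-R) 0 ∪ Ioc 0 R, ENNReal.ofReal (|s| ^ (-α)) := lintegral_mono_set h2
    _ ≤ _ := lintegral_union_le _ _ _
    _ = _ := by
      have h5 : 0 ≤ R ^ (1 - α) / (1 - α) :=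
        div_nonneg (Real.rpow_nonneg hR (1 - α)) (by linarith)
      rw [h3, h4, ← ENNReal.ofReal_add h5 h5]
      congr 1
      ring

/-- Split B at distance |B| from t. The near part is at most the integral over the ball; on the far
part the kernel is at most |B|^{-α} and the measure at most |B|. Both are of size |B|^{1-α}. -/
theorem setLIntegral_abs_rpow_le {α : ℝ} (hα0 : 0 < α) (hα1 : α < 1) (t : ℝ) (B : Set ℝ) :
    ∫⁻ s in B, ENNReal.ofReal (|t - s| ^ (-α)) ≤
      ENNReal.ofReal (2 / (1 - α) + 1) * volume B ^ (1 - α) := by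
  have hα : 0 < 1 - α := by linarith
  by_cases hB0 : volume B = 0
  · rw [setLIntegral_measure_zero _ _ hB0]; exact zero_le
  by_cases hBt : volume B = ⊤
  · rw [hBt, ENNReal.top_rpow_of_pos hα, ENNReal.mul_top]
    · exact le_top
    · simp only [ne_eq, ENNReal.ofReal_eq_zero, not_le]; positivity
  set R := (volume B).toReal with hR
  have hRpos : 0 < R := ENNReal.toReal_pos hB0 hBt
  have hBR : volume B = ENNReal.ofReal R := (ENNReal.ofReal_toReal hBt).symm
  have hsub : B ⊆ {s | |t - s| ≤ R} ∪ (B ∩ {s | R < |t - s|}) := by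
    intro s hs
    rcases le_or_gt (|t - s|) R with h | h
    · exact Or.inl h
    · exact Or.inr ⟨hs, h⟩
  calc ∫⁻ s in B, ENNReal.ofReal (|t - s| ^ (-α))
      ≤ ∫⁻ s in {s | |t - s| ≤ R} ∪ (B ∩ {s | R < |t - s|}), ENNReal.ofReal (|t - s| ^ (-α)) :=
        lintegral_mono_set hsub
    _ ≤ _ := lintegral_union_le _ _ _
    _ ≤ ENNReal.ofReal (2 * R ^ (1 - α) / (1 - α)) +
        ENNReal.ofReal (R ^ (-α)) * ENNReal.ofReal R := by
        gcongr
        · exact lintegral_abs_rpow_ball_le hα1 hRpos.le t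
        · calc _ ≤ ∫⁻ s in B ∩ {s | R < |t - s|}, ENNReal.ofReal (R ^ (-α)) := by
                refine setLIntegral_mono measurable_const fun s hs ↦ ?_
                apply ENNReal.ofReal_le_ofReal
                exact Real.rpow_le_rpow_of_nonpos hRpos (le_of_lt hs.2) (by linarith)
            _ ≤ ENNReal.ofReal (R ^ (-α)) * volume B := by
                rw [lintegral_const, Measure.restrict_apply_univ]
                gcongr
                exact inter_subset_left
            _ = _ := by rw [hBR]
    _ = _ := by
      rw [hBR, ENNReal.ofReal_rpow_of_pos hRpos, ← ENNReal.ofReal_mul (by positivity),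
        ← ENNReal.ofReal_mul (by positivity), ← ENNReal.ofReal_add (by positivity) (by positivity)]
      congr 1
      rw [show R ^ (1 - α) = R ^ (-α) * R by
        rw [← Real.rpow_add_one hRpos.ne']; ring_nf]
      field_simp

theorem volume_superlevel_le {f : ℝ → ℝ} (hf : Measurable f) {P : ℝ}
    (hP : 0 < P) (hn : ∫⁻ t, ENNReal.ofReal (f t ^ P) ≤ 1) {x : ℝ} (hx : 0 < x) :
    volume {t | x < f t} ≤ ENNReal.ofReal (x ^ (-P)) := by
  have h := mul_meas_ge_le_lintegral (μ := volume) (f := fun t ↦ ENNReal.ofReal (f t ^ P))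
    (by fun_prop) (ENNReal.ofReal (x ^ P))
  have hsub : {t | x < f t} ⊆ {t | ENNReal.ofReal (x ^ P) ≤ ENNReal.ofReal (f t ^ P)} := by
    intro t ht
    exact ENNReal.ofReal_le_ofReal (Real.rpow_le_rpow hx.le (le_of_lt ht) hP.le)
  have hpos : 0 < x ^ P := Real.rpow_pos_of_pos hx P
  rw [Real.rpow_neg hx.le, ENNReal.ofReal_inv_of_pos hpos, ← one_div,
    ENNReal.le_div_iff_mul_le (Or.inl (by simpa using hpos)) (Or.inl ENNReal.ofReal_ne_top), mul_comm]
  exact (mul_le_mul_right (measure_mono hsub) _).trans (h.trans hn)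

theorem measurable_volume_superlevel (f : ℝ → ℝ) : Measurable fun x ↦ volume {t | x < f t} :=
  Antitone.measurable fun _ y hxy ↦ measure_mono fun t (ht : y < f t) ↦ lt_of_le_of_lt hxy ht

/-- The relation between P, Q and α makes -Q(1-α)+1 equal to Q(1-1/P) > 0. The integral in y up to
x^{P/Q} is then a multiple of x^{P-1}, and what remains is the layer-cake formula for ∫ f^P. -/
theorem lintegral_superlevel_half_le {f : ℝ → ℝ} (hf : Measurable f) (hf0 : ∀ t, 0 ≤ f t) {P Q α : ℝ}
    (hP : 1 < P) (hQ : 1 < Q) (hα : 1 / P + 1 / Q + α = 2)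
    (hn : ∫⁻ t, ENNReal.ofReal (f t ^ P) ≤ 1) :
    ∫⁻ x in Ioi (0 : ℝ), ∫⁻ y in Ioi (0 : ℝ), (if y ^ Q ≤ x ^ P then
      volume {t | x < f t} * ENNReal.ofReal (y ^ (-Q)) ^ (1 - α) else 0) ≤
      ENNReal.ofReal (1 / (P * (Q * (1 - 1 / P)))) := by
  have hP0 : 0 < P := by linarith
  have hQ0 : 0 < Q := by linarith
  have hP' : 0 < 1 - 1 / P := by
    rw [sub_pos, div_lt_one hP0]; exact hP
  have key : -Q * (1 - α) + 1 = Q * (1 - 1 / P) := by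
    have : α = 2 - 1 / P - 1 / Q := by linarith
    rw [this]; field_simp; ring
  have hc : 0 < Q * (1 - 1 / P) := by positivity
  have inner : ∀ x ∈ Ioi (0 : ℝ), ∫⁻ y in Ioi (0 : ℝ), (if y ^ Q ≤ x ^ P then
      volume {t | x < f t} * ENNReal.ofReal (y ^ (-Q)) ^ (1 - α) else 0) =
      ENNReal.ofReal (1 / (Q * (1 - 1 / P))) *
        (volume {t | x < f t} * ENNReal.ofReal (x ^ (P - 1))) := by
    intro x hx
    have hx : 0 < x := hx
    have hE : ∀ y ∈ Ioi (0 : ℝ), (if y ^ Q ≤ x ^ P then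
        volume {t | x < f t} * ENNReal.ofReal (y ^ (-Q)) ^ (1 - α) else 0) =
        volume {t | x < f t} * (Ioc 0 (x ^ (P / Q))).indicator
          (fun y ↦ ENNReal.ofReal (y ^ (-Q * (1 - α)))) y := by
      intro y hy
      have hy : 0 < y := hy
      have hiff : y ^ Q ≤ x ^ P ↔ y ∈ Ioc 0 (x ^ (P / Q)) := by
        have : x ^ P = (x ^ (P / Q)) ^ Q := by
          rw [← Real.rpow_mul hx.le]; congr 1; field_simp
        rw [this, Real.rpow_le_rpow_iff hy.le (by positivity) hQ0]
        simp [hy]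
      by_cases h : y ^ Q ≤ x ^ P
      · rw [if_pos h, indicator_of_mem (hiff.1 h), ENNReal.ofReal_rpow_of_pos (by positivity),
          ← Real.rpow_mul hy.le]
      · rw [if_neg h, indicator_of_notMem (fun h' ↦ h (hiff.2 h')), mul_zero]
    rw [setLIntegral_congr_fun measurableSet_Ioi hE, lintegral_const_mul _
      (Measurable.indicator (by fun_prop) measurableSet_Ioc),
      lintegral_indicator measurableSet_Ioc, Measure.restrict_restrict measurableSet_Ioc,
      inter_eq_self_of_subset_left Ioc_subset_Ioi_self,
      lintegral_rpow_Ioc_zero (by linarith) (by positivity), key, mul_left_comm,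
      ← ENNReal.ofReal_mul (by positivity), ← Real.rpow_mul hx.le]
    congr 2
    rw [show P / Q * (Q * (1 - 1 / P)) = P - 1 by field_simp]
    ring
  rw [setLIntegral_congr_fun measurableSet_Ioi inner, lintegral_const_mul _ (by
    have := measurable_volume_superlevel f; fun_prop)]
  have hl := lintegral_rpow_eq_lintegral_meas_lt_mul (volume : Measure ℝ)
    (Filter.Eventually.of_forall hf0) hf.aemeasurable hP0
  rw [hl] at hn
  have h2 : ∫⁻ x in Ioi (0 : ℝ), volume {t | x < f t} * ENNReal.ofReal (x ^ (P - 1)) ≤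
      ENNReal.ofReal (1 / P) := by
    rw [ENNReal.ofReal_div_of_pos hP0, ENNReal.ofReal_one, ENNReal.le_div_iff_mul_le
      (Or.inl (by simpa using hP0)) (Or.inl ENNReal.ofReal_ne_top), mul_comm]
    exact hn
  calc _ ≤ _ := mul_le_mul_right h2 _
    _ = _ := by
      rw [← ENNReal.ofReal_mul (by positivity)]
      congr 1; field_simp

/-- Layer cake in both functions reduces to superlevel sets A of f and B of g, where the kernel
integrates to at most c|A||B|^{1-α} and also to at most c|B||A|^{1-α}. The first bound is used where
y^Q ≤ x^P, the second elsewhere. Chebyshev is spent only on the factor with the fractional power;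
the other factor reassembles the norm. -/
theorem hardy_littlewood_sobolev_bilinear {f g : ℝ → ℝ} (hf : Measurable f) (hf0 : ∀ t, 0 ≤ f t)
    (hg : Measurable g) (hg0 : ∀ t, 0 ≤ g t) {P Q α : ℝ} (hP : 1 < P) (hQ : 1 < Q)
    (hα0 : 0 < α) (hα1 : α < 1) (hα : 1 / P + 1 / Q + α = 2)
    (hnf : ∫⁻ t, ENNReal.ofReal (f t ^ P) ≤ 1) (hng : ∫⁻ t, ENNReal.ofReal (g t ^ Q) ≤ 1) :
    ∫⁻ t, (∫⁻ s, ENNReal.ofReal (|t - s| ^ (-α)) * ENNReal.ofReal (g s)) * ENNReal.ofReal (f t) ≤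
      ENNReal.ofReal (2 / (1 - α) + 1) * (ENNReal.ofReal (1 / (P * (Q * (1 - 1 / P)))) +
        ENNReal.ofReal (1 / (Q * (P * (1 - 1 / Q))))) := by
  set c := ENNReal.ofReal (2 / (1 - α) + 1) with hc
  have hkm : Measurable fun z : ℝ × ℝ ↦ ENNReal.ofReal (|z.1 - z.2| ^ (-α)) := by fun_prop
  have hlev : MeasurableSet {z : (ℝ × ℝ) × ℝ | z.1.2 < g z.2} :=
    measurableSet_lt (by fun_prop) (by fun_prop)
  have hBm : ∀ y, MeasurableSet {s | y < g s} := fun y ↦ measurableSet_lt measurable_const hg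
  have hAm : ∀ x, MeasurableSet {s | x < f s} := fun y ↦ measurableSet_lt measurable_const hf
  have hΨ : Measurable fun z : ℝ × ℝ ↦ ∫⁻ s in {s | z.2 < g s}, ENNReal.ofReal (|z.1 - s| ^ (-α)) := by
    have : (fun z : ℝ × ℝ ↦ ∫⁻ s in {s | z.2 < g s}, ENNReal.ofReal (|z.1 - s| ^ (-α))) =
        fun z : ℝ × ℝ ↦ ∫⁻ s, {w : (ℝ × ℝ) × ℝ | w.1.2 < g w.2}.indicator
          (fun w ↦ ENNReal.ofReal (|w.1.1 - w.2| ^ (-α))) (z, s) := by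
      funext z
      rw [← lintegral_indicator (hBm _)]
      rfl
    rw [this]
    exact Measurable.lintegral_prod_right' (Measurable.indicator (by fun_prop) hlev)
  have hΦ : Measurable fun t ↦ ∫⁻ s, ENNReal.ofReal (|t - s| ^ (-α)) * ENNReal.ofReal (g s) :=
    Measurable.lintegral_prod_right' (f := fun z : ℝ × ℝ ↦ 
      ENNReal.ofReal (|z.1 - z.2| ^ (-α)) * ENNReal.ofReal (g z.2)) (by fun_prop)
  have e1 : ∫⁻ t, (∫⁻ s, ENNReal.ofReal (|t - s| ^ (-α)) * ENNReal.ofReal (g s)) *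
      ENNReal.ofReal (f t) = ∫⁻ x in Ioi (0 : ℝ), ∫⁻ y in Ioi (0 : ℝ), ∫⁻ t in {t | x < f t},
        ∫⁻ s in {s | y < g s}, ENNReal.ofReal (|t - s| ^ (-α)) := by
    rw [lintegral_mul_ofReal_eq_lintegral_superlevel hΦ hf hf0]
    refine lintegral_congr fun x ↦ ?_
    rw [← lintegral_lintegral_swap (f := fun t y ↦
      ∫⁻ s in {s | y < g s}, ENNReal.ofReal (|t - s| ^ (-α))) hΨ.aemeasurable]
    refine lintegral_congr fun t ↦ ?_
    exact lintegral_mul_ofReal_eq_lintegral_superlevel (by fun_prop) hg hg0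
  have b1 : ∀ x y, ∫⁻ t in {t | x < f t}, ∫⁻ s in {s | y < g s}, ENNReal.ofReal (|t - s| ^ (-α)) ≤
      c * (volume {t | x < f t} * volume {s | y < g s} ^ (1 - α)) := by
    intro x y
    calc _ ≤ ∫⁻ t in {t | x < f t}, c * volume {s | y < g s} ^ (1 - α) :=
          lintegral_mono fun t ↦ setLIntegral_abs_rpow_le hα0 hα1 t _
      _ = _ := by rw [lintegral_const, Measure.restrict_apply_univ]; ring
  have b2 : ∀ x y, ∫⁻ t in {t | x < f t}, ∫⁻ s in {s | y < g s}, ENNReal.ofReal (|t - s| ^ (-α)) ≤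
      c * (volume {s | y < g s} * volume {t | x < f t} ^ (1 - α)) := by
    intro x y
    rw [lintegral_lintegral_swap hkm.aemeasurable]
    calc _ ≤ ∫⁻ s in {s | y < g s}, c * volume {t | x < f t} ^ (1 - α) := by
          refine lintegral_mono fun s ↦ ?_
          simp_rw [abs_sub_comm _ s]
          exact setLIntegral_abs_rpow_le hα0 hα1 s _
      _ = _ := by rw [lintegral_const, Measure.restrict_apply_univ]; ring
  have hα2 : 0 < 1 - α := by linarith
  have hA := measurable_volume_superlevel f
  have hB := measurable_volume_superlevel g
  have hm1 : Measurable fun z : ℝ × ℝ ↦ (if z.2 ^ Q ≤ z.1 ^ P then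
      volume {t | z.1 < f t} * ENNReal.ofReal (z.2 ^ (-Q)) ^ (1 - α) else 0) :=
    Measurable.ite (measurableSet_le (by fun_prop) (by fun_prop))
      ((hA.comp measurable_fst).mul (by fun_prop)) measurable_const
  have hm2 : Measurable fun z : ℝ × ℝ ↦ (if z.1 ^ P ≤ z.2 ^ Q then
      volume {t | z.2 < g t} * ENNReal.ofReal (z.1 ^ (-P)) ^ (1 - α) else 0) :=
    Measurable.ite (measurableSet_le (by fun_prop) (by fun_prop))
      ((hB.comp measurable_snd).mul (by fun_prop)) measurable_const
  rw [e1]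
  calc _ ≤ ∫⁻ x in Ioi (0 : ℝ), ∫⁻ y in Ioi (0 : ℝ), (c * (if y ^ Q ≤ x ^ P then
      volume {t | x < f t} * ENNReal.ofReal (y ^ (-Q)) ^ (1 - α) else 0) + 
        c * (if x ^ P ≤ y ^ Q then
      volume {t | y < g t} * ENNReal.ofReal (x ^ (-P)) ^ (1 - α) else 0)) := by
        refine setLIntegral_mono' measurableSet_Ioi fun x hx ↦
          setLIntegral_mono' measurableSet_Ioi fun y hy ↦ ?_
        rcases le_total (y ^ Q) (x ^ P) with h | h
        · refine le_trans ?_ (le_add_of_nonneg_right (zero_le))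
          rw [if_pos h]
          refine (b1 x y).trans ?_
          gcongr
          exact volume_superlevel_le hg (by linarith) hng hy
        · refine le_trans ?_ (le_add_of_nonneg_left (zero_le))
          rw [if_pos h]
          refine (b2 x y).trans ?_
          gcongr
          exact volume_superlevel_le hf (by linarith) hnf hx
    _ = c * (∫⁻ x in Ioi (0 : ℝ), ∫⁻ y in Ioi (0 : ℝ), (if y ^ Q ≤ x ^ P then
      volume {t | x < f t} * ENNReal.ofReal (y ^ (-Q)) ^ (1 - α) else 0)) +
      c * (∫⁻ y in Ioi (0 : ℝ), ∫⁻ x in Ioi (0 : ℝ), (if x ^ P ≤ y ^ Q then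
      volume {t | y < g t} * ENNReal.ofReal (x ^ (-P)) ^ (1 - α) else 0)) := by
        rw [lintegral_lintegral_swap (μ := volume.restrict (Ioi (0 : ℝ)))
          (ν := volume.restrict (Ioi (0 : ℝ)))
          (f := fun y x ↦ (if x ^ P ≤ y ^ Q then
            volume {t | y < g t} * ENNReal.ofReal (x ^ (-P)) ^ (1 - α) else 0))
          ((hm2.comp measurable_swap).aemeasurable),
          ← lintegral_const_mul _ (Measurable.lintegral_prod_right' hm1),
          ← lintegral_const_mul _ (Measurable.lintegral_prod_right' hm2),
          ← lintegral_add_left ((Measurable.lintegral_prod_right' hm1).const_mul c)]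
        refine lintegral_congr fun x ↦ ?_
        have hx1 := hm1.comp (measurable_prodMk_left (x := x))
        have hx2 := hm2.comp (measurable_prodMk_left (x := x))
        exact (lintegral_add_left (hx1.const_mul c) _).trans
          (congrArg₂ _ (lintegral_const_mul _ hx1) (lintegral_const_mul _ hx2))
    _ ≤ _ := by
        rw [mul_add]
        gcongr
        · exact lintegral_superlevel_half_le hf hf0 hP hQ hα hnf
        · exact lintegral_superlevel_half_le hg hg0 hQ hP (by linarith) hng

/-- Duality: the bilinear bound is tested on the (b-1)-th power of the potential itself, whose
natural exponent is b/(b-1). -/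
theorem hardy_littlewood_sobolev_of_norm_le_one {a b α : ℝ} (ha : 1 < a) (hab : a < b)
    (hα : α = 1 - 1 / a + 1 / b) : ∃ C : ℝ≥0∞, C ≠ ⊤ ∧ ∀ h : ℝ → ℝ, Measurable h → (∀ t, 0 ≤ h t) →
      ∫⁻ t, ENNReal.ofReal (h t ^ a) ≤ 1 →
      ∫⁻ t, (∫⁻ s, ENNReal.ofReal (|t - s| ^ (-α)) * ENNReal.ofReal (h s)) ^ b ≤ C ^ b := by
  have hb : 1 < b := ha.trans hab
  have ha0 : 0 < a := by linarith
  have hb0 : 0 < b := by linarith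
  have h1a : 1 / a < 1 := by rw [div_lt_one ha0]; exact ha
  have hba : 1 / b < 1 / a := one_div_lt_one_div_of_lt ha0 hab
  have h1b : 0 < 1 / b := by positivity
  have hP1 : 1 < b / (b - 1) := by rw [lt_div_iff₀ (by linarith)]; linarith
  have hb1 : 0 < b - 1 := by linarith
  set C := ENNReal.ofReal (2 / (1 - α) + 1) *
      (ENNReal.ofReal (1 / (b / (b - 1) * (a * (1 - 1 / (b / (b - 1)))))) +
        ENNReal.ofReal (1 / (a * (b / (b - 1) * (1 - 1 / a))))) with hC
  refine ⟨C, ?_, fun h hh hh0 hn ↦ ?_⟩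
  rotate_left
  · set M : ℝ → ℝ≥0∞ := fun t ↦ ∫⁻ s, ENNReal.ofReal (|t - s| ^ (-α)) * ENNReal.ofReal (h s) with hM
    have hMm : Measurable M := Measurable.lintegral_prod_right' (f := fun z : ℝ × ℝ ↦
      ENNReal.ofReal (|z.1 - z.2| ^ (-α)) * ENNReal.ofReal (h z.2)) (by fun_prop)
    have bil := fun (f : ℝ → ℝ) hf hf0 hnf ↦ hardy_littlewood_sobolev_bilinear (f := f) (g := h)
      hf hf0 hh hh0 hP1 ha (α := α) (by linarith) (by linarith)
      (by rw [hα]; field_simp; ring) hnf hn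
    -- Truncation in height and support makes ∫ m^b finite, so that it can be divided out; Fatou
    -- removes it at the end.
    set m : ℕ → ℝ → ℝ≥0∞ := fun N t ↦ (Icc (-N : ℝ) N).indicator (fun t ↦ min (M t) N) t with hm
    have hmm : ∀ N, Measurable (m N) := fun N ↦
      (hMm.min measurable_const).indicator measurableSet_Icc
    have hmN : ∀ N t, m N t ≤ N := fun N t ↦
      indicator_apply_le' (fun _ ↦ min_le_right _ _) (fun _ ↦ zero_le)
    have hmM : ∀ N t, m N t ≤ M t := fun N t ↦
      indicator_apply_le' (fun _ ↦ min_le_left _ _) (fun _ ↦ zero_le)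
    have hmt : ∀ N t, m N t ≠ ⊤ := fun N t ↦ ((hmN N t).trans_lt (ENNReal.natCast_lt_top N)).ne
    have step : ∀ N, ∫⁻ t, m N t ^ b ≤ C ^ b := by
      intro N
      set X := ∫⁻ t, m N t ^ b with hX
      by_cases hX0 : X = 0
      · rw [hX0]; exact zero_le
      have hXt : X ≠ ⊤ := by
        refine ne_top_of_le_ne_top (b := (N : ℝ≥0∞) ^ b * volume (Icc (-N : ℝ) N)) ?_ ?_
        · refine ENNReal.mul_ne_top (ENNReal.rpow_ne_top_of_nonneg hb0.le (ENNReal.natCast_ne_top N)) ?_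
          rw [Real.volume_Icc]; exact ENNReal.ofReal_ne_top
        · rw [← lintegral_indicator_const measurableSet_Icc]
          refine lintegral_mono fun t ↦ ?_
          by_cases ht : t ∈ Icc (-N : ℝ) N
          · rw [indicator_of_mem ht]
            exact ENNReal.rpow_le_rpow (hmN N t) hb0.le
          · simp only [hm, indicator_of_notMem ht]
            rw [ENNReal.zero_rpow_of_pos hb0]
      set x := X.toReal with hx
      have hx0 : 0 < x := ENNReal.toReal_pos hX0 hXt
      have hXx : X = ENNReal.ofReal x := (ENNReal.ofReal_toReal hXt).symm
      -- The factor x^{-(1-1/b)} normalises the test function in L^{b/(b-1)}. The left side is then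
      -- at least x·x^{-(1-1/b)} = x^{1/b}.
      have b1 := bil (fun t ↦ x ^ (-(1 - 1 / b)) * (m N t).toReal ^ (b - 1))
        (((hmm N).ennreal_toReal.pow_const _).const_mul _) (fun t ↦ by positivity) ?_
      · have e : ∀ t, m N t ^ b * ENNReal.ofReal (x ^ (-(1 - 1 / b))) ≤
            M t * ENNReal.ofReal (x ^ (-(1 - 1 / b)) * (m N t).toReal ^ (b - 1)) := by
          intro t
          rw [ENNReal.ofReal_mul (by positivity), ← ENNReal.ofReal_rpow_of_nonneg (by positivity) hb1.le,
            ENNReal.ofReal_toReal (hmt N t)]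
          calc _ = m N t * (ENNReal.ofReal (x ^ (-(1 - 1 / b))) * m N t ^ (b - 1)) := by
                rw [mul_left_comm, mul_comm]
                congr 1
                conv_rhs => enter [1]; rw [← ENNReal.rpow_one (m N t)]
                rw [← ENNReal.rpow_add_of_nonneg _ _ (by norm_num) hb1.le]
                congr 1; ring
            _ ≤ _ := by gcongr; exact hmM N t
        have b2 := (lintegral_mono e).trans b1
        rw [lintegral_mul_const _ ((hmm N).pow_const _), ← hX, hXx,
          ← ENNReal.ofReal_mul hx0.le] at b2
        rw [show x * x ^ (-(1 - 1 / b)) = x ^ (1 / b) by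
          conv_lhs => enter [1]; rw [← Real.rpow_one x]
          rw [← Real.rpow_add hx0]; ring_nf] at b2
        calc X = (ENNReal.ofReal (x ^ (1 / b))) ^ b := by
              rw [ENNReal.ofReal_rpow_of_nonneg (by positivity) hb0.le, ← Real.rpow_mul hx0.le, hXx]
              congr 1
              rw [one_div_mul_cancel hb0.ne', Real.rpow_one]
          _ ≤ _ := ENNReal.rpow_le_rpow b2 hb0.le
      · have e : ∀ t, ENNReal.ofReal ((x ^ (-(1 - 1 / b)) * (m N t).toReal ^ (b - 1)) ^ (b / (b - 1))) =
            ENNReal.ofReal x⁻¹ * m N t ^ b := by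
          intro t
          rw [Real.mul_rpow (by positivity) (by positivity), ← Real.rpow_mul hx0.le,
            ← Real.rpow_mul ENNReal.toReal_nonneg, ENNReal.ofReal_mul (by positivity),
            show -(1 - 1 / b) * (b / (b - 1)) = -1 by field_simp, Real.rpow_neg_one,
            show (b - 1) * (b / (b - 1)) = b by field_simp,
            ← ENNReal.ofReal_rpow_of_nonneg ENNReal.toReal_nonneg hb0.le,
            ENNReal.ofReal_toReal (hmt N t)]
        simp_rw [e]
        rw [lintegral_const_mul _ ((hmm N).pow_const _), ← hX, hXx, ← ENNReal.ofReal_mul (by positivity),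
          inv_mul_cancel₀ hx0.ne', ENNReal.ofReal_one]
    have hlim : ∀ t, Filter.Tendsto (fun N ↦ m N t ^ b) Filter.atTop (nhds (M t ^ b)) := by
      intro t
      refine (ENNReal.continuous_rpow_const.tendsto _).comp ?_
      have h1 : Filter.Tendsto (fun N : ℕ ↦ min (M t) (N : ℝ≥0∞)) Filter.atTop (nhds (M t)) := by
        have := (tendsto_const_nhds (x := M t)).min ENNReal.tendsto_nat_nhds_top
        simpa using this
      refine h1.congr' ?_
      filter_upwards [Filter.eventually_ge_atTop ⌈|t|⌉₊] with N hN
      have : |t| ≤ N := (Nat.le_ceil _).trans (by exact_mod_cast hN)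
      change min (M t) (N : ℝ≥0∞) = (Icc (-N : ℝ) N).indicator (fun t ↦ min (M t) (N : ℝ≥0∞)) t
      have ht : t ∈ Icc (-N : ℝ) N := abs_le.1 this
      rw [indicator_of_mem ht]
    calc ∫⁻ t, M t ^ b = ∫⁻ t, Filter.liminf (fun N ↦ m N t ^ b) Filter.atTop := by
          simp_rw [fun t ↦ (hlim t).liminf_eq]
      _ ≤ Filter.liminf (fun N ↦ ∫⁻ t, m N t ^ b) Filter.atTop :=
          lintegral_liminf_le fun N ↦ (hmm N).pow_const _
      _ ≤ _ := Filter.liminf_le_of_frequently_le' (Filter.Frequently.of_forall step)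
  · exact ENNReal.mul_ne_top ENNReal.ofReal_ne_top
      (ENNReal.add_ne_top.2 ⟨ENNReal.ofReal_ne_top, ENNReal.ofReal_ne_top⟩)

/-- The Hardy-Littlewood-Sobolev inequality on the line. -/
theorem hardy_littlewood_sobolev {a b α : ℝ} (ha : 1 < a) (hab : a < b)
    (hα : α = 1 - 1 / a + 1 / b) : ∃ C : ℝ≥0∞, C ≠ ⊤ ∧ ∀ h : ℝ → ℝ≥0∞, Measurable h →
      (∫⁻ t, (∫⁻ s, ENNReal.ofReal (|t - s| ^ (-α)) * h s) ^ b) ^ (1 / b) ≤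
        C * (∫⁻ t, h t ^ a) ^ (1 / a) := by
  obtain ⟨C, hC, H⟩ := hardy_littlewood_sobolev_of_norm_le_one ha hab hα
  have ha0 : 0 < a := by linarith
  have hb0 : 0 < b := by linarith
  -- The added 1 keeps the constant nonzero, so the right side is `⊤` when the norm of h is.
  refine ⟨C + 1, by simpa using hC, fun h hh ↦ ?_⟩
  set X := ∫⁻ t, h t ^ a with hX
  by_cases hXt : X = ⊤
  · rw [hXt, ENNReal.top_rpow_of_pos (by positivity), ENNReal.mul_top (by simp)]
    exact le_top
  have hfin : ∀ᵐ t, h t < ⊤ := by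
    filter_upwards [ae_lt_top (hh.pow_const a) hXt] with t ht
    by_contra hc
    rw [not_lt, top_le_iff] at hc
    rw [hc, ENNReal.top_rpow_of_pos ha0] at ht
    exact lt_irrefl _ ht
  by_cases hX0 : X = 0
  · have h0 : ∀ᵐ t, h t = 0 := by
      filter_upwards [(lintegral_eq_zero_iff (hh.pow_const a)).1 hX0] with t ht
      exact (ENNReal.rpow_eq_zero_iff_of_pos ha0).1 ht
    have : ∀ t, ∫⁻ s, ENNReal.ofReal (|t - s| ^ (-α)) * h s = 0 := by
      intro t
      rw [lintegral_congr_ae (g := fun _ ↦ 0) (by filter_upwards [h0] with s hs; rw [hs, mul_zero]),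
        lintegral_zero]
    simp_rw [this]
    rw [ENNReal.zero_rpow_of_pos hb0, lintegral_zero, ENNReal.zero_rpow_of_pos (by positivity)]
    exact zero_le
  set x := X.toReal with hx
  have hx0 : 0 < x := ENNReal.toReal_pos hX0 hXt
  have hXx : X = ENNReal.ofReal x := (ENNReal.ofReal_toReal hXt).symm
  have e1 : ∀ᵐ t, h t = ENNReal.ofReal (x ^ (1 / a)) *
      ENNReal.ofReal (x ^ (-(1 / a)) * (h t).toReal) := by
    filter_upwards [hfin] with t ht
    rw [← ENNReal.ofReal_mul (by positivity), ← mul_assoc, ← Real.rpow_add hx0, add_neg_cancel,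
      Real.rpow_zero, one_mul, ENNReal.ofReal_toReal ht.ne]
  have key := H (fun t ↦ x ^ (-(1 / a)) * (h t).toReal) (hh.ennreal_toReal.const_mul _)
    (fun t ↦ by positivity) ?_
  · have e2 : ∀ t, ∫⁻ s, ENNReal.ofReal (|t - s| ^ (-α)) * h s = ENNReal.ofReal (x ^ (1 / a)) *
        ∫⁻ s, ENNReal.ofReal (|t - s| ^ (-α)) * ENNReal.ofReal (x ^ (-(1 / a)) * (h s).toReal) := by
      intro t
      rw [← lintegral_const_mul' _ _ ENNReal.ofReal_ne_top]
      refine lintegral_congr_ae ?_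
      filter_upwards [e1] with s hs
      rw [mul_left_comm, ← hs]
    simp_rw [e2, ENNReal.mul_rpow_of_nonneg _ _ hb0.le]
    rw [lintegral_const_mul' _ _ (ENNReal.rpow_ne_top_of_nonneg hb0.le ENNReal.ofReal_ne_top),
      ENNReal.mul_rpow_of_nonneg _ _ (by positivity), ← ENNReal.rpow_mul, mul_one_div_cancel hb0.ne',
      ENNReal.rpow_one, hXx, ENNReal.ofReal_rpow_of_pos hx0, mul_comm]
    gcongr
    calc _ ≤ (C ^ b) ^ (1 / b) := ENNReal.rpow_le_rpow key (by positivity)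
      _ = C := by rw [← ENNReal.rpow_mul, mul_one_div_cancel hb0.ne', ENNReal.rpow_one]
      _ ≤ C + 1 := le_self_add
  · have e3 : ∀ᵐ t, ENNReal.ofReal ((x ^ (-(1 / a)) * (h t).toReal) ^ a) =
        ENNReal.ofReal x⁻¹ * h t ^ a := by
      filter_upwards [hfin] with t ht
      rw [Real.mul_rpow (by positivity) (by positivity), ← Real.rpow_mul hx0.le,
        ENNReal.ofReal_mul (by positivity), ← ENNReal.ofReal_rpow_of_nonneg ENNReal.toReal_nonneg ha0.le,
        ENNReal.ofReal_toReal ht.ne, show -(1 / a) * a = -1 by field_simp, Real.rpow_neg_one]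
    rw [lintegral_congr_ae e3, lintegral_const_mul _ (hh.pow_const a), ← hX, hXx,
      ← ENNReal.ofReal_mul (by positivity), inv_mul_cancel₀ hx0.ne', ENNReal.ofReal_one]

/-! ### The dispersive estimate -/

section Dispersive

variable {V : Type*} [NormedAddCommGroup V] [InnerProductSpace ℝ V] [FiniteDimensional ℝ V]
  [MeasurableSpace V] [BorelSpace V]

theorem integral_fourier_mul_eq_of_integrable {f g : V → ℂ} (hf : Integrable f)
    (hg : Integrable g) : ∫ ξ, 𝓕 f ξ * g ξ = ∫ x, f x * 𝓕 g x := by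
  have h := VectorFourier.integral_fourierIntegral_smul_eq_flip (L := innerₗ V) (μ := volume)
    (ν := volume) Real.continuous_fourierChar continuous_inner hf hg
  simpa using! h

theorem norm_fourier_le_integral_norm (f : V → ℂ) (ξ : V) : ‖𝓕 f ξ‖ ≤ ∫ x, ‖f x‖ := by
  rw [Real.fourier_eq]
  refine (norm_integral_le_integral_norm _).trans_eq ?_
  simp

theorem continuous_fourier_of_integrable {f : V → ℂ} (hf : Integrable f) : Continuous (𝓕 f) := by
  have := VectorFourier.fourierIntegral_continuous (L := innerₗ V) (μ := volume)
    Real.continuous_fourierChar continuous_inner hf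
  simpa using! this

/-- The multiplier is convolution with the transform of a complex Gaussian. That kernel is
(π/b)^{dim/2} times an exponential of modulus at most 1, since Re(1/b) ≥ 0. Moving the Fourier
transforms across the pairing avoids writing the convolution. -/
theorem norm_integral_gaussian_mul_fourier_mul_fourier_le_of_pos {f g : V → ℂ} (hf : Integrable f)
    (hg : Integrable g) {b : ℂ} (hb : 0 < b.re) :
    ‖∫ ξ : V, Complex.exp (-b * ‖ξ‖ ^ 2) * (𝓕 f ξ * 𝓕 g ξ)‖ ≤
      (Real.pi / ‖b‖) ^ (Module.finrank ℝ V / 2 : ℝ) * ((∫ x, ‖f x‖) * ∫ x, ‖g x‖) := by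
  have hG : Integrable fun ξ : V ↦ Complex.exp (-b * ‖ξ‖ ^ 2) := by
    simpa using GaussianFourier.integrable_cexp_neg_mul_sq_norm_add hb 0 (0 : V)
  have hGx : ∀ x : V, Integrable fun ξ : V ↦
      Complex.exp (-b * ‖ξ‖ ^ 2 + 2 * Real.pi * Complex.I * (inner ℝ (-x) ξ : ℝ)) := fun x ↦
    GaussianFourier.integrable_cexp_neg_mul_sq_norm_add hb _ _
  have hGg : Integrable fun ξ : V ↦ Complex.exp (-b * ‖ξ‖ ^ 2) * 𝓕 g ξ :=
    hG.mul_bdd (c := ∫ x, ‖g x‖) (continuous_fourier_of_integrable hg).aestronglyMeasurable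
      (Filter.Eventually.of_forall (norm_fourier_le_integral_norm g))
  set D := (Real.pi / ‖b‖) ^ (Module.finrank ℝ V / 2 : ℝ) with hD
  have inner : ∀ x, ‖𝓕 (fun ξ : V ↦ Complex.exp (-b * ‖ξ‖ ^ 2) * 𝓕 g ξ) x‖ ≤ D * ∫ y, ‖g y‖ := by
    intro x
    have e : 𝓕 (fun ξ : V ↦ Complex.exp (-b * ‖ξ‖ ^ 2) * 𝓕 g ξ) x = 
        ∫ y, g y * 𝓕 (fun ξ : V ↦ Complex.exp (-b * ‖ξ‖ ^ 2 + 2 * Real.pi * Complex.I *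
          (inner ℝ (-x) ξ : ℝ))) y := by
      rw [← integral_fourier_mul_eq_of_integrable hg (hGx x), Real.fourier_eq']
      refine integral_congr_ae (Filter.Eventually.of_forall fun ξ ↦ ?_)
      simp only [smul_eq_mul]
      rw [← mul_assoc, ← Complex.exp_add, mul_comm]
      congr 2
      rw [inner_neg_left, real_inner_comm]
      push_cast
      ring
    rw [e, ← integral_const_mul]
    refine norm_integral_le_of_norm_le (hg.norm.const_mul D) (Filter.Eventually.of_forall fun y ↦ ?_)
    rw [fourier_gaussian_innerProductSpace' hb, norm_mul, norm_mul, mul_comm D]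
    gcongr
    have h1 : ‖((Real.pi : ℂ) / b) ^ (Module.finrank ℝ V / 2 : ℂ)‖ = D := by
      have := Complex.norm_cpow_real ((Real.pi : ℂ) / b) (Module.finrank ℝ V / 2 : ℝ)
      push_cast at this
      rw [this, norm_div, Complex.norm_real, Real.norm_of_nonneg Real.pi_pos.le]
    have h2 : ‖Complex.exp (-(Real.pi : ℂ) ^ 2 * (‖-x - y‖ : ℂ) ^ 2 / b)‖ ≤ 1 := by
      rw [Complex.norm_exp, Real.exp_le_one_iff]
      have : (-(Real.pi : ℂ) ^ 2 * (‖-x - y‖ : ℂ) ^ 2 / b) =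
          ((-(Real.pi ^ 2 * ‖-x - y‖ ^ 2) : ℝ) : ℂ) * b⁻¹ := by
        push_cast; ring
      rw [this, Complex.re_ofReal_mul, Complex.inv_re]
      have : 0 ≤ b.re / Complex.normSq b := div_nonneg hb.le (Complex.normSq_nonneg b)
      have h3 : 0 ≤ Real.pi ^ 2 * ‖-x - y‖ ^ 2 := by positivity
      nlinarith [mul_nonneg h3 this]
    rw [h1]
    exact mul_le_of_le_one_right (by positivity) h2
  have e : ∫ ξ : V, Complex.exp (-b * ‖ξ‖ ^ 2) * (𝓕 f ξ * 𝓕 g ξ) =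
      ∫ x, f x * 𝓕 (fun ξ : V ↦ Complex.exp (-b * ‖ξ‖ ^ 2) * 𝓕 g ξ) x := by
    rw [← integral_fourier_mul_eq_of_integrable hf hGg]
    refine integral_congr_ae (Filter.Eventually.of_forall fun ξ ↦ ?_)
    ring
  rw [e]
  calc _ ≤ ∫ x, ‖f x‖ * (D * ∫ y, ‖g y‖) := by
        refine norm_integral_le_of_norm_le (hf.norm.mul_const _) (Filter.Eventually.of_forall fun x ↦ ?_)
        rw [norm_mul]
        gcongr
        exact inner x
    _ = _ := by rw [integral_mul_const]; ring

/-- The constant depends only on |b|, so b may be approached by b + 1/(n+1); this reaches the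
Schrödinger case Re b = 0. Integrability of the product of transforms supplies the dominating
function. -/
theorem norm_integral_gaussian_mul_fourier_mul_fourier_le {f g : V → ℂ} (hf : Integrable f)
    (hg : Integrable g) (hfg : Integrable fun ξ ↦ 𝓕 f ξ * 𝓕 g ξ) {b : ℂ} (hb : 0 ≤ b.re)
    (hb0 : b ≠ 0) :
    ‖∫ ξ : V, Complex.exp (-b * ‖ξ‖ ^ 2) * (𝓕 f ξ * 𝓕 g ξ)‖ ≤
      (Real.pi / ‖b‖) ^ (Module.finrank ℝ V / 2 : ℝ) * ((∫ x, ‖f x‖) * ∫ x, ‖g x‖) := by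
  have hε : Filter.Tendsto (fun n : ℕ ↦ b + ((1 / ((n : ℝ) + 1) : ℝ) : ℂ)) Filter.atTop (nhds b) := by
    have h := (Complex.continuous_ofReal.tendsto _).comp (tendsto_one_div_add_atTop_nhds_zero_nat (𝕜 := ℝ))
    simpa [Function.comp_def] using (tendsto_const_nhds (x := b)).add h
  have hre : ∀ n : ℕ, 0 < (b + ((1 / ((n : ℝ) + 1) : ℝ) : ℂ)).re := fun n ↦ by
    rw [Complex.add_re, Complex.ofReal_re]
    positivity
  have hL : Filter.Tendsto (fun n : ℕ ↦ ‖∫ ξ : V, Complex.exp (-(b + ((1 / ((n : ℝ) + 1) : ℝ) : ℂ)) * ‖ξ‖ ^ 2) *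
      (𝓕 f ξ * 𝓕 g ξ)‖) Filter.atTop (nhds ‖∫ ξ : V, Complex.exp (-b * ‖ξ‖ ^ 2) * (𝓕 f ξ * 𝓕 g ξ)‖) := by
    refine Filter.Tendsto.norm (tendsto_integral_of_dominated_convergence (fun ξ ↦ ‖𝓕 f ξ * 𝓕 g ξ‖) 
      (fun n ↦ ?_) hfg.norm (fun n ↦ Filter.Eventually.of_forall fun ξ ↦ ?_)
      (Filter.Eventually.of_forall fun ξ ↦ ?_))
    · exact (Continuous.aestronglyMeasurable (by fun_prop)).mul hfg.aestronglyMeasurable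
    · rw [norm_mul]
      refine mul_le_of_le_one_left (norm_nonneg _) ?_
      rw [Complex.norm_exp, Real.exp_le_one_iff, ← Complex.ofReal_pow, Complex.re_mul_ofReal,
        Complex.neg_re]
      have := (hre n).le
      nlinarith [sq_nonneg ‖ξ‖, mul_nonneg this (sq_nonneg ‖ξ‖)]
    · have : Continuous fun b : ℂ ↦ Complex.exp (-b * ‖ξ‖ ^ 2) * (𝓕 f ξ * 𝓕 g ξ) := by fun_prop
      exact (this.tendsto b).comp hε
  have hR : Filter.Tendsto (fun n : ℕ ↦ (Real.pi / ‖b + ((1 / ((n : ℝ) + 1) : ℝ) : ℂ)‖) ^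
      (Module.finrank ℝ V / 2 : ℝ) * ((∫ x, ‖f x‖) * ∫ x, ‖g x‖)) Filter.atTop
      (nhds ((Real.pi / ‖b‖) ^ (Module.finrank ℝ V / 2 : ℝ) * ((∫ x, ‖f x‖) * ∫ x, ‖g x‖))) := by
    refine Filter.Tendsto.mul_const _ (Filter.Tendsto.rpow_const ?_ (Or.inr (by positivity)))
    exact tendsto_const_nhds.div hε.norm (norm_ne_zero_iff.2 hb0)
  exact le_of_tendsto_of_tendsto' hL hR fun n ↦
    norm_integral_gaussian_mul_fourier_mul_fourier_le_of_pos hf hg (hre n)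

end Dispersive

/-- Subordination of `exp (-a λ²)` to the exponentials `exp (i z λ)`, along a contour in the upper
half plane that avoids the origin. -/
theorem exp_neg_mul_sq_eq_contour {a : ℂ} (ha : 0 < a.re) (l : ℝ) :
    (4 * Real.pi * a) ^ (1 / 2 : ℂ) * Complex.exp (-a * l ^ 2) =
      (∫ τ in Iic (-1 : ℝ), Complex.exp (-(τ : ℂ) ^ 2 / (4 * a)) * Complex.exp (Complex.I * τ * l)) +
      ((∫ x in (-1 : ℝ)..1, Complex.exp (-(x + Complex.I) ^ 2 / (4 * a)) *
          Complex.exp (Complex.I * (x + Complex.I) * l)) -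
        Complex.I * (∫ y in (0 : ℝ)..1, Complex.exp (-(1 + y * Complex.I) ^ 2 / (4 * a)) *
          Complex.exp (Complex.I * (1 + y * Complex.I) * l)) +
        Complex.I * (∫ y in (0 : ℝ)..1, Complex.exp (-(-1 + y * Complex.I) ^ 2 / (4 * a)) *
          Complex.exp (Complex.I * (-1 + y * Complex.I) * l))) +
      (∫ τ in Ioi (1 : ℝ), Complex.exp (-(τ : ℂ) ^ 2 / (4 * a)) * Complex.exp (Complex.I * τ * l)) := by
  have ha0 : a ≠ 0 := by rintro rfl; simp at ha
  have hb : 0 < (1 / (4 * a)).re := by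
    rw [one_div, Complex.inv_re]
    have : (4 * a).re = 4 * a.re := by simp
    rw [this]
    exact div_pos (by linarith) (Complex.normSq_pos.2 (by simpa using ha0))
  set F : ℂ → ℂ := fun z ↦ Complex.exp (-z ^ 2 / (4 * a)) * Complex.exp (Complex.I * z * l) with hF
  -- The Gaussian with parameter 1/(4a) has exp(-a l²), up to the factor on the left, as its
  -- transform; this is the formula along the whole real line.
  have h1 := fourierIntegral_gaussian hb l
  have e1 : ∀ x : ℝ, Complex.exp (Complex.I * l * x) * Complex.exp (-(1 / (4 * a)) * x ^ 2) = F x := by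
    intro x
    rw [hF, mul_comm]
    congr 2 <;> ring
  simp_rw [e1] at h1
  have e2 : (Real.pi / (1 / (4 * a)) : ℂ) = 4 * Real.pi * a := by
    rw [div_div_eq_mul_div]; ring
  have e3 : -(l : ℂ) ^ 2 / (4 * (1 / (4 * a))) = -a * l ^ 2 := by field_simp
  rw [e2, e3] at h1
  have hFint : Integrable fun x : ℝ ↦ F x := by
    have h2 : Integrable fun x : ℝ ↦ Complex.exp (-(x : ℂ) ^ 2 / (4 * a)) := by
      have h3 := integrable_cexp_neg_mul_sq hb
      refine h3.congr (Filter.Eventually.of_forall fun x ↦ ?_)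
      dsimp only
      congr 1; ring
    refine h2.mul_bdd (c := 1) (Continuous.aestronglyMeasurable (by fun_prop))
      (Filter.Eventually.of_forall fun x ↦ ?_)
    rw [mul_assoc, mul_comm, ← Complex.ofReal_mul, Complex.norm_exp_ofReal_mul_I]
  have hsplit : ∫ x : ℝ, F x = (∫ τ in Iic (-1 : ℝ), F τ) + (∫ x in (-1 : ℝ)..1, F x) +
      ∫ τ in Ioi (1 : ℝ), F τ := by
    rw [add_assoc, intervalIntegral.integral_interval_add_Ioi hFint.integrableOn hFint.integrableOn,
      intervalIntegral.integral_Iic_add_Ioi hFint.integrableOn hFint.integrableOn]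
  -- Cauchy's theorem on the rectangle with corners ±1 and ±1 + i replaces the segment [-1, 1] by
  -- the other three sides.
  have hrect := Complex.integral_boundary_rect_eq_zero_of_differentiableOn F (-1) (1 + Complex.I)
    (by intro z _; exact DifferentiableAt.differentiableWithinAt (by rw [hF]; fun_prop))
  simp at hrect
  rw [← h1, hsplit]
  congr 2
  linear_combination hrect

/-- Fubini, legitimate because |exp(iγl)| ≤ 1 when Im γ ≥ 0 and l ≥ 0. The bound B is imposed only
after integrating in ξ, since the decay in γ comes from that integral. -/
theorem norm_integral_path_le {V : Type*} [MeasurableSpace V] {μ : Measure V} [SFinite μ]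
    {h : V → ℂ} (hh : Integrable h μ) {l : V → ℝ} (hl : Measurable l)
    (hl0 : ∀ ξ, 0 ≤ l ξ) {S : Set ℝ} (hS : MeasurableSet S) {γ w : ℝ → ℂ} (hγ : Continuous γ)
    (hw : Continuous w) (hwi : IntegrableOn w S) (hγ0 : ∀ τ ∈ S, 0 ≤ (γ τ).im)
    {B : ℝ → ℝ} (hBi : IntegrableOn B S)
    (hB : ∀ τ ∈ S, ‖w τ‖ * ‖∫ ξ, Complex.exp (Complex.I * γ τ * l ξ) * h ξ ∂μ‖ ≤ B τ) :
    Integrable (fun ξ ↦ (∫ τ in S, w τ * Complex.exp (Complex.I * γ τ * l ξ)) * h ξ) μ ∧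
    ‖∫ ξ, (∫ τ in S, w τ * Complex.exp (Complex.I * γ τ * l ξ)) * h ξ ∂μ‖ ≤ ∫ τ in S, B τ := by
  have hint : Integrable (fun z : V × ℝ ↦ w z.2 * Complex.exp (Complex.I * γ z.2 * l z.1) * h z.1)
      (μ.prod (volume.restrict S)) := by
    have h1 := hh.mul_prod hwi
    refine h1.mono ?_ ?_
    · refine AEStronglyMeasurable.mul (Measurable.aestronglyMeasurable ?_) hh.1.comp_fst
      have := hγ.measurable
      have := hw.measurable
      fun_prop
    · have : ∀ᵐ z ∂μ.prod (volume.restrict S), z.2 ∈ S := by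
        have : ∀ᵐ τ ∂(volume.restrict S), τ ∈ S := ae_restrict_mem hS
        exact Measure.quasiMeasurePreserving_snd.ae this
      filter_upwards [this] with z hz
      rw [norm_mul, norm_mul, norm_mul, mul_comm ‖h z.1‖]
      gcongr
      refine mul_le_of_le_one_right (norm_nonneg _) ?_
      rw [Complex.norm_exp, Real.exp_le_one_iff, Complex.re_mul_ofReal, Complex.I_mul_re]
      nlinarith [hγ0 _ hz, hl0 z.1, mul_nonneg (hγ0 _ hz) (hl0 z.1)]
  have e1 : ∀ ξ, (∫ τ in S, w τ * Complex.exp (Complex.I * γ τ * l ξ)) * h ξ =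
      ∫ τ in S, w τ * Complex.exp (Complex.I * γ τ * l ξ) * h ξ := fun ξ ↦
    (integral_mul_const _ _).symm
  simp_rw [e1]
  refine ⟨hint.integral_prod_left, ?_⟩
  rw [integral_integral_swap hint]
  refine norm_integral_le_of_norm_le hBi ?_
  filter_upwards [ae_restrict_mem hS] with τ hτ
  refine le_trans (le_of_eq ?_) (hB τ hτ)
  rw [← norm_mul, ← integral_const_mul]
  simp_rw [mul_assoc]

theorem norm_exp_neg_sq_div_le {a z : ℂ} (ha : 1 ≤ ‖a‖) (hz : ‖z‖ ^ 2 ≤ 4) :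
    ‖Complex.exp (-z ^ 2 / (4 * a))‖ ≤ Real.exp 1 := by
  rw [Complex.norm_exp, Real.exp_le_exp]
  refine (Complex.re_le_norm _).trans ?_
  rw [norm_div, norm_neg, norm_pow, norm_mul, div_le_one (by
    have : 0 < ‖a‖ := by linarith
    simpa using this)]
  simp only [Complex.norm_ofNat]
  linarith

theorem norm_exp_neg_ofReal_sq_div_le {a : ℂ} (ha : 0 ≤ a.re) (τ : ℝ) :
    ‖Complex.exp (-(τ : ℂ) ^ 2 / (4 * a))‖ ≤ 1 := by
  rw [Complex.norm_exp, Real.exp_le_one_iff]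
  have : -(τ : ℂ) ^ 2 / (4 * a) = ((-(τ ^ 2 / 4) : ℝ) : ℂ) * a⁻¹ := by
    push_cast; rw [div_eq_mul_inv, mul_inv]; ring
  rw [this, Complex.re_ofReal_mul, Complex.inv_re]
  have h1 : 0 ≤ a.re / Complex.normSq a := div_nonneg ha (Complex.normSq_nonneg a)
  have h2 : 0 ≤ τ ^ 2 / 4 := by positivity
  nlinarith [mul_nonneg h2 h1]

/-- If the multipliers `exp (i z l)` decay like `|z|^(-e)` with `e > 1` in the upper half plane, the
multipliers `exp (-a l²)` are bounded uniformly in `a`. -/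
theorem norm_integral_exp_neg_mul_sq_le {V : Type*} [MeasurableSpace V] {μ : Measure V} [SFinite μ]
    {h : V → ℂ} (hh : Integrable h μ) {l : V → ℝ} (hl : Measurable l)
    (hl0 : ∀ ξ, 0 ≤ l ξ) {e D : ℝ} (he : 1 < e) (hD : 0 ≤ D)
    (hdec : ∀ z : ℂ, 0 ≤ z.im → z ≠ 0 →
      ‖∫ ξ, Complex.exp (Complex.I * z * l ξ) * h ξ ∂μ‖ ≤ D * ‖z‖ ^ (-e))
    {a : ℂ} (ha : 0 < a.re) (ha1 : 1 ≤ ‖a‖) :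
    ‖∫ ξ, Complex.exp (-a * (l ξ : ℂ) ^ 2) * h ξ ∂μ‖ ≤ D * (2 / (e - 1) + 4 * Real.exp 1) := by
  have ha0 : a ≠ 0 := by rintro rfl; simp at ha
  have hb : 0 < (1 / (4 * a)).re := by
    rw [one_div, Complex.inv_re]
    have : (4 * a).re = 4 * a.re := by simp
    rw [this]
    exact div_pos (by linarith) (Complex.normSq_pos.2 (by simpa using ha0))
  have hwint : Integrable fun x : ℝ ↦ Complex.exp (-(x : ℂ) ^ 2 / (4 * a)) := by
    refine (integrable_cexp_neg_mul_sq hb).congr (Filter.Eventually.of_forall fun x ↦ ?_)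
    dsimp only
    congr 1; ring
  -- Here e > 1 is needed: the two unbounded rays contribute D/(e-1) each.
  have hIoi : IntegrableOn (fun τ : ℝ ↦ D * τ ^ (-e)) (Ioi 1) :=
    (integrableOn_Ioi_rpow_of_lt (by linarith) one_pos).const_mul D
  have hIoiv : ∫ τ in Ioi (1 : ℝ), D * τ ^ (-e) = D * (1 / (e - 1)) := by
    rw [integral_const_mul, integral_Ioi_rpow_of_lt (by linarith) one_pos, Real.one_rpow]
    congr 1
    rw [show -e + 1 = -(e - 1) by ring, neg_div_neg_eq]
  have hIic : IntegrableOn (fun τ : ℝ ↦ D * (-τ) ^ (-e)) (Iic (-1)) :=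
    by
    have := (Measure.measurePreserving_neg (volume : Measure ℝ)).integrableOn_comp_preimage
      (MeasurableEquiv.neg ℝ).measurableEmbedding (f := fun τ : ℝ ↦ D * τ ^ (-e)) (s := Ici 1)
    have h2 := this.2 ((integrableOn_Ici_iff_integrableOn_Ioi).2 hIoi)
    simpa [Function.comp_def] using h2
  have hIicv : ∫ τ in Iic (-1 : ℝ), D * (-τ) ^ (-e) = D * (1 / (e - 1)) := by
    rw [← hIoiv, ← integral_comp_neg_Ioi]
    simp
  have p1 := norm_integral_path_le (μ := μ) hh hl hl0 (S := Iic (-1)) measurableSet_Iic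
    (γ := fun τ ↦ (τ : ℂ)) (w := fun τ ↦ Complex.exp (-(τ : ℂ) ^ 2 / (4 * a)))
    (by fun_prop) (by fun_prop) hwint.integrableOn (by simp) hIic (by
      intro τ hτ
      have hτ : τ ≤ -1 := hτ
      refine (mul_le_of_le_one_left (norm_nonneg _) (norm_exp_neg_ofReal_sq_div_le ha.le τ)).trans ?_
      have := hdec (τ : ℂ) (by simp) (by simp; linarith)
      rwa [Complex.norm_real, Real.norm_of_nonpos (by linarith)] at this)
  have p2 := norm_integral_path_le (μ := μ) hh hl hl0 (S := Ioi 1) measurableSet_Ioi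
    (γ := fun τ ↦ (τ : ℂ)) (w := fun τ ↦ Complex.exp (-(τ : ℂ) ^ 2 / (4 * a)))
    (by fun_prop) (by fun_prop) hwint.integrableOn (by simp) hIoi (by
      intro τ hτ
      have hτ : 1 < τ := hτ
      refine (mul_le_of_le_one_left (norm_nonneg _) (norm_exp_neg_ofReal_sq_div_le ha.le τ)).trans ?_
      have := hdec (τ : ℂ) (by simp) (by simp; linarith)
      rwa [Complex.norm_real, Real.norm_of_nonneg (by linarith)] at this)
  have seg : ∀ (γ : ℝ → ℂ) (s t : ℝ), s ≤ t → Continuous γ → (∀ τ ∈ Ioc s t, 0 ≤ (γ τ).im) →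
      (∀ τ ∈ Ioc s t, 1 ≤ ‖γ τ‖ ^ 2) → (∀ τ ∈ Ioc s t, ‖γ τ‖ ^ 2 ≤ 4) →
      Integrable (fun ξ ↦ (∫ τ in s..t, Complex.exp (-(γ τ) ^ 2 / (4 * a)) *
        Complex.exp (Complex.I * γ τ * l ξ)) * h ξ) μ ∧
      ‖∫ ξ, (∫ τ in s..t, Complex.exp (-(γ τ) ^ 2 / (4 * a)) *
        Complex.exp (Complex.I * γ τ * l ξ)) * h ξ ∂μ‖ ≤ (t - s) * (D * Real.exp 1) := by
    intro γ s t hst hγ hγ0 hγ1 hγ2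
    simp_rw [intervalIntegral.integral_of_le hst]
    have := norm_integral_path_le (μ := μ) hh hl hl0 (S := Ioc s t) measurableSet_Ioc
      (γ := γ) (w := fun τ ↦ Complex.exp (-(γ τ) ^ 2 / (4 * a))) (B := fun _ ↦ D * Real.exp 1)
      hγ (by fun_prop) ((Continuous.integrableOn_Icc (by fun_prop)).mono_set Ioc_subset_Icc_self)
      hγ0 (integrableOn_const (by simp)) (by
        intro τ hτ
        have h1 : 1 ≤ ‖γ τ‖ := by nlinarith [hγ1 τ hτ, norm_nonneg (γ τ)]
        have h2 := hdec (γ τ) (hγ0 τ hτ) (by rw [← norm_pos_iff]; linarith)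
        have h3 : ‖γ τ‖ ^ (-e) ≤ 1 := Real.rpow_le_one_of_one_le_of_nonpos h1 (by linarith)
        rw [mul_comm]
        refine mul_le_mul (h2.trans (mul_le_of_le_one_right hD h3))
          (norm_exp_neg_sq_div_le ha1 (hγ2 τ hτ)) (norm_nonneg _) hD)
    refine ⟨this.1, this.2.trans_eq ?_⟩
    rw [setIntegral_const]
    simp [hst]
  -- The three sides have lengths 2, 1, 1 and stay in 1 ≤ |z|² ≤ 2, where the decay factor is at
  -- most 1 and the weight at most exp 1. This is the term 4 exp 1.
  have q1 := seg (fun x ↦ x + Complex.I) (-1) 1 (by norm_num) (by fun_prop) (by simp)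
    (fun τ hτ ↦ by
      rw [← Complex.normSq_eq_norm_sq, Complex.normSq_apply]; simp; nlinarith [mul_self_nonneg τ])
    (fun τ hτ ↦ by
      rw [← Complex.normSq_eq_norm_sq, Complex.normSq_apply]; simp; nlinarith [hτ.1, hτ.2])
  have q2 := seg (fun y ↦ 1 + y * Complex.I) 0 1 (by norm_num) (by fun_prop)
    (fun τ hτ ↦ by simpa using hτ.1.le)
    (fun τ hτ ↦ by
      rw [← Complex.normSq_eq_norm_sq, Complex.normSq_apply]; simp; nlinarith [mul_self_nonneg τ])
    (fun τ hτ ↦ by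
      rw [← Complex.normSq_eq_norm_sq, Complex.normSq_apply]; simp; nlinarith [hτ.1, hτ.2])
  have q3 := seg (fun y ↦ -1 + y * Complex.I) 0 1 (by norm_num) (by fun_prop)
    (fun τ hτ ↦ by simpa using hτ.1.le)
    (fun τ hτ ↦ by
      rw [← Complex.normSq_eq_norm_sq, Complex.normSq_apply]; simp; nlinarith [mul_self_nonneg τ])
    (fun τ hτ ↦ by
      rw [← Complex.normSq_eq_norm_sq, Complex.normSq_apply]; simp; nlinarith [hτ.1, hτ.2])
  have key : (4 * Real.pi * a) ^ (1 / 2 : ℂ) * ∫ ξ, Complex.exp (-a * (l ξ : ℂ) ^ 2) * h ξ ∂μ =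
      (∫ ξ, (∫ τ in Iic (-1 : ℝ), Complex.exp (-(τ : ℂ) ^ 2 / (4 * a)) *
        Complex.exp (Complex.I * τ * l ξ)) * h ξ ∂μ) +
      ((∫ ξ, (∫ x in (-1 : ℝ)..1, Complex.exp (-(x + Complex.I) ^ 2 / (4 * a)) *
          Complex.exp (Complex.I * (x + Complex.I) * l ξ)) * h ξ ∂μ) -
        Complex.I * (∫ ξ, (∫ y in (0 : ℝ)..1, Complex.exp (-(1 + y * Complex.I) ^ 2 / (4 * a)) *
          Complex.exp (Complex.I * (1 + y * Complex.I) * l ξ)) * h ξ ∂μ) +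
        Complex.I * (∫ ξ, (∫ y in (0 : ℝ)..1, Complex.exp (-(-1 + y * Complex.I) ^ 2 / (4 * a)) *
          Complex.exp (Complex.I * (-1 + y * Complex.I) * l ξ)) * h ξ ∂μ)) +
      (∫ ξ, (∫ τ in Ioi (1 : ℝ), Complex.exp (-(τ : ℂ) ^ 2 / (4 * a)) *
        Complex.exp (Complex.I * τ * l ξ)) * h ξ ∂μ) := by
    have aux : ∀ A B C D E : V → ℂ, Integrable A μ → Integrable B μ → Integrable C μ → Integrable D μ →
        Integrable E μ → ∫ ξ, (A ξ + (B ξ - Complex.I * C ξ + Complex.I * D ξ) + E ξ) ∂μ =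
        (∫ ξ, A ξ ∂μ) + ((∫ ξ, B ξ ∂μ) - Complex.I * (∫ ξ, C ξ ∂μ) + Complex.I * (∫ ξ, D ξ ∂μ)) +
          ∫ ξ, E ξ ∂μ := by
      intro A B C D E hA hB hC hD hE
      have hC' := hC.const_mul Complex.I
      have hD' := hD.const_mul Complex.I
      have h1 : Integrable (fun ξ ↦ B ξ - Complex.I * C ξ) μ := hB.sub hC'
      have h2 : Integrable (fun ξ ↦ B ξ - Complex.I * C ξ + Complex.I * D ξ) μ := h1.add hD'
      have h3 : Integrable (fun ξ ↦ A ξ + (B ξ - Complex.I * C ξ + Complex.I * D ξ)) μ := hA.add h2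
      rw [integral_add h3 hE, integral_add hA h2, integral_add h1 hD', integral_sub hB hC',
        integral_const_mul, integral_const_mul]
    rw [← integral_const_mul, ← aux _ _ _ _ _ p1.1 q1.1 q2.1 q3.1 p2.1]
    refine integral_congr_ae (Filter.Eventually.of_forall fun ξ ↦ ?_)
    dsimp only
    rw [← mul_assoc, exp_neg_mul_sq_eq_contour ha (l ξ)]
    ring
  -- Since |a| ≥ 1, the prefactor has modulus at least 1 and can be dropped.
  have hc : 1 ≤ ‖(4 * Real.pi * a : ℂ) ^ (1 / 2 : ℂ)‖ := by
    have := Complex.norm_cpow_real (4 * Real.pi * a) (1 / 2)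
    push_cast at this
    rw [this]
    refine Real.one_le_rpow ?_ (by norm_num)
    rw [norm_mul, norm_mul, Complex.norm_real, Real.norm_of_nonneg Real.pi_pos.le]
    simp only [Complex.norm_ofNat]
    nlinarith [Real.pi_gt_three, mul_le_mul Real.pi_gt_three.le ha1 (by norm_num) Real.pi_pos.le]
  calc _ ≤ ‖(4 * Real.pi * a : ℂ) ^ (1 / 2 : ℂ)‖ * ‖∫ ξ, Complex.exp (-a * (l ξ : ℂ) ^ 2) * h ξ ∂μ‖ :=
        le_mul_of_one_le_left (norm_nonneg _) hc
    _ ≤ D * (1 / (e - 1)) + ((1 - -1) * (D * Real.exp 1) + (1 - 0) * (D * Real.exp 1) +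
        (1 - 0) * (D * Real.exp 1)) + D * (1 / (e - 1)) := by
      rw [← norm_mul, key]
      refine (norm_add_le _ _).trans (add_le_add ((norm_add_le _ _).trans (add_le_add
        (p1.2.trans_eq hIicv) ((norm_add_le _ _).trans (add_le_add ((norm_sub_le _ _).trans
          (add_le_add q1.2 ?_)) ?_)))) (p2.2.trans_eq hIoiv))
      · rw [norm_mul, Complex.norm_I, one_mul]; exact q2.2
      · rw [norm_mul, Complex.norm_I, one_mul]; exact q3.2
    _ = _ := by ring

/-- The dispersive estimate for `e^{itΔ²}`, in bilinear form. -/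
theorem norm_integral_biharmonicSymbol_mul_fourier_le {d : ℕ} (hd : 3 ≤ d) : ∃ C : ℝ, 0 < C ∧
    ∀ (t : ℝ) (f g : EuclideanSpace ℝ (Fin d) → ℂ), t ≠ 0 → Integrable f → Integrable g →
      Integrable (fun ξ ↦ 𝓕 f ξ * 𝓕 g ξ) →
      ‖∫ ξ, biharmonicSymbol d t ξ * (𝓕 f ξ * 𝓕 g ξ)‖ ≤
        C * |t| ^ (-(d / 4 : ℝ)) * ((∫ x, ‖f x‖) * ∫ x, ‖g x‖) := by
  have he : (1 : ℝ) < d / 2 := by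
    have : (3 : ℝ) ≤ d := by exact_mod_cast hd
    linarith
  refine ⟨(Real.pi / (2 * Real.pi) ^ 2) ^ (d / 2 : ℝ) * (2 / ((d : ℝ) / 2 - 1) + 4 * Real.exp 1),
    by have : 0 < (d : ℝ) / 2 - 1 := by linarith
       positivity, fun t f g ht hf hg hfg ↦ ?_⟩
  have ht' : 0 < |t| := abs_pos.2 ht
  -- Chosen so that (σ|ξ|²)² = |t||2πξ|⁴. The factor σ^{-d/2} from the Gaussian bound then becomes
  -- the decay |t|^{-d/4}.
  set σ : ℝ := √|t| * (2 * Real.pi) ^ 2 with hσ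
  have hσ0 : 0 < σ := by positivity
  set K := (∫ x, ‖f x‖) * ∫ x, ‖g x‖ with hK
  have hK0 : 0 ≤ K := by positivity
  have hdec : ∀ z : ℂ, 0 ≤ z.im → z ≠ 0 →
      ‖∫ ξ : EuclideanSpace ℝ (Fin d), Complex.exp (Complex.I * z * (σ * ‖ξ‖ ^ 2 : ℝ)) * (𝓕 f ξ * 𝓕 g ξ)‖ ≤
        (Real.pi / σ) ^ (d / 2 : ℝ) * K * ‖z‖ ^ (-(d / 2 : ℝ)) := by
    intro z hz hz0
    have h1 := norm_integral_gaussian_mul_fourier_mul_fourier_le hf hg hfg (b := -(Complex.I * z * σ))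
      (by rw [Complex.neg_re, Complex.re_mul_ofReal, Complex.I_mul_re]; nlinarith)
      (by simp [hz0, hσ0.ne'])
    rw [finrank_euclideanSpace_fin] at h1
    have e1 : ∀ ξ : EuclideanSpace ℝ (Fin d), Complex.exp (-(-(Complex.I * z * σ)) * ‖ξ‖ ^ 2) =
        Complex.exp (Complex.I * z * (σ * ‖ξ‖ ^ 2 : ℝ)) := by
      intro ξ; congr 1; push_cast; ring
    simp_rw [e1] at h1
    refine h1.trans_eq ?_
    have e2 : ‖-(Complex.I * z * σ)‖ = ‖z‖ * σ := by
      simp [abs_of_pos hσ0]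
    rw [e2, Real.rpow_neg (norm_nonneg _), show Real.pi / (‖z‖ * σ) = (Real.pi / σ) / ‖z‖ by
      field_simp, Real.div_rpow (by positivity) (norm_nonneg _)]
    ring
  obtain ⟨sg, hsg, htsg⟩ : ∃ sg : ℝ, |sg| = 1 ∧ t = sg * |t| := by
    rcases lt_or_gt_of_ne ht with h | h
    · exact ⟨-1, by simp, by rw [abs_of_neg h]; ring⟩
    · exact ⟨1, by simp, by rw [abs_of_pos h]; ring⟩
  -- The parameters a = 1/(n+1) - i sgn t have positive real part and modulus at least 1, and exp(-a
  -- l²) tends to exp(i sgn(t) l²), the biharmonic symbol. The bound is uniform in n.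
  have ha : ∀ n : ℕ, 0 < (((1 / ((n : ℝ) + 1) : ℝ) : ℂ) - sg * Complex.I).re := by
    intro n
    have : (((1 / ((n : ℝ) + 1) : ℝ) : ℂ) - sg * Complex.I).re = 1 / ((n : ℝ) + 1) := by
      rw [Complex.sub_re, Complex.ofReal_re]; simp
    rw [this]
    positivity
  have ha1 : ∀ n : ℕ, 1 ≤ ‖((1 / ((n : ℝ) + 1) : ℝ) : ℂ) - sg * Complex.I‖ := by
    intro n
    refine le_trans ?_ (Complex.abs_im_le_norm _)
    rw [Complex.sub_im, Complex.ofReal_im]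
    simp [hsg]
  have hbd := fun n : ℕ ↦ norm_integral_exp_neg_mul_sq_le hfg
    (l := fun ξ : EuclideanSpace ℝ (Fin d) ↦ σ * ‖ξ‖ ^ 2) (by fun_prop) (fun ξ ↦ by positivity) he
    (by positivity) hdec (ha n) (ha1 n)
  have hlim : Filter.Tendsto (fun n : ℕ ↦ ((1 / ((n : ℝ) + 1) : ℝ) : ℂ) - sg * Complex.I)
      Filter.atTop (nhds (-(sg * Complex.I))) := by
    have h := (Complex.continuous_ofReal.tendsto _).comp (tendsto_one_div_add_atTop_nhds_zero_nat (𝕜 := ℝ))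
    simpa [Function.comp_def] using h.sub (tendsto_const_nhds (x := (sg : ℂ) * Complex.I))
  have hL : Filter.Tendsto (fun n : ℕ ↦ ∫ ξ : EuclideanSpace ℝ (Fin d),
      Complex.exp (-(((1 / ((n : ℝ) + 1) : ℝ) : ℂ) - sg * Complex.I) *
        ((σ * ‖ξ‖ ^ 2 : ℝ) : ℂ) ^ 2) * (𝓕 f ξ * 𝓕 g ξ)) Filter.atTop
      (nhds (∫ ξ, biharmonicSymbol d t ξ * (𝓕 f ξ * 𝓕 g ξ))) := by
    refine tendsto_integral_of_dominated_convergence (fun ξ ↦ ‖𝓕 f ξ * 𝓕 g ξ‖)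
      (fun n ↦ ?_) hfg.norm (fun n ↦ Filter.Eventually.of_forall fun ξ ↦ ?_)
      (Filter.Eventually.of_forall fun ξ ↦ ?_)
    · exact (Continuous.aestronglyMeasurable (by fun_prop)).mul hfg.aestronglyMeasurable
    · rw [norm_mul]
      refine mul_le_of_le_one_left (norm_nonneg _) ?_
      rw [Complex.norm_exp, Real.exp_le_one_iff, ← Complex.ofReal_pow, Complex.re_mul_ofReal,
        Complex.neg_re]
      have := (ha n).le
      nlinarith [mul_nonneg this (sq_nonneg (σ * ‖ξ‖ ^ 2))]
    · have : Continuous fun b : ℂ ↦ Complex.exp (-b * ((σ * ‖ξ‖ ^ 2 : ℝ) : ℂ) ^ 2) * (𝓕 f ξ * 𝓕 g ξ) := by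
        fun_prop
      have h2 := (this.tendsto _).comp hlim
      have h3 : (t : ℝ) * (2 * Real.pi * ‖ξ‖) ^ 4 = sg * (σ * ‖ξ‖ ^ 2) ^ 2 := by
        have h4 : σ ^ 2 = |t| * (2 * Real.pi) ^ 4 := by
          rw [hσ, mul_pow, Real.sq_sqrt (abs_nonneg t)]; ring
        rw [mul_pow σ, h4]
        conv_lhs => rw [htsg]
        ring
      have h5 : biharmonicSymbol d t ξ = 
          Complex.exp (- -(sg * Complex.I) * ((σ * ‖ξ‖ ^ 2 : ℝ) : ℂ) ^ 2) := by
        simp only [biharmonicSymbol]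
        rw [h3]
        congr 1
        push_cast
        ring
      rw [h5]
      exact h2
  refine le_of_tendsto hL.norm (Filter.Eventually.of_forall fun n ↦ (hbd n).trans_eq ?_)
  have e3 : (Real.pi / σ) ^ (d / 2 : ℝ) = (Real.pi / (2 * Real.pi) ^ 2) ^ (d / 2 : ℝ) * |t| ^ (-(d / 4 : ℝ)) := by
    rw [hσ, show Real.pi / (√|t| * (2 * Real.pi) ^ 2) = Real.pi / (2 * Real.pi) ^ 2 * |t| ^ (-(1 / 2) : ℝ) by
      rw [Real.rpow_neg ht'.le, ← Real.sqrt_eq_rpow]; field_simp,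
      Real.mul_rpow (by positivity) (by positivity), ← Real.rpow_mul ht'.le]
    congr 2; ring
  rw [e3]
  ring

/-! ### Riesz-Thorin interpolation -/

section RieszThorin

variable {α : Type*} [MeasurableSpace α] {μ : Measure α}

theorem Lp_coeFn_sum_smul_ae_eq {ι : Type*} (s : Finset ι) (c : ι → ℂ) (U : ι → Lp ℂ 2 μ) :
    ((∑ i ∈ s, c i • U i : Lp ℂ 2 μ) : α → ℂ) =ᵐ[μ] fun x ↦ ∑ i ∈ s, c i * (U i : α → ℂ) x := by
  classical
  induction s using Finset.induction_on with
  | empty =>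
    simp only [Finset.sum_empty]
    exact Lp.coeFn_zero ℂ 2 μ
  | insert i s his ih =>
    rw [Finset.sum_insert his]
    filter_upwards [Lp.coeFn_add (c i • U i) (∑ i ∈ s, c i • U i), Lp.coeFn_smul (c i) (U i), ih]
      with x h1 h2 h3
    rw [h1, Finset.sum_insert his, Pi.add_apply, h2, h3, Pi.smul_apply, smul_eq_mul]

/-- For simple f the family f|f|^{e-1} is a finite combination of fixed L² vectors, the indicators
of level sets, whose scalar coefficients are entire in e. The value 0 is left out because its level
set may have infinite measure. -/
theorem exists_sum_smul_ae_eq_mul_norm_cpow (f : SimpleFunc α ℂ) (hf : MemLp f 2 μ) :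
    ∃ (s : Finset ℂ) (U : ℂ → Lp ℂ 2 μ), (∀ a ∈ s, a ≠ 0) ∧ ∀ e : ℂ,
      ((∑ a ∈ s, (a * (‖a‖ : ℂ) ^ (e - 1)) • U a : Lp ℂ 2 μ) : α → ℂ) =ᵐ[μ]
        fun x ↦ f x * (‖f x‖ : ℂ) ^ (e - 1) := by
  classical
  refine ⟨f.range.filter (· ≠ 0), fun a ↦ if h : μ (f ⁻¹' {a}) ≠ ⊤ then
    indicatorConstLp 2 (f.measurableSet_preimage {a}) h 1 else 0, by simp, fun e ↦ ?_⟩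
  refine (Lp_coeFn_sum_smul_ae_eq _ _ _).trans ?_
  have hU : ∀ᵐ x ∂μ, ∀ a ∈ f.range.filter (· ≠ 0), ((if h : μ (f ⁻¹' {a}) ≠ ⊤ then
      indicatorConstLp 2 (f.measurableSet_preimage {a}) h (1 : ℂ) else 0 : Lp ℂ 2 μ) : α → ℂ) x =
      if f x = a then 1 else 0 := by
    rw [Filter.eventually_all_finset]
    intro a ha
    have ha0 : a ≠ 0 := (Finset.mem_filter.1 ha).2
    have hfin : μ (f ⁻¹' {a}) ≠ ⊤ :=
      (f.measure_preimage_lt_top_of_memLp (by simp) (by simp) hf a ha0).ne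
    rw [dif_pos hfin]
    filter_upwards [indicatorConstLp_coeFn (p := 2) (hs := f.measurableSet_preimage {a})
      (hμs := hfin) (c := (1 : ℂ))] with x hx
    rw [hx, indicator_apply]
    rfl
  filter_upwards [hU] with x hx
  rw [Finset.sum_congr rfl fun a ha ↦ by rw [hx a ha]]
  by_cases h0 : f x = 0
  · rw [h0, zero_mul]
    refine Finset.sum_eq_zero fun a ha ↦ ?_
    rw [if_neg (fun h ↦ (Finset.mem_filter.1 ha).2 h.symm), mul_zero]
  · rw [Finset.sum_eq_single (f x)]
    · simp
    · intro b _ hb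
      rw [if_neg (fun h ↦ hb h.symm), mul_zero]
    · intro h
      exact absurd (Finset.mem_filter.2 ⟨SimpleFunc.mem_range_self f x, h0⟩) h

theorem norm_mul_norm_cpow_sub_one (a : ℂ) {e : ℂ} (he : e.re ≠ 0) :
    ‖a * (‖a‖ : ℂ) ^ (e - 1)‖ = ‖a‖ ^ e.re := by
  by_cases ha : a = 0
  · simp [ha, Real.zero_rpow he]
  · have h : 0 < ‖a‖ := norm_pos_iff.2 ha
    rw [norm_mul, Complex.norm_cpow_eq_rpow_re_of_pos h, Complex.sub_re, Complex.one_re,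
      Real.rpow_sub_one h.ne']
    field_simp

/-- The three lines theorem is applied to z ↦ B(f|f|^{e(z)-1}, g|g|^{e(z)-1}). Both arguments move
together, from the L¹ bound on Re z = 0 to the L² bound on Re z = 1. -/
theorem riesz_thorin_simpleFunc (B : Lp ℂ 2 μ →ₗ[ℂ] Lp ℂ 2 μ →ₗ[ℂ] ℂ) {K : ℝ} (hK : 0 ≤ K)
    (h2 : ∀ f g, ‖B f g‖ ≤ ‖f‖ * ‖g‖)
    (h1 : ∀ f g : Lp ℂ 2 μ, Integrable f μ → Integrable g μ →
      ‖B f g‖ ≤ K * ((∫ x, ‖f x‖ ∂μ) * ∫ x, ‖g x‖ ∂μ))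
    {r r' : ℝ} (hr : 2 < r) (hrr : r.HolderConjugate r') (f g : SimpleFunc α ℂ)
    (hf : MemLp f 2 μ) (hg : MemLp g 2 μ) :
    ‖B (hf.toLp f) (hg.toLp g)‖ ≤ K ^ (1 - 2 / r) *
      ((eLpNorm f (ENNReal.ofReal r') μ).toReal * (eLpNorm g (ENNReal.ofReal r') μ).toReal) := by
  have hr0 : 0 < r := by linarith
  have hr'0 : 0 < r' := hrr.symm.pos
  have hr'1 : 1 < r' := hrr.symm.lt
  have hinv : r⁻¹ + r'⁻¹ = 1 := hrr.inv_add_inv_eq_one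
  obtain ⟨s, U, hs, hU⟩ := exists_sum_smul_ae_eq_mul_norm_cpow f hf
  obtain ⟨s', U', hs', hU'⟩ := exists_sum_smul_ae_eq_mul_norm_cpow g hg
  set v : ℂ → Lp ℂ 2 μ := fun e ↦ ∑ a ∈ s, (a * (‖a‖ : ℂ) ^ (e - 1)) • U a with hv
  set w : ℂ → Lp ℂ 2 μ := fun e ↦ ∑ a ∈ s', (a * (‖a‖ : ℂ) ^ (e - 1)) • U' a with hw
  have hLp : ∀ (f : SimpleFunc α ℂ), MemLp f 2 μ → MemLp f (ENNReal.ofReal r') μ := fun f hf ↦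
    (SimpleFunc.memLp_iff (by simpa using hr'0) ENNReal.ofReal_ne_top).2
      ((SimpleFunc.memLp_iff (by simp) (by simp)).1 hf)
  have hX : ∀ (f : SimpleFunc α ℂ), MemLp f 2 μ → (eLpNorm f (ENNReal.ofReal r') μ).toReal =
      (∫ x, ‖f x‖ ^ r' ∂μ) ^ r'⁻¹ := by
    intro f hf
    rw [(hLp f hf).eLpNorm_eq_integral_rpow_norm (by simpa using hr'0) ENNReal.ofReal_ne_top,
      ENNReal.toReal_ofReal hr'0.le, ENNReal.toReal_ofReal (by positivity)]
  -- The moduli are |f|^{r'} on Re z = 0 and |f|^{r'/2} on Re z = 1, so both boundary norms are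
  -- powers of ∫|f|^{r'}. At z = 2/r the exponent is 1 and f, g themselves reappear.
  set e : ℂ → ℂ := fun z ↦ r' * (1 - z / 2) with he
  have here : ∀ z, (e z).re = r' * (1 - z.re / 2) := by
    intro z
    simp [he]
  have nrm1 : ∀ (f : SimpleFunc α ℂ) (u : Lp ℂ 2 μ) (z : ℂ), MemLp f 2 μ → z.re = 0 →
      u =ᵐ[μ] (fun x ↦ f x * (‖f x‖ : ℂ) ^ (e z - 1)) → Integrable u μ ∧
      ∫ x, ‖u x‖ ∂μ = ∫ x, ‖f x‖ ^ r' ∂μ := by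
    intro f u z hf hz hu
    have h3 : ∀ᵐ x ∂μ, ‖u x‖ = ‖f x‖ ^ r' := by
      filter_upwards [hu] with x hx
      have : (e z).re = r' := by rw [here, hz]; ring
      rw [hx, norm_mul_norm_cpow_sub_one _ (by rw [this]; exact hr'0.ne'), this]
    refine ⟨?_, integral_congr_ae h3⟩
    rw [← integrable_norm_iff (Lp.aestronglyMeasurable u)]
    have := (hLp f hf).integrable_norm_rpow (by simpa using hr'0) ENNReal.ofReal_ne_top
    rw [ENNReal.toReal_ofReal hr'0.le] at this
    exact this.congr (h3.mono fun x hx ↦ hx.symm)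
  have nrm2 : ∀ (f : SimpleFunc α ℂ) (u : Lp ℂ 2 μ) (z : ℂ), MemLp f 2 μ → z.re = 1 →
      u =ᵐ[μ] (fun x ↦ f x * (‖f x‖ : ℂ) ^ (e z - 1)) →
      ‖u‖ = (∫ x, ‖f x‖ ^ r' ∂μ) ^ (2⁻¹ : ℝ) := by
    intro f u z hf hz hu
    rw [Lp.norm_def, (Lp.memLp u).eLpNorm_eq_integral_rpow_norm (by simp) (by simp),
      ENNReal.toReal_ofReal (by positivity)]
    simp only [ENNReal.toReal_ofNat]
    congr 1
    refine integral_congr_ae ?_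
    filter_upwards [hu] with x hx
    have : (e z).re = r' / 2 := by rw [here, hz]; ring
    rw [hx, norm_mul_norm_cpow_sub_one _ (by rw [this]; positivity), this,
      ← Real.rpow_mul (norm_nonneg _)]
    congr 1; ring
  set X := ∫ x, ‖f x‖ ^ r' ∂μ with hXdef
  set Y := ∫ x, ‖g x‖ ^ r' ∂μ with hYdef
  have hX0 : 0 ≤ X := by positivity
  have hY0 : 0 ≤ Y := by positivity
  set F : ℂ → ℂ := fun z ↦ B (v (e z)) (w (e z)) with hF
  have hFexp : F = fun z ↦ ∑ b ∈ s', ∑ a ∈ s, (a * (‖a‖ : ℂ) ^ (e z - 1)) *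
      (b * (‖b‖ : ℂ) ^ (e z - 1)) * B (U a) (U' b) := by
    funext z
    simp only [hF, hv, hw, map_sum, map_smul, LinearMap.sum_apply, LinearMap.smul_apply, smul_eq_mul,
      Finset.mul_sum]
    refine Finset.sum_congr rfl fun b _ ↦ Finset.sum_congr rfl fun a _ ↦ ?_
    ring
  have hpow : ∀ a : ℂ, a ≠ 0 → Differentiable ℂ fun z ↦ (‖a‖ : ℂ) ^ (e z - 1) := by
    intro a ha z
    refine DifferentiableAt.const_cpow (by rw [he]; fun_prop) (Or.inl ?_)
    simpa using ha
  have hdiff : Differentiable ℂ F := by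
    rw [hFexp]
    refine Differentiable.fun_sum fun b hb ↦ Differentiable.fun_sum fun a ha ↦ ?_
    have := hpow a (hs a ha)
    have := hpow b (hs' b hb)
    fun_prop
  have hcb : ∀ (a : ℂ) (z : ℂ), 0 ≤ z.re → z.re ≤ 1 →
      ‖a * (‖a‖ : ℂ) ^ (e z - 1)‖ ≤ (max 1 ‖a‖) ^ r' := by
    intro a z hz0 hz1
    have h3 : (e z).re ≤ r' := by rw [here]; nlinarith
    have h4 : 0 < (e z).re := by rw [here]; nlinarith
    rw [norm_mul_norm_cpow_sub_one _ h4.ne']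
    exact (Real.rpow_le_rpow (norm_nonneg _) (le_max_right _ _) h4.le).trans
      (Real.rpow_le_rpow_of_exponent_le (le_max_left _ _) h3)
  have hbdd : BddAbove ((norm ∘ F) '' Complex.HadamardThreeLines.verticalClosedStrip 0 1) := by
    refine ⟨∑ b ∈ s', ∑ a ∈ s, (max 1 ‖a‖) ^ r' * (max 1 ‖b‖) ^ r' * ‖B (U a) (U' b)‖, ?_⟩
    rintro _ ⟨z, hz, rfl⟩
    have hz : z.re ∈ Icc (0 : ℝ) 1 := hz
    simp only [Function.comp, hFexp]
    refine norm_sum_le_of_le _ fun b _ ↦ norm_sum_le_of_le _ fun a _ ↦ ?_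
    rw [norm_mul, norm_mul]
    gcongr
    · exact hcb a z hz.1 hz.2
    · exact hcb b z hz.1 hz.2
  have hθ : ((2 / r : ℝ) : ℂ) ∈ Complex.HadamardThreeLines.verticalClosedStrip 0 1 := by
    change ((2 / r : ℝ) : ℂ).re ∈ Icc (0 : ℝ) 1
    rw [Complex.ofReal_re]
    exact ⟨by positivity, by rw [div_le_one hr0]; exact hr.le⟩
  have main := Complex.HadamardThreeLines.norm_le_interp_of_mem_verticalClosedStrip₀₁' F hθ
    hdiff.diffContOnCl hbdd (a := K * (X * Y)) (b := X ^ (2⁻¹ : ℝ) * Y ^ (2⁻¹ : ℝ)) (by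
      intro z hz
      have hz : z.re = 0 := hz
      obtain ⟨i1, n1⟩ := nrm1 f (v (e z)) z hf hz (hU _)
      obtain ⟨i2, n2⟩ := nrm1 g (w (e z)) z hg hz (hU' _)
      have := h1 _ _ i1 i2
      rwa [n1, n2] at this) (by
      intro z hz
      have hz : z.re = 1 := hz
      have := h2 (v (e z)) (w (e z))
      rwa [nrm2 f _ z hf hz (hU _), nrm2 g _ z hg hz (hU' _)] at this)
  have hrel : r' * (1 - 1 / r) = 1 := by
    have : 1 - 1 / r = r'⁻¹ := by rw [one_div]; linarith
    rw [this, mul_inv_cancel₀ hr'0.ne']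
  have heθ : e ((2 / r : ℝ) : ℂ) = 1 := by
    calc e ((2 / r : ℝ) : ℂ) = ((r' * (1 - 1 / r) : ℝ) : ℂ) := by
          rw [he]; push_cast; ring
      _ = 1 := by rw [hrel]; simp
  have hvf : v (e ((2 / r : ℝ) : ℂ)) = hf.toLp f := by
    refine Lp.ext ((hU _).trans ?_)
    rw [heθ]
    filter_upwards [hf.coeFn_toLp] with x hx
    rw [hx]; simp
  have hwg : w (e ((2 / r : ℝ) : ℂ)) = hg.toLp g := by
    refine Lp.ext ((hU' _).trans ?_)
    rw [heθ]
    filter_upwards [hg.coeFn_toLp] with x hx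
    rw [hx]; simp
  simp only [hF] at main
  rw [hvf, hwg, Complex.ofReal_re] at main
  rw [hX f hf, hX g hg]
  refine main.trans_eq ?_
  have h2r : 0 ≤ 1 - 2 / r := by rw [sub_nonneg, div_le_one hr0]; exact hr.le
  have hXX : ∀ X : ℝ, 0 ≤ X → X ^ (1 - 2 / r) * (X ^ (2⁻¹ : ℝ)) ^ (2 / r) = X ^ r'⁻¹ := by
    intro X hX
    rw [← Real.rpow_mul hX, ← Real.rpow_add_of_nonneg hX h2r (by positivity)]
    congr 1
    have : r'⁻¹ = 1 - r⁻¹ := by linarith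
    rw [this]; ring
  rw [Real.mul_rpow hK (by positivity), Real.mul_rpow hX0 hY0, Real.mul_rpow (by positivity) (by positivity),
    ← hXX X hX0, ← hXX Y hY0]
  ring

theorem tendsto_toReal_eLpNorm_of_tendsto {p : ℝ≥0∞} (hp : 1 ≤ p) {f : α → ℂ} {F : ℕ → α → ℂ} (hf : MemLp f p μ)
    (hF : ∀ n, MemLp (F n) p μ)
    (h : Filter.Tendsto (fun n ↦ eLpNorm (F n - f) p μ) Filter.atTop (nhds 0)) :
    Filter.Tendsto (fun n ↦ (eLpNorm (F n) p μ).toReal) Filter.atTop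
      (nhds (eLpNorm f p μ).toReal) := by
  have : Fact (1 ≤ p) := ⟨hp⟩
  have h2 := (Lp.tendsto_Lp_iff_tendsto_eLpNorm'' F hF f hf).2 h
  simpa [Lp.norm_toLp] using h2.norm

/-- Riesz-Thorin interpolation between `L¹ × L¹` and `L² × L²` for bilinear forms. -/
theorem riesz_thorin (B : Lp ℂ 2 μ →ₗ[ℂ] Lp ℂ 2 μ →ₗ[ℂ] ℂ) {K : ℝ} (hK : 0 ≤ K)
    (h2 : ∀ f g, ‖B f g‖ ≤ ‖f‖ * ‖g‖)
    (h1 : ∀ f g : Lp ℂ 2 μ, Integrable f μ → Integrable g μ →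
      ‖B f g‖ ≤ K * ((∫ x, ‖f x‖ ∂μ) * ∫ x, ‖g x‖ ∂μ))
    {r r' : ℝ} (hr : 2 < r) (hrr : r.HolderConjugate r') (f g : Lp ℂ 2 μ)
    (hf : MemLp f (ENNReal.ofReal r') μ) (hg : MemLp g (ENNReal.ofReal r') μ) :
    ‖B f g‖ ≤ K ^ (1 - 2 / r) *
      ((eLpNorm f (ENNReal.ofReal r') μ).toReal * (eLpNorm g (ENNReal.ofReal r') μ).toReal) := by
  have hr'1 : 1 ≤ ENNReal.ofReal r' := by
    rw [← ENNReal.ofReal_one]; exact ENNReal.ofReal_le_ofReal hrr.symm.lt.le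
  -- One sequence of simple functions must converge in L², for continuity of B, and in L^{r'}, for
  -- the right side.
  have approx : ∀ f : Lp ℂ 2 μ, MemLp f (ENNReal.ofReal r') μ → ∃ F : ℕ → SimpleFunc α ℂ,
      ∃ hF : ∀ n, MemLp (F n) 2 μ,
      Filter.Tendsto (fun n ↦ (hF n).toLp (F n)) Filter.atTop (nhds f) ∧
      Filter.Tendsto (fun n ↦ (eLpNorm (F n) (ENNReal.ofReal r') μ).toReal) Filter.atTop
        (nhds (eLpNorm f (ENNReal.ofReal r') μ).toReal) := by
    intro f hf
    have fm : Measurable f := (Lp.stronglyMeasurable f).measurable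
    refine ⟨fun n ↦ SimpleFunc.approxOn f fm (range f ∪ {0}) 0 (by simp) n,
      fun n ↦ SimpleFunc.memLp_approxOn_range fm (Lp.memLp f) n, ?_, ?_⟩
    · have := SimpleFunc.tendsto_approxOn_range_Lp (p := 2) (by simp) fm (Lp.memLp f)
      rwa [Lp.toLp_coeFn] at this
    · exact tendsto_toReal_eLpNorm_of_tendsto hr'1 hf
        (fun n ↦ SimpleFunc.memLp_approxOn_range fm hf n)
        (SimpleFunc.tendsto_approxOn_range_Lp_eLpNorm ENNReal.ofReal_ne_top fm hf.2)
  obtain ⟨F, hF, hF1, hF2⟩ := approx f hf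
  obtain ⟨G, hG, hG1, hG2⟩ := approx g hg
  have hB : Filter.Tendsto (fun n ↦ B ((hF n).toLp (F n)) ((hG n).toLp (G n))) Filter.atTop
      (nhds (B f g)) := by
    set Bc := B.mkContinuous₂ 1 (by simpa using h2)
    have h3 : Continuous fun z : Lp ℂ 2 μ × Lp ℂ 2 μ ↦ Bc z.1 z.2 := by fun_prop
    exact (h3.tendsto (f, g)).comp (hF1.prodMk_nhds hG1)
  exact le_of_tendsto_of_tendsto' hB.norm ((hF2.mul hG2).const_mul _) fun n ↦
    riesz_thorin_simpleFunc B hK h2 h1 hr hrr (F n) (G n) (hF n) (hG n)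

/-- The converse of Hölder's inequality, tested on bounded functions supported in the sets of an
exhausting sequence of finite measure. -/
theorem eLpNorm_le_of_forall_norm_integral_le {g : α → ℂ} (hg : AEStronglyMeasurable g μ)
    {A : ℕ → Set α} (hAm : ∀ n, MeasurableSet (A n)) (hAfin : ∀ n, μ (A n) ≠ ⊤)
    (hA : ∀ x, ∀ᶠ n in Filter.atTop, x ∈ A n) {r r' : ℝ} (hrr : r.HolderConjugate r') {M : ℝ}
    (hM : 0 ≤ M)
    (H : ∀ (f : α → ℂ) (n : ℕ), AEStronglyMeasurable f μ → (∃ c, ∀ x, ‖f x‖ ≤ c) →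
      (∀ x, x ∉ A n → f x = 0) →
      ‖∫ x, f x * g x ∂μ‖ ≤ M * (eLpNorm f (ENNReal.ofReal r') μ).toReal) :
    eLpNorm g (ENNReal.ofReal r) μ ≤ ENNReal.ofReal M := by
  wlog hgm : StronglyMeasurable g generalizing g
  · rw [eLpNorm_congr_ae hg.ae_eq_mk]
    refine this hg.stronglyMeasurable_mk.aestronglyMeasurable (fun f n hf hb h0 ↦ ?_)
      hg.stronglyMeasurable_mk
    rw [integral_congr_ae (g := fun x ↦ f x * g x)
      (by filter_upwards [hg.ae_eq_mk] with x hx; rw [hx])]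
    exact H f n hf hb h0
  have hr0 : 0 < r := hrr.pos
  have hr1 : 1 < r := hrr.lt
  have hr'0 : 0 < r' := hrr.symm.pos
  have hinv : r⁻¹ + r'⁻¹ = 1 := hrr.inv_add_inv_eq_one
  have hgm' : Measurable g := hgm.measurable
  -- Cutting off both the domain and the size of g makes the integral of |g|^r finite before
  -- anything is known about g.
  set S : ℕ → Set α := fun n ↦ A n ∩ {x | ‖g x‖ ≤ n} with hS
  have hSm : ∀ n, MeasurableSet (S n) := fun n ↦
    (hAm n).inter (measurableSet_le hgm'.norm measurable_const)
  have hSfin : ∀ n, μ (S n) ≠ ⊤ := fun n ↦ measure_ne_top_of_subset inter_subset_left (hAfin n)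
  have step : ∀ n, ∫⁻ x, (S n).indicator (fun x ↦ ENNReal.ofReal (‖g x‖ ^ r)) x ∂μ ≤
      ENNReal.ofReal (M ^ r) := by
    intro n
    set X := ∫ x in S n, ‖g x‖ ^ r ∂μ with hX
    have hint : IntegrableOn (fun x ↦ ‖g x‖ ^ r) (S n) μ := by
      refine Measure.integrableOn_of_bounded (M := (n : ℝ) ^ r) (hSfin n)
        (Measurable.aestronglyMeasurable (by fun_prop)) ?_
      filter_upwards [ae_restrict_mem (hSm n)] with x hx
      rw [Real.norm_of_nonneg (by positivity)]
      exact Real.rpow_le_rpow (norm_nonneg _) hx.2 hr0.le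
    rw [lintegral_indicator (hSm n), ← ofReal_integral_eq_lintegral_ofReal hint
      (Filter.Eventually.of_forall fun x ↦ by positivity), ← hX]
    apply ENNReal.ofReal_le_ofReal
    have hX0 : 0 ≤ X := by positivity
    rcases hX0.eq_or_lt with h | hXpos
    · rw [← h]; positivity
    -- The extremiser in Hölder's inequality: it turns the hypothesis into X ≤ M X^{1/r'}, hence
    -- X^{1/r} ≤ M.
    set f : α → ℂ := (S n).indicator fun x ↦ ((‖g x‖ ^ (r - 2) : ℝ) : ℂ) * (starRingEnd ℂ) (g x) with hf
    have hfm : Measurable f := Measurable.indicator (by fun_prop) (hSm n)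
    have hfn : ∀ x, ‖f x‖ = (S n).indicator (fun x ↦ ‖g x‖ ^ (r - 1)) x := by
      intro x
      by_cases hx : x ∈ S n
      · rw [hf, indicator_of_mem hx, indicator_of_mem hx, norm_mul, RCLike.norm_conj, Complex.norm_real,
          Real.norm_of_nonneg (by positivity)]
        by_cases h0 : ‖g x‖ = 0
        · rw [h0, mul_zero, Real.zero_rpow (by linarith)]
        · rw [← Real.rpow_add_one h0]; ring_nf
      · rw [hf, indicator_of_notMem hx, indicator_of_notMem hx, norm_zero]
    have hfg : ∫ x, f x * g x ∂μ = X := by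
      rw [hX, ← integral_indicator (hSm n)]
      refine (integral_congr_ae (g := fun x ↦ (((S n).indicator (fun x ↦ ‖g x‖ ^ r) x : ℝ) : ℂ)) ?_).trans
        integral_ofReal
      refine Filter.Eventually.of_forall fun x ↦ ?_
      dsimp only
      by_cases hx : x ∈ S n
      · rw [hf, indicator_of_mem hx, indicator_of_mem hx, mul_assoc, mul_comm _ (g x), Complex.mul_conj,
          Complex.normSq_eq_norm_sq]
        by_cases h0 : ‖g x‖ = 0
        · rw [h0, Real.zero_rpow hr0.ne']; simp
        · rw [← Complex.ofReal_mul, ← Real.rpow_natCast, ← Real.rpow_add (by positivity)]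
          norm_num
      · rw [hf, indicator_of_notMem hx, indicator_of_notMem hx, zero_mul]; simp
    have hfnorm : (eLpNorm f (ENNReal.ofReal r') μ).toReal = X ^ r'⁻¹ := by
      rw [eLpNorm_eq_lintegral_rpow_enorm_toReal (by simpa using hr'0) ENNReal.ofReal_ne_top,
        ENNReal.toReal_ofReal hr'0.le]
      have : ∫⁻ x, ‖f x‖ₑ ^ r' ∂μ = ENNReal.ofReal X := by
        rw [hX, ofReal_integral_eq_lintegral_ofReal hint
          (Filter.Eventually.of_forall fun x ↦ by positivity), ← lintegral_indicator (hSm n)]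
        refine lintegral_congr fun x ↦ ?_
        rw [← ofReal_norm, hfn, ENNReal.ofReal_rpow_of_nonneg _ hr'0.le]
        · by_cases hx : x ∈ S n
          · rw [indicator_of_mem hx, indicator_of_mem hx, ← Real.rpow_mul (norm_nonneg _)]
            congr 2
            exact hrr.sub_one_mul_conj
          · rw [indicator_of_notMem hx, indicator_of_notMem hx, Real.zero_rpow hr'0.ne', ENNReal.ofReal_zero]
        · exact indicator_nonneg (fun x _ ↦ by positivity) x
      rw [this, one_div, ENNReal.ofReal_rpow_of_pos hXpos, ENNReal.toReal_ofReal (by positivity)]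
    have hH := H f n hfm.aestronglyMeasurable ⟨(n : ℝ) ^ (r - 1), fun x ↦ by
      rw [hfn]
      refine indicator_apply_le' (fun hx ↦ ?_) (fun _ ↦ by positivity)
      exact Real.rpow_le_rpow (norm_nonneg _) hx.2 (by linarith)⟩
      (fun x hx ↦ indicator_of_notMem (fun h ↦ hx h.1) _)
    rw [hfg, hfnorm, Complex.norm_real, Real.norm_of_nonneg hX0] at hH
    have h3 : X ^ r⁻¹ ≤ M := by
      have h4 : X = X ^ r⁻¹ * X ^ r'⁻¹ := by
        rw [← Real.rpow_add hXpos, hinv, Real.rpow_one]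
      rw [h4] at hH
      nth_rewrite 2 [← h4] at hH
      exact le_of_mul_le_mul_right hH (by positivity)
    calc X = (X ^ r⁻¹) ^ r := by rw [← Real.rpow_mul hX0, inv_mul_cancel₀ hr0.ne', Real.rpow_one]
      _ ≤ M ^ r := Real.rpow_le_rpow (by positivity) h3 hr0.le
  have hlim : ∀ x, Filter.Tendsto (fun n ↦ (S n).indicator (fun x ↦ ENNReal.ofReal (‖g x‖ ^ r)) x)
      Filter.atTop (nhds (ENNReal.ofReal (‖g x‖ ^ r))) := by
    intro x
    refine tendsto_const_nhds.congr' ?_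
    filter_upwards [hA x, Filter.eventually_ge_atTop ⌈‖g x‖⌉₊] with n hn hn2
    have h5 : ‖g x‖ ≤ n := (Nat.le_ceil _).trans (by exact_mod_cast hn2)
    have : x ∈ S n := ⟨hn, h5⟩
    rw [indicator_of_mem this]
  have hfatou : ∫⁻ x, ENNReal.ofReal (‖g x‖ ^ r) ∂μ ≤ ENNReal.ofReal (M ^ r) := by
    calc _ = ∫⁻ x, Filter.liminf (fun n ↦ (S n).indicator (fun x ↦ ENNReal.ofReal (‖g x‖ ^ r)) x)
          Filter.atTop ∂μ := by simp_rw [fun x ↦ (hlim x).liminf_eq]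
      _ ≤ _ := lintegral_liminf_le fun n ↦ Measurable.indicator (by fun_prop) (hSm n)
      _ ≤ _ := Filter.liminf_le_of_frequently_le' (Filter.Frequently.of_forall step)
  rw [eLpNorm_eq_lintegral_rpow_enorm_toReal (by simpa using hr0) ENNReal.ofReal_ne_top,
    ENNReal.toReal_ofReal hr0.le]
  simp_rw [← ofReal_norm, ENNReal.ofReal_rpow_of_nonneg (norm_nonneg _) hr0.le]
  calc _ ≤ (ENNReal.ofReal (M ^ r)) ^ (1 / r) := ENNReal.rpow_le_rpow hfatou (by positivity)
    _ = _ := by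
      rw [ENNReal.ofReal_rpow_of_nonneg (by positivity) (by positivity), ← Real.rpow_mul hM,
        mul_one_div_cancel hr0.ne', Real.rpow_one]

end RieszThorin

/-! ### Functionals bounded in `L^r'` -/

section SchwartzFunctional

variable {E : Type*} [NormedAddCommGroup E] [InnerProductSpace ℝ E] [FiniteDimensional ℝ E]
  [MeasurableSpace E] [BorelSpace E]

theorem holderTriple_ofReal_two {s r' : ℝ} (hs : 0 < s) (hr' : 0 < r') (h : s⁻¹ + 2⁻¹ = r'⁻¹) :
    ENNReal.HolderTriple (ENNReal.ofReal s) 2 (ENNReal.ofReal r') := by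
  constructor
  rw [← ENNReal.ofReal_inv_of_pos hs, ← ENNReal.ofReal_inv_of_pos hr', ← h,
    ENNReal.ofReal_add (by positivity) (by positivity), ENNReal.ofReal_inv_of_pos two_pos]
  simp

omit [FiniteDimensional ℝ E] [MeasurableSpace E] [BorelSpace E] in
theorem hasTemperateGrowth_ofReal_one_add_norm_sq_rpow (κ : ℝ) :
    (fun x : E ↦ (((1 + ‖x‖ ^ 2) ^ κ : ℝ) : ℂ)).HasTemperateGrowth :=
  Function.Complex.hasTemperateGrowth_ofReal.comp (Function.hasTemperateGrowth_one_add_norm_sq_rpow E κ)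

/-- A functional on Schwartz functions that is bounded in `L^{r'}`, `r' < 2`, is given by a function
in the dual space `L^r`. -/
theorem exists_eLpNorm_le_of_schwartz_bound {r r' : ℝ} (hr : 2 < r) (hrr : r.HolderConjugate r')
    (Λ : 𝓢(E, ℂ) →ₗ[ℂ] ℂ) {M : ℝ} (hM : 0 ≤ M)
    (hΛ : ∀ φ, ‖Λ φ‖ ≤ M * (eLpNorm φ (ENNReal.ofReal r') volume).toReal) :
    ∃ g : E → ℂ, AEStronglyMeasurable g volume ∧
      eLpNorm g (ENNReal.ofReal r) volume ≤ ENNReal.ofReal M ∧ ∀ φ, Λ φ = ∫ x, φ x * g x := by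
  have hr0 : 0 < r := hrr.pos
  have hr'0 : 0 < r' := hrr.symm.pos
  have hinv : r⁻¹ + r'⁻¹ = 1 := hrr.inv_add_inv_eq_one
  have hr2 : r⁻¹ < 2⁻¹ := inv_strictAnti₀ two_pos hr
  -- Duality is taken in L² rather than L^{r'}. Multiplication by a weight w in L^s maps L² into
  -- L^{r'}, so φ ↦ Λ(wφ) is bounded on L², is represented by Riesz, and the weight is divided out
  -- again.
  set s := (r'⁻¹ - 2⁻¹)⁻¹ with hs
  have hs0 : 0 < s := inv_pos.2 (by linarith)
  have hsr : s⁻¹ + 2⁻¹ = r'⁻¹ := by rw [hs, inv_inv]; ring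
  have := holderTriple_ofReal_two hs0 hr'0 hsr
  have : Fact ((1 : ℝ≥0∞) ≤ ENNReal.ofReal r') := ⟨by
    rw [← ENNReal.ofReal_one]; exact ENNReal.ofReal_le_ofReal hrr.symm.lt.le⟩
  have : Fact ((1 : ℝ≥0∞) ≤ ENNReal.ofReal s) := ⟨by
    rw [← ENNReal.ofReal_one]; apply ENNReal.ofReal_le_ofReal
    rw [hs]; apply (one_le_inv₀ (by linarith)).2
    have : 0 < r⁻¹ := by positivity
    linarith⟩
  -- With 2κs = dim + 1 the weight (1+|x|²)^{-κ} lies in L^s.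
  set κ : ℝ := (Module.finrank ℝ E + 1) / (2 * s) with hκ
  have hκ0 : 0 ≤ κ := by positivity
  set w : E → ℂ := fun x ↦ (((1 + ‖x‖ ^ 2) ^ (-κ) : ℝ) : ℂ) with hw
  set v : E → ℂ := fun x ↦ (((1 + ‖x‖ ^ 2) ^ κ : ℝ) : ℂ) with hv
  have hwg : w.HasTemperateGrowth := hasTemperateGrowth_ofReal_one_add_norm_sq_rpow (-κ)
  have hvg : v.HasTemperateGrowth := hasTemperateGrowth_ofReal_one_add_norm_sq_rpow κ
  have hwv : ∀ x, w x * v x = 1 := by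
    intro x
    rw [hw, hv, ← Complex.ofReal_mul, ← Real.rpow_add (by positivity)]
    simp
  have hwc : Continuous w := hwg.1.continuous
  have hvc : Continuous v := hvg.1.continuous
  have hwLp : MemLp w (ENNReal.ofReal s) volume := by
    rw [← integrable_norm_rpow_iff hwc.aestronglyMeasurable (by simpa using hs0) ENNReal.ofReal_ne_top,
      ENNReal.toReal_ofReal hs0.le]
    have := integrable_rpow_neg_one_add_norm_sq (E := E) (μ := volume)
      (r := Module.finrank ℝ E + 1) (by linarith)
    refine this.congr (Filter.Eventually.of_forall fun x ↦ ?_)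
    dsimp only [w]
    rw [Complex.norm_real, Real.norm_of_nonneg (by positivity), ← Real.rpow_mul (by positivity)]
    congr 1
    rw [hκ]; field_simp
  set T : Lp ℂ 2 (volume : Measure E) →L[ℂ] Lp ℂ (ENNReal.ofReal r') (volume : Measure E) :=
    (ContinuousLinearMap.mul ℂ ℂ).holderL volume (ENNReal.ofReal s) 2 (ENNReal.ofReal r')
      (hwLp.toLp w) with hT
  have hTae : ∀ F : Lp ℂ 2 (volume : Measure E), T F =ᵐ[volume] fun x ↦ w x * F x := by
    intro F
    have h := ContinuousLinearMap.coeFn_holder (r := ENNReal.ofReal r') (ContinuousLinearMap.mul ℂ ℂ)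
      (hwLp.toLp w) F
    filter_upwards [h, hwLp.coeFn_toLp] with x h1 h2
    rw [← h2]
    exact h1
  set Λ₁ : 𝓢(E, ℂ) →ₗ[ℂ] ℂ := Λ ∘ₗ (SchwartzMap.smulLeftCLM ℂ w).toLinearMap with hΛ₁
  have hdense : DenseRange (SchwartzMap.toLpCLM ℂ (E := E) ℂ 2 volume) :=
    SchwartzMap.denseRange_toLpCLM ENNReal.ofNat_ne_top
  have hTφ : ∀ φ : 𝓢(E, ℂ), ‖Λ₁ φ‖ ≤ M * ‖T (φ.toLp 2 volume)‖ := by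
    intro φ
    refine (hΛ _).trans_eq ?_
    rw [Lp.norm_def]
    congr 2
    refine eLpNorm_congr_ae ?_
    filter_upwards [hTae (φ.toLp 2 volume), φ.coeFn_toLp 2 volume] with x h1 h2
    rw [h1, h2]
    exact SchwartzMap.smulLeftCLM_apply_apply hwg φ x
  have hb : ∀ φ : 𝓢(E, ℂ), ‖Λ₁ φ‖ ≤ (M * ‖T‖) * ‖(SchwartzMap.toLpCLM ℂ (E := E) ℂ 2 volume).toLinearMap φ‖ := by
    intro φ
    rw [mul_assoc]
    exact (hTφ φ).trans (mul_le_mul_of_nonneg_left (T.le_opNorm _) hM)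
  set Λt := Λ₁.extendOfNorm (SchwartzMap.toLpCLM ℂ (E := E) ℂ 2 volume).toLinearMap with hΛt
  have hΛtφ : ∀ φ : 𝓢(E, ℂ), Λt (φ.toLp 2 volume) = Λ₁ φ := fun φ ↦
    LinearMap.extendOfNorm_eq hdense ⟨_, hb⟩ φ
  -- The bound by ‖TF‖ is kept through the density argument instead of M‖T‖‖F‖: it yields the
  -- constant M in L^r, independent of the weight.
  have hΛtT : ∀ F, ‖Λt F‖ ≤ M * ‖T F‖ := by
    intro F
    refine hdense.induction (P := fun F ↦ ‖Λt F‖ ≤ M * ‖T F‖) ?_ ?_ F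
    · rintro _ ⟨φ, rfl⟩
      rw [SchwartzMap.toLpCLM_apply, hΛtφ]
      exact hTφ φ
    · exact isClosed_le (by fun_prop) (by fun_prop)
  set y := (InnerProductSpace.toDual ℂ (Lp ℂ 2 (volume : Measure E))).symm Λt with hy
  have hΛty : ∀ F, Λt F = ∫ x, F x * (starRingEnd ℂ) (y x) := by
    intro F
    rw [← InnerProductSpace.toDual_symm_apply, L2.inner_def]
    rfl
  refine ⟨fun x ↦ v x * (starRingEnd ℂ) (y x), ?_, ?_, ?_⟩
  · exact hvc.aestronglyMeasurable.mul (Complex.continuous_conj.comp_aestronglyMeasurable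
      (Lp.aestronglyMeasurable y))
  · refine eLpNorm_le_of_forall_norm_integral_le (hvc.aestronglyMeasurable.mul
      (Complex.continuous_conj.comp_aestronglyMeasurable (Lp.aestronglyMeasurable y)))
      (A := fun n ↦ Metric.closedBall 0 n) (fun n ↦ measurableSet_closedBall)
      (fun n ↦ measure_closedBall_lt_top.ne) (fun x ↦ ?_) hrr hM ?_
    · filter_upwards [Filter.eventually_ge_atTop ⌈‖x‖⌉₊] with n hn
      have : ‖x‖ ≤ n := (Nat.le_ceil _).trans (by exact_mod_cast hn)
      simpa using this
    · rintro f n hf ⟨c, hc⟩ h0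
      have hF : MemLp (fun x ↦ f x * v x) 2 volume := by
        have e : (fun x ↦ f x * v x) = (Metric.closedBall (0 : E) n).indicator fun x ↦ f x * v x := by
          funext x
          by_cases hx : x ∈ Metric.closedBall (0 : E) n
          · rw [indicator_of_mem hx]
          · rw [indicator_of_notMem hx, h0 x hx, zero_mul]
        rw [e, memLp_indicator_iff_restrict measurableSet_closedBall]
        have : IsFiniteMeasure (volume.restrict (Metric.closedBall (0 : E) n)) :=
          ⟨by rw [Measure.restrict_apply_univ]; exact measure_closedBall_lt_top⟩
        refine MemLp.of_bound (hf.mul hvc.aestronglyMeasurable).restrict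
          (c * (1 + (n : ℝ) ^ 2) ^ κ) ?_
        filter_upwards [ae_restrict_mem measurableSet_closedBall] with x hx
        have hx : ‖x‖ ≤ n := by simpa using hx
        rw [norm_mul]
        have hc0 : 0 ≤ c := (norm_nonneg _).trans (hc x)
        refine mul_le_mul (hc x) ?_ (norm_nonneg _) hc0
        dsimp only [v]
        rw [Complex.norm_real, Real.norm_of_nonneg (by positivity)]
        gcongr
      have h1 := hΛtT (hF.toLp _)
      rw [hΛty, Lp.norm_def] at h1
      have e1 : ∫ x, f x * (v x * (starRingEnd ℂ) (y x)) =
          ∫ x, (hF.toLp _ : E → ℂ) x * (starRingEnd ℂ) (y x) := by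
        refine integral_congr_ae ?_
        filter_upwards [hF.coeFn_toLp] with x hx
        rw [hx, mul_assoc]
      have e2 : eLpNorm (T (hF.toLp _)) (ENNReal.ofReal r') volume =
          eLpNorm f (ENNReal.ofReal r') volume := by
        refine eLpNorm_congr_ae ?_
        filter_upwards [hF.coeFn_toLp, hTae (hF.toLp _)] with x hx h2
        rw [h2, hx, mul_left_comm, hwv, mul_one]
      change ‖∫ x, f x * (v x * (starRingEnd ℂ) (y x))‖ ≤ _
      rw [e1, ← e2]
      exact h1
  · intro φ
    have e1 : Λ φ = Λ₁ (SchwartzMap.smulLeftCLM ℂ v φ) := by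
      rw [hΛ₁]
      simp only [LinearMap.comp_apply, ContinuousLinearMap.coe_coe]
      rw [SchwartzMap.smulLeftCLM_smulLeftCLM_apply hwg hvg]
      congr 1
      ext x
      rw [SchwartzMap.smulLeftCLM_apply_apply (hwg.mul hvg), Pi.mul_apply, hwv, one_smul]
    rw [e1, ← hΛtφ, hΛty]
    refine integral_congr_ae ?_
    filter_upwards [(SchwartzMap.smulLeftCLM ℂ v φ).coeFn_toLp 2 volume] with x hx
    rw [hx, SchwartzMap.smulLeftCLM_apply_apply hvg, smul_eq_mul]
    ring

end SchwartzFunctional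

/-! ### The Hausdorff-Young inequality and the dispersive estimate in `L^r` -/

section HausdorffYoung

theorem ae_eq_of_forall_schwartz_integral_eq {E : Type*} [NormedAddCommGroup E] [NormedSpace ℝ E]
    [FiniteDimensional ℝ E] [MeasurableSpace E] [BorelSpace E] {μ : Measure E} {f g : E → ℂ}
    (hf : LocallyIntegrable f μ) (hg : LocallyIntegrable g μ)
    (h : ∀ φ : 𝓢(E, ℂ), ∫ x, φ x * f x ∂μ = ∫ x, φ x * g x ∂μ) : f =ᵐ[μ] g := by
  refine ae_eq_of_integral_contDiff_smul_eq hf hg fun η hη hηc ↦ ?_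
  have hg₁ : HasCompactSupport (Complex.ofRealCLM ∘ η) := hηc.comp_left rfl
  have hg₂ : ContDiff ℝ (⊤ : ℕ∞) (Complex.ofRealCLM ∘ η) := by fun_prop
  simpa using h (hg₁.toSchwartzMap hg₂)

variable {V : Type*} [NormedAddCommGroup V] [InnerProductSpace ℝ V] [FiniteDimensional ℝ V]
  [MeasurableSpace V] [BorelSpace V]

/-- The Plancherel extension and the integral formula define the same tempered distribution, so they
agree almost everywhere on L¹ ∩ L². -/
theorem Lp_fourier_ae_eq (f : Lp ℂ 2 (volume : Measure V)) (hf : Integrable f) :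
    (𝓕 f : Lp ℂ 2 (volume : Measure V)) =ᵐ[volume] 𝓕 (f : V → ℂ) := by
  refine ae_eq_of_forall_schwartz_integral_eq ((Lp.memLp _).locallyIntegrable (by norm_num))
    (continuous_fourier_of_integrable hf).locallyIntegrable fun φ ↦ ?_
  have h := congrArg (fun T : 𝓢'(V, ℂ) ↦ T φ) (Lp.fourier_toTemperedDistribution_eq f)
  simp only [TemperedDistribution.fourier_apply, Lp.toTemperedDistribution_apply,
    smul_eq_mul] at h
  rw [← h, SchwartzMap.fourier_coe, integral_fourier_mul_eq_of_integrable φ.integrable hf]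

theorem Lp_fourierInv_ae_eq (f : Lp ℂ 2 (volume : Measure V)) (hf : Integrable f) :
    (𝓕⁻ f : Lp ℂ 2 (volume : Measure V)) =ᵐ[volume] 𝓕 (fun x ↦ f (-x)) := by
  have hf' : Integrable (fun x ↦ f (-x)) := hf.comp_neg
  refine ae_eq_of_forall_schwartz_integral_eq ((Lp.memLp _).locallyIntegrable (by norm_num))
    (continuous_fourier_of_integrable hf').locallyIntegrable fun φ ↦ ?_
  have h := congrArg (fun T : 𝓢'(V, ℂ) ↦ T φ) (Lp.fourierInv_toTemperedDistribution_eq f)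
  simp only [TemperedDistribution.fourierInv_apply, Lp.toTemperedDistribution_apply,
    smul_eq_mul] at h
  rw [← h, ← integral_fourier_mul_eq_of_integrable φ.integrable hf', SchwartzMap.fourierInv_coe,
    ← integral_neg_eq_self]
  simp [Real.fourierInv_eq_fourier_neg]

/-- The bilinear form `∫ m (U f) (W g)` on `L²` for isometries `U`, `W` and a multiplier `m` bounded
by `1`. -/
theorem exists_bilinear_integral_mul {α : Type*} [MeasurableSpace α] {μ : Measure α}
    (U W : Lp ℂ 2 μ →ₗ[ℂ] Lp ℂ 2 μ) (hU : ∀ f, ‖U f‖ = ‖f‖) (hW : ∀ f, ‖W f‖ = ‖f‖)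
    {m : α → ℂ} (hm : AEStronglyMeasurable m μ) (hm1 : ∀ x, ‖m x‖ ≤ 1) :
    ∃ B : Lp ℂ 2 μ →ₗ[ℂ] Lp ℂ 2 μ →ₗ[ℂ] ℂ,
      (∀ f g, B f g = ∫ x, m x * (U f x * W g x) ∂μ) ∧ ∀ f g, ‖B f g‖ ≤ ‖f‖ * ‖g‖ := by
  have hi : ∀ f g : Lp ℂ 2 μ, Integrable (fun x ↦ m x * (f x * g x)) μ := fun f g ↦
    ((Lp.memLp f).integrable_mul (Lp.memLp g)).bdd_mul hm (Filter.Eventually.of_forall hm1)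
  refine ⟨LinearMap.mk₂ ℂ (fun f g ↦ ∫ x, m x * (U f x * W g x) ∂μ) ?_ ?_ ?_ ?_,
    fun f g ↦ rfl, fun f g ↦ ?_⟩
  · intro f₁ f₂ g
    rw [← integral_add (hi _ _) (hi _ _), map_add]
    refine integral_congr_ae ?_
    filter_upwards [Lp.coeFn_add (U f₁) (U f₂)] with x hx
    rw [hx, Pi.add_apply]; ring
  · intro c f g
    rw [map_smul, ← integral_smul]
    refine integral_congr_ae ?_
    filter_upwards [Lp.coeFn_smul c (U f)] with x hx
    rw [hx, Pi.smul_apply, smul_eq_mul, smul_eq_mul]; ring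
  · intro f g₁ g₂
    rw [← integral_add (hi _ _) (hi _ _), map_add]
    refine integral_congr_ae ?_
    filter_upwards [Lp.coeFn_add (W g₁) (W g₂)] with x hx
    rw [hx, Pi.add_apply]; ring
  · intro c f g
    rw [map_smul, ← integral_smul]
    refine integral_congr_ae ?_
    filter_upwards [Lp.coeFn_smul c (W g)] with x hx
    rw [hx, Pi.smul_apply, smul_eq_mul, smul_eq_mul]; ring
  · change ‖∫ x, m x * (U f x * W g x) ∂μ‖ ≤ _
    have hn : ∀ f : Lp ℂ 2 μ, (∫ x, ‖f x‖ ^ (2 : ℝ) ∂μ) ^ (1 / 2 : ℝ) = ‖f‖ := by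
      intro f
      rw [Lp.norm_def, (Lp.memLp f).eLpNorm_eq_integral_rpow_norm (by simp) (by simp),
        ENNReal.toReal_ofReal (by positivity)]
      simp
    calc ‖∫ x, m x * (U f x * W g x) ∂μ‖ ≤ ∫ x, ‖U f x‖ * ‖W g x‖ ∂μ := by
          refine norm_integral_le_of_norm_le ?_ (Filter.Eventually.of_forall fun x ↦ ?_)
          · exact (Lp.memLp (U f)).norm.integrable_mul (Lp.memLp (W g)).norm
          · rw [norm_mul, norm_mul]
            exact mul_le_of_le_one_left (by positivity) (hm1 x)
      _ ≤ (∫ x, ‖U f x‖ ^ (2 : ℝ) ∂μ) ^ (1 / 2 : ℝ) * (∫ x, ‖W g x‖ ^ (2 : ℝ) ∂μ) ^ (1 / 2 : ℝ) :=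
          integral_mul_norm_le_Lp_mul_Lq .two_two (by simpa using Lp.memLp (U f))
            (by simpa using Lp.memLp (W g))
      _ = ‖f‖ * ‖g‖ := by rw [hn, hn, hU, hW]

theorem memLp_of_bounded_of_support_finite {α : Type*} [MeasurableSpace α] {μ : Measure α}
    {f : α → ℂ} {A : Set α} (hf : AEStronglyMeasurable f μ) (hA : MeasurableSet A)
    (hAf : μ A ≠ ⊤) {c : ℝ} (hc : ∀ x, ‖f x‖ ≤ c) (h0 : ∀ x, x ∉ A → f x = 0) (p : ℝ≥0∞) :
    MemLp f p μ := by
  have : Fact (μ A < ⊤) := ⟨hAf.lt_top⟩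
  have h : MemLp f p (μ.restrict A) :=
    MemLp.of_bound hf.restrict c (Filter.Eventually.of_forall hc)
  rw [← memLp_indicator_iff_restrict hA] at h
  convert h using 1
  ext x
  by_cases hx : x ∈ A <;> simp [hx, h0]

/-- Interpolation for an operator on Schwartz functions given by its bilinear form on `L²`. -/
theorem eLpNorm_le_of_bilinear {φ h : 𝓢(V, ℂ)}
    (B : Lp ℂ 2 (volume : Measure V) →ₗ[ℂ] Lp ℂ 2 (volume : Measure V) →ₗ[ℂ] ℂ)
    {K : ℝ} (hK : 0 ≤ K) (h2 : ∀ f g, ‖B f g‖ ≤ ‖f‖ * ‖g‖)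
    (h1 : ∀ f g : Lp ℂ 2 (volume : Measure V), Integrable f → Integrable g → ‖B f g‖ ≤ K * ((∫ x, ‖f x‖) * ∫ x, ‖g x‖))
    (hB : ∀ f : Lp ℂ 2 (volume : Measure V), Integrable f →
      B f (φ.toLp 2) = ∫ x, f x * h x)
    {r r' : ℝ} (hr : 2 < r) (hrr : r.HolderConjugate r') :
    eLpNorm h (ENNReal.ofReal r) volume ≤
      ENNReal.ofReal (K ^ (1 - 2 / r)) * eLpNorm φ (ENNReal.ofReal r') volume := by
  have hr1 : (1 : ℝ≥0∞) ≤ ENNReal.ofReal r' := by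
    rw [← ENNReal.ofReal_one]; exact ENNReal.ofReal_le_ofReal hrr.symm.lt.le
  have hφ : MemLp φ (ENNReal.ofReal r') volume := φ.memLp _
  have key : eLpNorm h (ENNReal.ofReal r) volume ≤
      ENNReal.ofReal (K ^ (1 - 2 / r) * (eLpNorm φ (ENNReal.ofReal r') volume).toReal) := by
    refine eLpNorm_le_of_forall_norm_integral_le h.continuous.aestronglyMeasurable
      (A := fun n : ℕ ↦ Metric.ball 0 n) (fun n ↦ Metric.isOpen_ball.measurableSet)
      (fun n ↦ measure_ball_lt_top.ne) (fun x ↦ ?_) hrr (by positivity) ?_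
    · obtain ⟨N, hN⟩ := exists_nat_gt ‖x‖
      filter_upwards [Filter.eventually_ge_atTop N] with n hn
      rw [mem_ball_zero_iff]
      exact hN.trans_le (by exact_mod_cast hn)
    · rintro f n hfm ⟨c, hc⟩ h0
      -- The test functions of the converse Hölder inequality are bounded with bounded support,
      -- hence in L¹ ∩ L² ∩ L^{r'}, where the form B and the interpolated bound both apply.
      have hmem := memLp_of_bounded_of_support_finite hfm Metric.isOpen_ball.measurableSet
        (measure_ball_lt_top (μ := (volume : Measure V))).ne hc h0
      set F := (hmem 2).toLp f
      have hF : F =ᵐ[volume] f := (hmem 2).coeFn_toLp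
      have hFi : Integrable F := (memLp_one_iff_integrable.1 (hmem 1)).congr hF.symm
      have hφL := φ.coeFn_toLp 2 volume
      have e1 : ∫ x, f x * h x = B F (φ.toLp 2) := by
        rw [hB F hFi]
        refine integral_congr_ae ?_
        filter_upwards [hF] with x hx
        rw [hx]
      rw [e1]
      refine (riesz_thorin B hK h2 h1 hr hrr F (φ.toLp 2) ?_ ?_).trans (le_of_eq ?_)
      · exact (memLp_congr_ae hF).2 (hmem _)
      · exact (memLp_congr_ae hφL).2 hφ
      · rw [eLpNorm_congr_ae hF, eLpNorm_congr_ae hφL]; ring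
  rwa [ENNReal.ofReal_mul (by positivity), ENNReal.ofReal_toReal hφ.2.ne] at key

/-- The Hausdorff–Young inequality for Schwartz functions. -/
theorem eLpNorm_fourier_le {r r' : ℝ} (hr : 2 < r) (hrr : r.HolderConjugate r') (φ : 𝓢(V, ℂ)) :
    eLpNorm (𝓕 φ : 𝓢(V, ℂ)) (ENNReal.ofReal r) volume ≤ eLpNorm φ (ENNReal.ofReal r') volume := by
  -- The form ∫ 𝓕f · g is bounded with constant 1 both on L² × L² (Plancherel) and on L¹ × L¹.
  obtain ⟨B, hB, hB2⟩ := exists_bilinear_integral_mul (μ := (volume : Measure V)) (m := fun _ ↦ 1)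
    (Lp.fourierTransformₗᵢ V ℂ).toLinearEquiv.toLinearMap LinearMap.id
    (fun f ↦ (Lp.fourierTransformₗᵢ V ℂ).norm_map f) (fun f ↦ rfl)
    aestronglyMeasurable_const (by simp)
  have hB' : ∀ f g : Lp ℂ 2 (volume : Measure V), Integrable f →
      B f g = ∫ x, 𝓕 (f : V → ℂ) x * g x := by
    intro f g hf
    rw [hB]
    refine integral_congr_ae ?_
    filter_upwards [Lp_fourier_ae_eq f hf] with x hx
    rw [one_mul, ← hx]
    rfl
  have := eLpNorm_le_of_bilinear (φ := φ) (h := 𝓕 φ) B zero_le_one hB2 ?_ ?_ hr hrr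
  · simpa using this
  · intro f g hf hg
    rw [hB' f g hf, one_mul, ← integral_const_mul]
    refine norm_integral_le_of_norm_le (hg.norm.const_mul _) (Filter.Eventually.of_forall fun x ↦ ?_)
    rw [norm_mul]
    gcongr
    exact norm_fourier_le_integral_norm _ _
  · intro f hf
    rw [hB' f _ hf, SchwartzMap.fourier_coe, ← integral_fourier_mul_eq_of_integrable hf φ.integrable]
    refine integral_congr_ae ?_
    filter_upwards [φ.coeFn_toLp 2 volume] with x hx
    rw [hx]

theorem norm_biharmonicSymbol (d : ℕ) (t : ℝ) (ξ : EuclideanSpace ℝ (Fin d)) :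
    ‖biharmonicSymbol d t ξ‖ = 1 := by
  rw [biharmonicSymbol, Complex.norm_exp_ofReal_mul_I]

/-- The dispersive estimate `‖e^{itΔ²} φ‖_{L^r} ≤ C |t|^{-(d/4)(1-2/r)} ‖φ‖_{L^{r'}}`. -/
theorem exists_eLpNorm_biharmonic_le {d : ℕ} (hd : 3 ≤ d) : ∃ C : ℝ, 0 < C ∧
    ∀ (t r r' : ℝ) (φ : 𝓢(EuclideanSpace ℝ (Fin d), ℂ)), t ≠ 0 → 2 < r → r.HolderConjugate r' →
      eLpNorm (𝓕 (SchwartzMap.smulLeftCLM ℂ (biharmonicSymbol d t) (𝓕⁻ φ)) :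
          𝓢(EuclideanSpace ℝ (Fin d), ℂ)) (ENNReal.ofReal r) volume ≤
        ENNReal.ofReal ((C * |t| ^ (-(d / 4 : ℝ))) ^ (1 - 2 / r)) *
          eLpNorm φ (ENNReal.ofReal r') volume := by
  obtain ⟨C, hC, hC1⟩ := norm_integral_biharmonicSymbol_mul_fourier_le hd
  refine ⟨C, hC, fun t r r' φ ht hr hrr ↦ ?_⟩
  set E := EuclideanSpace ℝ (Fin d)
  have hmg := biharmonicSymbol_hasTemperateGrowth d t
  -- The second isometry is the inverse transform, so that moving 𝓕 off f leaves 𝓕(m𝓕⁻¹φ). On L¹ ∩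
  -- L² it is the transform of the reflection, to which the bilinear dispersive bound applies.
  obtain ⟨B, hB, hB2⟩ := exists_bilinear_integral_mul (μ := (volume : Measure E))
    (m := biharmonicSymbol d t)
    (Lp.fourierTransformₗᵢ E ℂ).toLinearEquiv.toLinearMap
    (Lp.fourierTransformₗᵢ E ℂ).symm.toLinearEquiv.toLinearMap
    (fun f ↦ (Lp.fourierTransformₗᵢ E ℂ).norm_map f)
    (fun f ↦ (Lp.fourierTransformₗᵢ E ℂ).symm.norm_map f)
    hmg.1.continuous.aestronglyMeasurable (fun x ↦ (norm_biharmonicSymbol d t x).le)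
  have hB' : ∀ f g : Lp ℂ 2 (volume : Measure E),
      B f g = ∫ x, biharmonicSymbol d t x *
        ((𝓕 f : Lp ℂ 2 (volume : Measure E)) x * (𝓕⁻ g : Lp ℂ 2 (volume : Measure E)) x) :=
    fun f g ↦ hB f g
  refine eLpNorm_le_of_bilinear B (by positivity) hB2 ?_ ?_ hr hrr
  · intro f g hf hg
    have hint : Integrable (fun x ↦ (𝓕 f : Lp ℂ 2 (volume : Measure E)) x *
        (𝓕⁻ g : Lp ℂ 2 (volume : Measure E)) x) := (Lp.memLp _).integrable_mul (Lp.memLp _)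
    have hae : (fun x ↦ (𝓕 f : Lp ℂ 2 (volume : Measure E)) x *
        (𝓕⁻ g : Lp ℂ 2 (volume : Measure E)) x) =ᵐ[volume]
        fun x ↦ 𝓕 (f : E → ℂ) x * 𝓕 (fun y ↦ g (-y)) x := by
      filter_upwards [Lp_fourier_ae_eq f hf, Lp_fourierInv_ae_eq g hg] with x h1 h2
      rw [h1, h2]
    have h := hC1 t f (fun y ↦ g (-y)) ht hf hg.comp_neg (hint.congr hae)
    rw [integral_neg_eq_self (fun y ↦ ‖g y‖)] at h
    refine le_of_eq_of_le ?_ h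
    rw [hB']
    congr 1
    refine integral_congr_ae ?_
    filter_upwards [hae] with x hx
    rw [hx]
  · intro f hf
    rw [hB', SchwartzMap.toLp_fourierInv_eq, SchwartzMap.fourier_coe,
      ← integral_fourier_mul_eq_of_integrable hf (SchwartzMap.integrable _)]
    refine integral_congr_ae ?_
    filter_upwards [(𝓕⁻ φ : 𝓢(E, ℂ)).coeFn_toLp 2 volume, Lp_fourier_ae_eq f hf] with x hx hx2
    rw [hx, hx2, SchwartzMap.smulLeftCLM_apply_apply hmg, smul_eq_mul]
    ring

end HausdorffYoung

/-! ### Riesz potentials -/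

section RieszPotential

open Filter Topology

variable {V : Type*} [NormedAddCommGroup V] [InnerProductSpace ℝ V]

/-- The smooth approximation `(|2πξ|² + 1/(n+1))^{-σ/2}` of the symbol `|2πξ|^{-σ}`. -/
noncomputable def regRieszSymbol (σ : ℝ) (n : ℕ) (ξ : V) : ℂ :=
  ((((2 * Real.pi * ‖ξ‖) ^ 2 + 1 / (n + 1 : ℝ)) ^ (-σ / 2) : ℝ) : ℂ)

/-- Pulling out 1/(n+1) and rescaling ξ by 2π√(n+1) reduces to a power of 1+|ξ|². Unlike |2πξ|^{-σ},
this symbol therefore maps Schwartz functions to Schwartz functions. -/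
theorem regRieszSymbol_hasTemperateGrowth (σ : ℝ) (n : ℕ) :
    (regRieszSymbol σ n : V → ℂ).HasTemperateGrowth := by
  have hn : (0 : ℝ) < n + 1 := by positivity
  have h1 : (fun ξ : V ↦ ((1 / (n + 1 : ℝ)) ^ (-σ / 2)) *
      (1 + ‖(2 * Real.pi * √(n + 1 : ℝ)) • ξ‖ ^ 2) ^ (-σ / 2)).HasTemperateGrowth :=
    (Function.HasTemperateGrowth.const _).mul
      ((Function.hasTemperateGrowth_one_add_norm_sq_rpow V (-σ / 2)).comp
        ((2 * Real.pi * √(n + 1 : ℝ)) • ContinuousLinearMap.id ℝ V).hasTemperateGrowth)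
  have e : (regRieszSymbol σ n : V → ℂ) = Complex.ofReal ∘ fun ξ : V ↦
      ((1 / (n + 1 : ℝ)) ^ (-σ / 2)) *
        (1 + ‖(2 * Real.pi * √(n + 1 : ℝ)) • ξ‖ ^ 2) ^ (-σ / 2) := by
    funext ξ
    simp only [regRieszSymbol, Function.comp]
    congr 1
    rw [← Real.mul_rpow (by positivity) (by positivity), norm_smul, Real.norm_of_nonneg
      (by positivity)]
    congr 1
    rw [mul_pow, mul_pow, mul_pow, mul_pow, Real.sq_sqrt hn.le]
    field_simp
    ring
  rw [e]
  exact Function.Complex.hasTemperateGrowth_ofReal.comp h1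

omit [InnerProductSpace ℝ V] in
theorem norm_regRieszSymbol_le {σ : ℝ} (hσ : 0 < σ) (n : ℕ) {ξ : V} (hξ : ξ ≠ 0) :
    ‖regRieszSymbol σ n ξ‖ ≤ (2 * Real.pi * ‖ξ‖) ^ (-σ) := by
  have h0 : 0 < 2 * Real.pi * ‖ξ‖ := by positivity
  rw [regRieszSymbol, Complex.norm_real, Real.norm_of_nonneg (by positivity)]
  calc ((2 * Real.pi * ‖ξ‖) ^ 2 + 1 / (n + 1 : ℝ)) ^ (-σ / 2)
      ≤ ((2 * Real.pi * ‖ξ‖) ^ 2) ^ (-σ / 2) :=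
        Real.rpow_le_rpow_of_nonpos (by positivity) (by simp; positivity) (by linarith)
    _ = (2 * Real.pi * ‖ξ‖) ^ (-σ) := by
        rw [← Real.rpow_natCast, ← Real.rpow_mul h0.le]; congr 1; push_cast; ring

omit [InnerProductSpace ℝ V] in
theorem tendsto_regRieszSymbol (σ : ℝ) {ξ : V} (hξ : ξ ≠ 0) :
    Tendsto (fun n ↦ regRieszSymbol σ n ξ) atTop (𝓝 (((2 * Real.pi * ‖ξ‖) ^ (-σ) : ℝ) : ℂ)) := by
  have h0 : 0 < 2 * Real.pi * ‖ξ‖ := by positivity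
  have h1 : Tendsto (fun n : ℕ ↦ (2 * Real.pi * ‖ξ‖) ^ 2 + 1 / (n + 1 : ℝ)) atTop
      (𝓝 ((2 * Real.pi * ‖ξ‖) ^ 2 + 0)) := tendsto_const_nhds.add tendsto_one_div_add_atTop_nhds_zero_nat
  have h2 := h1.rpow_const (p := -σ / 2) (Or.inl (by positivity))
  have h3 : ((2 * Real.pi * ‖ξ‖) ^ 2 + 0) ^ (-σ / 2) = (2 * Real.pi * ‖ξ‖) ^ (-σ) := by
    rw [add_zero, ← Real.rpow_natCast, ← Real.rpow_mul h0.le]; congr 1; push_cast; ring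
  rw [h3] at h2
  exact (Complex.continuous_ofReal.tendsto _).comp h2

variable [FiniteDimensional ℝ V] [MeasurableSpace V] [BorelSpace V]

omit [InnerProductSpace ℝ V] [FiniteDimensional ℝ V] in
theorem measurable_rieszSymbol (σ : ℝ) :
    Measurable (fun ξ : V ↦ (((2 * Real.pi * ‖ξ‖) ^ (-σ) : ℝ) : ℂ)) := by fun_prop

/-- In polar coordinates the radial integrand is a multiple of y^{dim-1-σq}, integrable at 0 because
σq < dim. -/
theorem memLp_indicator_rieszSymbol {σ q : ℝ} (hσ : 0 < σ) (hq : 0 < q)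
    (hσq : σ * q < Module.finrank ℝ V) :
    MemLp ((Metric.ball (0 : V) 1).indicator fun ξ : V ↦ (((2 * Real.pi * ‖ξ‖) ^ (-σ) : ℝ) : ℂ))
      (ENNReal.ofReal q) volume := by
  have hd : 0 < Module.finrank ℝ V := by
    have : 0 < σ * q := by positivity
    exact_mod_cast this.trans hσq
  have : Nontrivial V := Module.nontrivial_of_finrank_pos hd
  have hm : AEStronglyMeasurable ((Metric.ball (0 : V) 1).indicator
      fun ξ : V ↦ (((2 * Real.pi * ‖ξ‖) ^ (-σ) : ℝ) : ℂ)) volume :=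
    ((measurable_rieszSymbol σ).indicator Metric.isOpen_ball.measurableSet).aestronglyMeasurable
  rw [← integrable_norm_rpow_iff hm (by simpa using hq) (by simp), ENNReal.toReal_ofReal hq.le]
  set f : ℝ → ℝ := (Iio 1).indicator fun y ↦ (2 * Real.pi * y) ^ (-(σ * q)) with hf
  have h1 : Integrable (fun ξ : V ↦ f ‖ξ‖) := by
    rw [integrable_fun_norm_addHaar]
    have h2 : IntegrableOn (fun y : ℝ ↦ (2 * Real.pi) ^ (-(σ * q)) *
        y ^ ((Module.finrank ℝ V : ℝ) - 1 - σ * q)) (Ioo 0 1) := by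
      refine Integrable.const_mul ?_ _
      exact (intervalIntegral.integrableOn_Ioo_rpow_iff one_pos).2 (by linarith)
    have h3 : IntegrableOn ((Iio 1).indicator fun y : ℝ ↦ (2 * Real.pi) ^ (-(σ * q)) *
        y ^ ((Module.finrank ℝ V : ℝ) - 1 - σ * q)) (Ioi 0) := by
      rw [IntegrableOn, integrable_indicator_iff measurableSet_Iio, IntegrableOn,
        Measure.restrict_restrict measurableSet_Iio]
      rwa [inter_comm, Ioi_inter_Iio]
    refine h3.congr_fun (fun y hy ↦ ?_) measurableSet_Ioi
    have hy0 : (0 : ℝ) < y := hy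
    by_cases hy1 : y < 1
    · simp only [hf, Set.indicator, mem_Iio, hy1, if_true, smul_eq_mul]
      rw [Real.mul_rpow (by positivity) hy0.le, Real.rpow_sub hy0, Real.rpow_neg hy0.le (σ * q),
        ← Real.rpow_natCast y, Nat.cast_sub hd, Nat.cast_one]
      field_simp
    · simp [hf, hy1]
  refine h1.congr (Eventually.of_forall fun ξ ↦ ?_)
  by_cases hξ : ‖ξ‖ < 1
  · simp only [hf, Set.indicator, mem_Iio, hξ, if_true, mem_ball_zero_iff]
    rw [Complex.norm_real, Real.norm_of_nonneg (by positivity), ← Real.rpow_mul (by positivity)]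
    congr 1; ring
  · simp only [hf, Set.indicator, mem_Iio, hξ, if_false, mem_ball_zero_iff, norm_zero]
    rw [Real.zero_rpow hq.ne']

omit [InnerProductSpace ℝ V] [FiniteDimensional ℝ V] [MeasurableSpace V] [BorelSpace V] in
theorem norm_indicator_compl_rieszSymbol_le {σ : ℝ} (hσ : 0 < σ) (ξ : V) :
    ‖(Metric.ball (0 : V) 1)ᶜ.indicator (fun ξ : V ↦ (((2 * Real.pi * ‖ξ‖) ^ (-σ) : ℝ) : ℂ)) ξ‖ ≤
      1 := by
  by_cases hξ : ξ ∈ (Metric.ball (0 : V) 1)ᶜ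
  · rw [indicator_of_mem hξ, Complex.norm_real, Real.norm_of_nonneg (by positivity)]
    have h1 : 1 ≤ ‖ξ‖ := by simpa using hξ
    refine Real.rpow_le_one_of_one_le_of_nonpos ?_ (by linarith)
    nlinarith [Real.two_le_pi]
  · rw [indicator_of_notMem hξ]; simp

/-- `|2πξ|^{-σ} f` is in `L^q` for Schwartz functions `f`, if `σ q < dim V`. -/
theorem memLp_rieszSymbol_mul_schwartz {σ q : ℝ} (hσ : 0 < σ) (hq : 1 ≤ q)
    (hσq : σ * q < Module.finrank ℝ V) (φ : 𝓢(V, ℂ)) :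
    MemLp (fun ξ : V ↦ (((2 * Real.pi * ‖ξ‖) ^ (-σ) : ℝ) : ℂ) * φ ξ) (ENNReal.ofReal q) volume := by
  set k : V → ℂ := fun ξ : V ↦ (((2 * Real.pi * ‖ξ‖) ^ (-σ) : ℝ) : ℂ)
  have h1 : MemLp (fun ξ ↦ (Metric.ball (0 : V) 1).indicator k ξ * φ ξ) (ENNReal.ofReal q)
      volume := by
    exact MemLp.mul' (p := ENNReal.ofReal q) (q := ⊤) (φ.memLp ⊤)
      (memLp_indicator_rieszSymbol hσ (by linarith) hσq)
  have h2 : MemLp (fun ξ ↦ (Metric.ball (0 : V) 1)ᶜ.indicator k ξ * φ ξ) (ENNReal.ofReal q)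
      volume := by
    have hb : MemLp ((Metric.ball (0 : V) 1)ᶜ.indicator k) ⊤ volume :=
      memLp_top_of_bound ((measurable_rieszSymbol σ).indicator
        Metric.isOpen_ball.measurableSet.compl).aestronglyMeasurable 1
        (Eventually.of_forall fun ξ ↦ norm_indicator_compl_rieszSymbol_le hσ ξ)
    exact MemLp.mul' (p := ⊤) (q := ENNReal.ofReal q) (φ.memLp _) hb
  convert h1.add h2 using 1
  funext ξ
  rw [Pi.add_apply, ← add_mul]
  congr 1
  exact (congrFun (indicator_self_add_compl (Metric.ball (0 : V) 1) k) ξ).symm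

/-- `|2πξ|^{-σ} W`, `W ∈ L^r`, is a tempered distribution when `|2πξ|^{-σ}` is locally in `L^{r'}`. -/
theorem exists_temperedDistribution_rieszSymbol_mul {σ r r' : ℝ} (hσ : 0 < σ)
    (hrr : r.HolderConjugate r') (hσr : σ * r' < Module.finrank ℝ V) {W : V → ℂ}
    (hW : MemLp W (ENNReal.ofReal r) volume) :
    ∃ S : 𝓢'(V, ℂ), ∀ φ : 𝓢(V, ℂ),
      Integrable (fun ξ ↦ φ ξ * ((((2 * Real.pi * ‖ξ‖) ^ (-σ) : ℝ) : ℂ) * W ξ)) ∧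
      S φ = ∫ ξ, φ ξ * ((((2 * Real.pi * ‖ξ‖) ^ (-σ) : ℝ) : ℂ) * W ξ) := by
  set k : V → ℂ := fun ξ : V ↦ (((2 * Real.pi * ‖ξ‖) ^ (-σ) : ℝ) : ℂ) with hk
  have : (ENNReal.ofReal r').HolderConjugate (ENNReal.ofReal r) := hrr.symm.ennrealOfReal
  have : Fact ((1 : ℝ≥0∞) ≤ ENNReal.ofReal r) := ⟨by
    rw [← ENNReal.ofReal_one]; exact ENNReal.ofReal_le_ofReal hrr.lt.le⟩
  -- Near the origin the weight is in L^{r'} and the product in L¹ by Hölder. Away from it the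
  -- weight is bounded and the product stays in L^r. Each piece is a tempered distribution.
  have h1 : MemLp (fun ξ ↦ (Metric.ball (0 : V) 1).indicator k ξ * W ξ) 1 volume :=
    MemLp.mul' (p := ENNReal.ofReal r') (q := ENNReal.ofReal r) hW
      (memLp_indicator_rieszSymbol hσ hrr.symm.pos hσr)
  have h2 : MemLp (fun ξ ↦ (Metric.ball (0 : V) 1)ᶜ.indicator k ξ * W ξ) (ENNReal.ofReal r)
      volume := by
    have hb : MemLp ((Metric.ball (0 : V) 1)ᶜ.indicator k) ⊤ volume :=
      memLp_top_of_bound ((measurable_rieszSymbol σ).indicator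
        Metric.isOpen_ball.measurableSet.compl).aestronglyMeasurable 1
        (Eventually.of_forall fun ξ ↦ norm_indicator_compl_rieszSymbol_le hσ ξ)
    exact MemLp.mul' (p := ⊤) (q := ENNReal.ofReal r) hW hb
  refine ⟨(Lp.toTemperedDistribution (h1.toLp _)) + (Lp.toTemperedDistribution (h2.toLp _)),
    fun φ ↦ ?_⟩
  have i1 : Integrable (fun ξ ↦ φ ξ * ((Metric.ball (0 : V) 1).indicator k ξ * W ξ)) :=
    memLp_one_iff_integrable.1 (MemLp.mul' (p := ⊤) (q := 1) h1 (φ.memLp ⊤))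
  have i2 : Integrable (fun ξ ↦ φ ξ * ((Metric.ball (0 : V) 1)ᶜ.indicator k ξ * W ξ)) :=
    memLp_one_iff_integrable.1
      (MemLp.mul' (p := ENNReal.ofReal r') (q := ENNReal.ofReal r) h2 (φ.memLp _))
  have e : ∀ ξ, φ ξ * ((Metric.ball (0 : V) 1).indicator k ξ * W ξ) +
      φ ξ * ((Metric.ball (0 : V) 1)ᶜ.indicator k ξ * W ξ) = φ ξ * (k ξ * W ξ) := by
    intro ξ
    rw [← mul_add, ← add_mul]
    congr 2
    exact congrFun (indicator_self_add_compl (Metric.ball (0 : V) 1) k) ξ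
  refine ⟨(i1.add i2).congr (Eventually.of_forall e), ?_⟩
  rw [add_apply, Lp.toTemperedDistribution_apply,
    Lp.toTemperedDistribution_apply]
  have a1 : ∫ ξ, φ ξ • (h1.toLp _ : V → ℂ) ξ =
      ∫ ξ, φ ξ * ((Metric.ball (0 : V) 1).indicator k ξ * W ξ) := by
    refine integral_congr_ae ?_
    filter_upwards [h1.coeFn_toLp] with x hx
    rw [hx, smul_eq_mul]
  have a2 : ∫ ξ, φ ξ • (h2.toLp _ : V → ℂ) ξ =
      ∫ ξ, φ ξ * ((Metric.ball (0 : V) 1)ᶜ.indicator k ξ * W ξ) := by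
    refine integral_congr_ae ?_
    filter_upwards [h2.coeFn_toLp] with x hx
    rw [hx, smul_eq_mul]
  rw [a1, a2, ← integral_add i1 i2]
  exact integral_congr_ae (Eventually.of_forall e)

end RieszPotential

/-! ### Jointly measurable representatives -/

section JointMeasurability

open Filter Topology

variable {V : Type*} [NormedAddCommGroup V] [InnerProductSpace ℝ V] [FiniteDimensional ℝ V]
  [MeasurableSpace V] [BorelSpace V]

/-- A weakly measurable family of locally integrable functions has a jointly measurable
representative. -/
theorem exists_stronglyMeasurable_uncurry_ae_eq {α : Type*} [MeasurableSpace α] {g : α → V → ℂ}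
    (hg : ∀ t, LocallyIntegrable (g t))
    (hm : ∀ φ : 𝓢(V, ℂ), StronglyMeasurable fun t ↦ ∫ x, φ x * g t x) :
    ∃ U : α → V → ℂ, StronglyMeasurable (Function.uncurry U) ∧ ∀ t, U t =ᵐ[volume] g t := by
  -- Mollifications of g t are continuous in x. At a fixed x they are pairings with a test function,
  -- hence measurable in t; together this gives joint measurability.
  let ρ : ℕ → ContDiffBump (0 : V) := fun n ↦
    ⟨1 / (n + 1 : ℝ), 2 / (n + 1 : ℝ), by positivity, by gcongr; norm_num⟩
  let v : ℕ → α → V → ℂ := fun n t ↦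
    convolution ((ρ n).normed volume) (g t) (ContinuousLinearMap.lsmul ℝ ℝ) volume
  have hvc : ∀ n t, Continuous (v n t) := fun n t ↦
    (ρ n).hasCompactSupport_normed.continuous_convolution_left _ (ρ n).continuous_normed (hg t)
  have hvm : ∀ n x, StronglyMeasurable fun t ↦ v n t x := by
    intro n x
    have hc : HasCompactSupport (Complex.ofRealCLM ∘ fun y ↦ (ρ n).normed volume (x - y)) := by
      refine HasCompactSupport.comp_left (g := Complex.ofRealCLM) ?_ (map_zero _)
      exact (ρ n).hasCompactSupport_normed.comp_homeomorph (Homeomorph.subLeft x)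
    have hs : ContDiff ℝ (⊤ : ℕ∞) (Complex.ofRealCLM ∘ fun y ↦ (ρ n).normed volume (x - y)) :=
      Complex.ofRealCLM.contDiff.comp ((ρ n).contDiff_normed.comp (contDiff_const.sub contDiff_id))
    convert hm (hc.toSchwartzMap hs) using 2 with t
    simp only [v, convolution_eq_swap]
    refine integral_congr_ae (Eventually.of_forall fun y ↦ ?_)
    simp
  have hjm : ∀ n, StronglyMeasurable fun z : α × V ↦ v n z.1 z.2 := fun n ↦
    (stronglyMeasurable_uncurry_of_continuous_of_stronglyMeasurable (u := fun x t ↦ v n t x)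
      (fun t ↦ hvc n t) (hvm n)).comp_measurable measurable_swap
  -- By Lebesgue differentiation the mollifications converge to g t at almost every x; elsewhere the
  -- default value of `limUnder` is harmless.
  refine ⟨fun t x ↦ limUnder atTop fun n ↦ v n t x, StronglyMeasurable.limUnder (l := atTop) hjm, fun t ↦ ?_⟩
  have hlim : Tendsto (fun n ↦ (ρ n).rOut) atTop (𝓝 0) := by
    have := (tendsto_one_div_add_atTop_nhds_zero_nat (𝕜 := ℝ)).const_mul 2
    simpa only [ρ, mul_one_div, mul_zero] using this
  have hK : ∀ᶠ n in atTop, (ρ n).rOut ≤ 2 * (ρ n).rIn :=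
    Eventually.of_forall fun n ↦ by simp [ρ]; rw [div_eq_mul_inv]
  filter_upwards [ContDiffBump.ae_convolution_tendsto_right_of_locallyIntegrable hlim hK (hg t)]
    with x hx
  exact hx.limUnder_eq

end JointMeasurability

/-! ### Duhamel's integral -/

section DuhamelPairing

open Filter Topology

theorem measurable_eLpNorm_of_stronglyMeasurable_uncurry {α β : Type*} [MeasurableSpace α]
    [MeasurableSpace β] {μ : Measure β} [SFinite μ] {G : α → β → ℂ}
    (hG : StronglyMeasurable (Function.uncurry G)) {q : ℝ} (hq : 0 < q) :
    Measurable fun s ↦ eLpNorm (G s) (ENNReal.ofReal q) μ := by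
  simp_rw [eLpNorm_eq_lintegral_rpow_enorm_toReal (by simpa using hq : ENNReal.ofReal q ≠ 0)
    ENNReal.ofReal_ne_top, ENNReal.toReal_ofReal hq.le]
  exact (Measurable.lintegral_prod_right' (hG.enorm.pow_const q)).pow_const _

theorem norm_integral_mul_le_eLpNorm {α : Type*} [MeasurableSpace α] {μ : Measure α} {f g : α → ℂ}
    {r r' : ℝ} (hrr : r.HolderConjugate r') (hf : MemLp f (ENNReal.ofReal r) μ)
    (hg : MemLp g (ENNReal.ofReal r') μ) :
    ‖∫ x, f x * g x ∂μ‖ ≤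
      (eLpNorm f (ENNReal.ofReal r) μ).toReal * (eLpNorm g (ENNReal.ofReal r') μ).toReal := by
  have : (ENNReal.ofReal r).HolderConjugate (ENNReal.ofReal r') := hrr.ennrealOfReal
  have h := eLpNorm_smul_le_mul_eLpNorm (p := ENNReal.ofReal r) (q := ENNReal.ofReal r') (r := 1)
    hg.1 hf.1
  rw [← ENNReal.toReal_mul, ← toReal_enorm]
  refine ENNReal.toReal_mono (ENNReal.mul_ne_top hf.2.ne hg.2.ne) ?_
  refine (enorm_integral_le_lintegral_enorm _).trans ?_
  rw [eLpNorm_one_eq_lintegral_enorm] at h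
  exact h

variable {d : ℕ}

theorem eLpNorm_smulLeftCLM_biharmonicSymbol (τ : ℝ) (φ : 𝓢(EuclideanSpace ℝ (Fin d), ℂ))
    (q : ℝ≥0∞) :
    eLpNorm (SchwartzMap.smulLeftCLM ℂ (biharmonicSymbol d τ) φ) q volume =
      eLpNorm φ q volume := by
  refine eLpNorm_congr_norm_ae (Eventually.of_forall fun x ↦ ?_)
  rw [SchwartzMap.smulLeftCLM_apply_apply (biharmonicSymbol_hasTemperateGrowth d τ), norm_smul,
    norm_biharmonicSymbol, one_mul]

theorem continuous_biharmonicSymbol_uncurry :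
    Continuous fun z : ℝ × EuclideanSpace ℝ (Fin d) ↦ biharmonicSymbol d z.1 z.2 := by
  unfold biharmonicSymbol
  fun_prop

/-- The symbol is unimodular, so |φ| dominates the Fourier integral for all times at once. Joint
continuity gives the measurability of the pairings in (t, s). -/
theorem continuous_fourier_smulLeftCLM_biharmonicSymbol
    (φ : 𝓢(EuclideanSpace ℝ (Fin d), ℂ)) :
    Continuous fun z : ℝ × EuclideanSpace ℝ (Fin d) ↦
      (𝓕 (SchwartzMap.smulLeftCLM ℂ (biharmonicSymbol d z.1) φ) :
        𝓢(EuclideanSpace ℝ (Fin d), ℂ)) z.2 := by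
  have e : ∀ z : ℝ × EuclideanSpace ℝ (Fin d),
      (𝓕 (SchwartzMap.smulLeftCLM ℂ (biharmonicSymbol d z.1) φ) :
        𝓢(EuclideanSpace ℝ (Fin d), ℂ)) z.2 =
      ∫ v, Real.fourierChar (-inner ℝ v z.2) • (biharmonicSymbol d z.1 v * φ v) := by
    intro z
    rw [SchwartzMap.fourier_coe, Real.fourier_eq]
    simp_rw [SchwartzMap.smulLeftCLM_apply_apply (biharmonicSymbol_hasTemperateGrowth d z.1),
      smul_eq_mul]
  obtain ⟨K, hK, hc⟩ : ∃ K : (ℝ × EuclideanSpace ℝ (Fin d)) × EuclideanSpace ℝ (Fin d) → ℂ,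
      (∀ z v, Real.fourierChar (-inner ℝ v z.2) • (biharmonicSymbol d z.1 v * φ v) = K (z, v)) ∧
        Continuous K := by
    refine ⟨fun y ↦ Real.fourierChar (-inner ℝ y.2 y.1.2) • (biharmonicSymbol d y.1.1 y.2 * φ y.2),
      fun z v ↦ rfl, Continuous.smul ?_ (Continuous.mul ?_ (φ.continuous.comp continuous_snd))⟩
    · have hi : Continuous fun y : (ℝ × EuclideanSpace ℝ (Fin d)) × EuclideanSpace ℝ (Fin d) ↦
          -inner ℝ y.2 y.1.2 := (continuous_snd.inner continuous_fst.snd).neg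
      exact continuous_subtype_val.comp (Real.continuous_fourierChar.comp hi)
    · exact continuous_biharmonicSymbol_uncurry.comp
        (continuous_fst.fst.prodMk continuous_snd)
  have hb : ∀ z v, ‖K (z, v)‖ = ‖φ v‖ := fun z v ↦ by
    rw [← hK, Circle.norm_smul, norm_mul, norm_biharmonicSymbol, one_mul]
  simp_rw [e, hK]
  refine continuous_of_dominated (bound := fun v ↦ ‖φ v‖) (fun z ↦ ?_)
    (fun z ↦ Eventually.of_forall fun v ↦ (hb z v).le) φ.integrable.norm
    (Eventually.of_forall fun v ↦ ?_)
  · exact (hc.comp (Continuous.prodMk_right z)).aestronglyMeasurable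
  · exact hc.comp (Continuous.prodMk_left v)

/-- The pairing of `𝓕 (e^{iτ|2πξ|⁴} φ)` with a function `g`. -/
noncomputable def propagatorPairing (g : EuclideanSpace ℝ (Fin d) → ℂ) (τ : ℝ)
    (φ : 𝓢(EuclideanSpace ℝ (Fin d), ℂ)) : ℂ :=
  ∫ x, (𝓕 (SchwartzMap.smulLeftCLM ℂ (biharmonicSymbol d τ) φ) :
    𝓢(EuclideanSpace ℝ (Fin d), ℂ)) x * g x

/-- The time integral of `propagatorPairing` in Duhamel's formula. -/
noncomputable def duhamelPairing (G : ℝ → EuclideanSpace ℝ (Fin d) → ℂ) (t₀ t : ℝ)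
    (φ : 𝓢(EuclideanSpace ℝ (Fin d), ℂ)) : ℂ :=
  ∫ s in t₀..t, propagatorPairing (G s) (t - s) φ

theorem stronglyMeasurable_propagatorPairing {G : ℝ → EuclideanSpace ℝ (Fin d) → ℂ}
    (hG : StronglyMeasurable (Function.uncurry G)) (φ : 𝓢(EuclideanSpace ℝ (Fin d), ℂ)) :
    StronglyMeasurable fun z : ℝ × ℝ ↦ propagatorPairing (G z.2) (z.1 - z.2) φ := by
  refine StronglyMeasurable.integral_prod_right ?_
  refine StronglyMeasurable.mul ?_ ?_
  · refine ((continuous_fourier_smulLeftCLM_biharmonicSymbol φ).comp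
      (?_ : Continuous fun y : (ℝ × ℝ) × EuclideanSpace ℝ (Fin d) ↦
        (y.1.1 - y.1.2, y.2))).stronglyMeasurable
    fun_prop
  · exact hG.comp_measurable (measurable_fst.snd.prodMk measurable_snd)

theorem stronglyMeasurable_duhamelPairing {G : ℝ → EuclideanSpace ℝ (Fin d) → ℂ}
    (hG : StronglyMeasurable (Function.uncurry G)) (t₀ : ℝ)
    (φ : 𝓢(EuclideanSpace ℝ (Fin d), ℂ)) :
    StronglyMeasurable fun t ↦ duhamelPairing G t₀ t φ := by
  unfold duhamelPairing
  simp_rw [intervalIntegral.intervalIntegral_eq_integral_uIoc,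
    ← integral_indicator measurableSet_uIoc]
  -- The orientation of the interval integral: t may lie on either side of t₀.
  have h1 : StronglyMeasurable fun t : ℝ ↦ if t₀ ≤ t then (1 : ℝ) else -1 :=
    StronglyMeasurable.ite measurableSet_Ici stronglyMeasurable_const stronglyMeasurable_const
  have hs : MeasurableSet {z : ℝ × ℝ | z.2 ∈ uIoc t₀ z.1} := by
    simp only [mem_uIoc]
    measurability
  have h2 : StronglyMeasurable fun t : ℝ ↦ ∫ s, (uIoc t₀ t).indicator
      (fun s ↦ propagatorPairing (G s) (t - s) φ) s :=
    StronglyMeasurable.integral_prod_right (f := fun t s ↦ (uIoc t₀ t).indicator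
      (fun s ↦ propagatorPairing (G s) (t - s) φ) s)
      ((stronglyMeasurable_propagatorPairing hG φ).indicator hs)
  exact h1.smul h2

/-! ### Frequency-side bounds by Hausdorff-Young, valid at every time. -/

section Bounds

variable {r r' : ℝ} (hr : 2 < r) (hrr : r.HolderConjugate r')
include hr hrr

/-- Hölder, then Hausdorff-Young, which does not see the unimodular symbol. The bound has no decay
but is uniform in τ, so it needs only integrability in time of the norms of G. -/
theorem norm_propagatorPairing_le {g : EuclideanSpace ℝ (Fin d) → ℂ}
    (hg : MemLp g (ENNReal.ofReal r') volume) (τ : ℝ) (φ : 𝓢(EuclideanSpace ℝ (Fin d), ℂ)) :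
    ‖propagatorPairing g τ φ‖ ≤ (eLpNorm g (ENNReal.ofReal r') volume).toReal *
      (eLpNorm φ (ENNReal.ofReal r') volume).toReal := by
  refine (norm_integral_mul_le_eLpNorm hrr (SchwartzMap.memLp _ _ volume) hg).trans ?_
  rw [mul_comm]
  refine mul_le_mul_of_nonneg_left ?_ ENNReal.toReal_nonneg
  refine ENNReal.toReal_mono (φ.memLp (ENNReal.ofReal r') volume).2.ne ?_
  refine (eLpNorm_fourier_le hr hrr _).trans ?_
  rw [eLpNorm_smulLeftCLM_biharmonicSymbol]

omit hr in
theorem propagatorPairing_linear {g : EuclideanSpace ℝ (Fin d) → ℂ}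
    (hg : MemLp g (ENNReal.ofReal r') volume) (τ : ℝ) (c : ℂ)
    (φ ψ : 𝓢(EuclideanSpace ℝ (Fin d), ℂ)) :
    propagatorPairing g τ (c • φ + ψ) =
      c * propagatorPairing g τ φ + propagatorPairing g τ ψ := by
  have : (ENNReal.ofReal r).HolderConjugate (ENNReal.ofReal r') := hrr.ennrealOfReal
  have hi : ∀ φ : 𝓢(EuclideanSpace ℝ (Fin d), ℂ), Integrable fun x ↦ φ x * g x := fun φ ↦
    (φ.memLp (ENNReal.ofReal r)).integrable_mul hg
  unfold propagatorPairing
  rw [← integral_const_mul, ← integral_add ((hi _).const_mul _) (hi _)]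
  refine integral_congr_ae (Eventually.of_forall fun x ↦ ?_)
  simp only [map_add, map_smul, FourierTransform.fourier_add, FourierTransform.fourier_smul,
    add_apply, smul_apply, smul_eq_mul]
  ring

variable {G : ℝ → EuclideanSpace ℝ (Fin d) → ℂ} (hG : StronglyMeasurable (Function.uncurry G))
  (hA : ∀ s, MemLp (G s) (ENNReal.ofReal r') volume)
  (hA1 : ∫⁻ s, eLpNorm (G s) (ENNReal.ofReal r') volume ≠ ⊤)
include hG hA hA1

omit hr hA in
theorem integrable_toReal_eLpNorm :
    Integrable fun s ↦ (eLpNorm (G s) (ENNReal.ofReal r') volume).toReal :=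
  integrable_toReal_of_lintegral_ne_top
    (measurable_eLpNorm_of_stronglyMeasurable_uncurry hG hrr.symm.pos).aemeasurable hA1

theorem integrable_propagatorPairing (t : ℝ) (φ : 𝓢(EuclideanSpace ℝ (Fin d), ℂ)) :
    Integrable fun s ↦ propagatorPairing (G s) (t - s) φ := by
  refine Integrable.mono' ((integrable_toReal_eLpNorm hrr hG hA1).mul_const
    (eLpNorm φ (ENNReal.ofReal r') volume).toReal) ?_
    (Eventually.of_forall fun s ↦ norm_propagatorPairing_le hr hrr (hA s) _ _)
  exact ((stronglyMeasurable_propagatorPairing hG φ).comp_measurable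
    (measurable_const.prodMk measurable_id)).aestronglyMeasurable

theorem exists_linearMap_duhamelPairing (t₀ t : ℝ) :
    ∃ Λ : 𝓢(EuclideanSpace ℝ (Fin d), ℂ) →ₗ[ℂ] ℂ, ∀ φ, Λ φ = duhamelPairing G t₀ t φ := by
  have hlin : ∀ (c : ℂ) (φ ψ : 𝓢(EuclideanSpace ℝ (Fin d), ℂ)), duhamelPairing G t₀ t (c • φ + ψ) =
      c * duhamelPairing G t₀ t φ + duhamelPairing G t₀ t ψ := by
    intro c φ ψ
    have hi := fun φ ↦ (integrable_propagatorPairing hr hrr hG hA hA1 t φ).intervalIntegrable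
      (a := t₀) (b := t)
    unfold duhamelPairing
    rw [← intervalIntegral.integral_const_mul, ← intervalIntegral.integral_add
      ((hi φ).const_mul _) (hi ψ)]
    refine intervalIntegral.integral_congr fun s _ ↦ ?_
    exact propagatorPairing_linear hrr (hA s) _ _ _ _
  have h0 : duhamelPairing G t₀ t 0 = 0 := by simpa using hlin (-1) 0 0
  refine ⟨{ toFun := duhamelPairing G t₀ t, map_add' := fun φ ψ ↦ ?_, map_smul' := fun c φ ↦ ?_ },
    fun φ ↦ rfl⟩
  · simpa using hlin 1 φ ψ
  · simpa [h0] using hlin c φ 0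

theorem norm_duhamelPairing_le (t₀ t : ℝ) (φ : 𝓢(EuclideanSpace ℝ (Fin d), ℂ)) :
    ‖duhamelPairing G t₀ t φ‖ ≤
      (∫ s, (eLpNorm (G s) (ENNReal.ofReal r') volume).toReal) *
        (eLpNorm φ (ENNReal.ofReal r') volume).toReal := by
  have hi := integrable_toReal_eLpNorm hrr hG hA1
  rw [duhamelPairing, intervalIntegral.norm_intervalIntegral_eq, ← integral_mul_const]
  refine (norm_integral_le_of_norm_le (hi.mul_const _).integrableOn
    (Eventually.of_forall fun s ↦ norm_propagatorPairing_le hr hrr (hA s) _ φ)).trans ?_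
  exact setIntegral_le_integral (hi.mul_const _)
    (Eventually.of_forall fun s ↦ by positivity)

/-- W is the Fourier transform of the Duhamel integral of G. It exists at every t, including times
where the dispersive majorant diverges, and so makes u(t) defined throughout the interval. -/
theorem exists_memLp_duhamelPairing (t₀ t : ℝ) :
    ∃ W : EuclideanSpace ℝ (Fin d) → ℂ, MemLp W (ENNReal.ofReal r) volume ∧
      ∀ φ, duhamelPairing G t₀ t φ = ∫ x, φ x * W x := by
  obtain ⟨Λ, hΛ⟩ := exists_linearMap_duhamelPairing hr hrr hG hA hA1 t₀ t
  obtain ⟨W, h1, h2, h3⟩ := exists_eLpNorm_le_of_schwartz_bound hr hrr Λ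
    (integral_nonneg fun s ↦ ENNReal.toReal_nonneg)
    (fun φ ↦ by rw [hΛ]; exact norm_duhamelPairing_le hr hrr hG hA hA1 t₀ t φ)
  exact ⟨W, ⟨h1, h2.trans_lt ENNReal.ofReal_lt_top⟩, fun φ ↦ by rw [← hΛ, h3]⟩

end Bounds

/-- Dispersive bound for Duhamel's integral, with a jointly measurable representative. -/
theorem exists_stronglyMeasurable_duhamelPairing_fourierInv (hd : 3 ≤ d) {r r' : ℝ} (hr : 2 < r)
    (hrr : r.HolderConjugate r') :
    ∃ C : ℝ≥0, ∀ (G : ℝ → EuclideanSpace ℝ (Fin d) → ℂ) (t₀ : ℝ),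
      StronglyMeasurable (Function.uncurry G) →
      (∀ s, MemLp (G s) (ENNReal.ofReal r') volume) →
      ∫⁻ s, eLpNorm (G s) (ENNReal.ofReal r') volume ≠ ⊤ →
      ∃ U : ℝ → EuclideanSpace ℝ (Fin d) → ℂ, StronglyMeasurable (Function.uncurry U) ∧
        ∀ t, eLpNorm (U t) (ENNReal.ofReal r) volume ≤ C * (∫⁻ s, ENNReal.ofReal
            (|t - s| ^ (-(d / 4 * (1 - 2 / r) : ℝ))) * eLpNorm (G s) (ENNReal.ofReal r') volume) ∧
          ((∫⁻ s, ENNReal.ofReal (|t - s| ^ (-(d / 4 * (1 - 2 / r) : ℝ))) *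
              eLpNorm (G s) (ENNReal.ofReal r') volume) ≠ ⊤ →
            MemLp (U t) (ENNReal.ofReal r) volume ∧
            ∀ ψ : 𝓢(EuclideanSpace ℝ (Fin d), ℂ),
              duhamelPairing G t₀ t (𝓕⁻ ψ) = ∫ x, ψ x * U t x) := by
  obtain ⟨C, hC, hdisp⟩ := exists_eLpNorm_biharmonic_le hd
  set α : ℝ := d / 4 * (1 - 2 / r) with hα
  refine ⟨Real.toNNReal (C ^ (1 - 2 / r)), fun G t₀ hG hA hA1 ↦ ?_⟩
  set A : ℝ → ℝ≥0∞ := fun s ↦ eLpNorm (G s) (ENNReal.ofReal r') volume with hAdef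
  have hAm : Measurable A := measurable_eLpNorm_of_stronglyMeasurable_uncurry hG hrr.symm.pos
  set M : ℝ → ℝ≥0∞ := fun t ↦ ∫⁻ s, ENNReal.ofReal (|t - s| ^ (-α)) * A s with hM
  have hMm : Measurable M := by
    refine Measurable.lintegral_prod_right' (f := fun z : ℝ × ℝ ↦
      ENNReal.ofReal (|z.1 - z.2| ^ (-α)) * A z.2) ?_
    exact Measurable.mul (by fun_prop) (hAm.comp measurable_snd)
  -- Testing on 𝓕⁻ψ returns to physical space, where the propagator acts as 𝓕(m𝓕⁻ψ) and disperses.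
  -- The time s = t is excluded and is a null set.
  have hpt : ∀ (t s : ℝ) (ψ : 𝓢(EuclideanSpace ℝ (Fin d), ℂ)), s ≠ t →
      ‖propagatorPairing (G s) (t - s) (𝓕⁻ ψ)‖ ≤ C ^ (1 - 2 / r) * (|t - s| ^ (-α) * (A s).toReal) *
        (eLpNorm ψ (ENNReal.ofReal r') volume).toReal := by
    intro t s ψ hst
    have hts : t - s ≠ 0 := sub_ne_zero.2 hst.symm
    refine (norm_integral_mul_le_eLpNorm hrr (SchwartzMap.memLp _ _ volume) (hA s)).trans ?_
    have h := hdisp (t - s) r r' ψ hts hr hrr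
    have h' := ENNReal.toReal_mono (ENNReal.mul_ne_top ENNReal.ofReal_ne_top (ψ.memLp (ENNReal.ofReal r') volume).2.ne) h
    rw [ENNReal.toReal_mul, ENNReal.toReal_ofReal (by positivity),
      Real.mul_rpow hC.le (by positivity), ← Real.rpow_mul (abs_nonneg _)] at h'
    have e : -(d / 4 : ℝ) * (1 - 2 / r) = -α := by rw [hα]; ring
    rw [e] at h'
    calc _ ≤ (C ^ (1 - 2 / r) * |t - s| ^ (-α) * (eLpNorm ψ (ENNReal.ofReal r') volume).toReal) *
          (A s).toReal := mul_le_mul_of_nonneg_right h' ENNReal.toReal_nonneg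
      _ = _ := by ring
  have hbound : ∀ t, M t ≠ ⊤ → ∀ ψ : 𝓢(EuclideanSpace ℝ (Fin d), ℂ),
      ‖duhamelPairing G t₀ t (𝓕⁻ ψ)‖ ≤ (C ^ (1 - 2 / r) * (M t).toReal) *
        (eLpNorm ψ (ENNReal.ofReal r') volume).toReal := by
    intro t ht ψ
    have hm : Measurable fun s ↦ ENNReal.ofReal (|t - s| ^ (-α)) * A s :=
      Measurable.mul (by fun_prop) hAm
    have hi : Integrable fun s ↦ |t - s| ^ (-α) * (A s).toReal := by
      have := integrable_toReal_of_lintegral_ne_top hm.aemeasurable ht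
      refine this.congr (Eventually.of_forall fun s ↦ ?_)
      simp only
      rw [ENNReal.toReal_mul, ENNReal.toReal_ofReal (by positivity)]
    have hMi : (M t).toReal = ∫ s, |t - s| ^ (-α) * (A s).toReal := by
      rw [hM, ← integral_toReal hm.aemeasurable (ae_lt_top hm ht)]
      refine integral_congr_ae (Eventually.of_forall fun s ↦ ?_)
      simp only
      rw [ENNReal.toReal_mul, ENNReal.toReal_ofReal (by positivity)]
    rw [duhamelPairing, intervalIntegral.norm_intervalIntegral_eq, hMi, ← integral_const_mul,
      ← integral_mul_const]
    have hi' := (hi.const_mul (C ^ (1 - 2 / r))).mul_const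
      (eLpNorm ψ (ENNReal.ofReal r') volume).toReal
    refine (norm_integral_le_of_norm_le hi'.integrableOn ?_).trans
      (setIntegral_le_integral hi' (Eventually.of_forall fun s ↦ by positivity))
    refine ae_restrict_of_ae ?_
    have : ∀ᵐ s : ℝ, s ≠ t := by simp [ae_iff]
    filter_upwards [this] with s hs
    exact hpt t s ψ hs
  -- Where M t is infinite the function is taken to be 0; the set of such t is measurable, so the
  -- family stays weakly measurable.
  have hex : ∀ t, ∃ g : EuclideanSpace ℝ (Fin d) → ℂ, MemLp g (ENNReal.ofReal r) volume ∧
      eLpNorm g (ENNReal.ofReal r) volume ≤ Real.toNNReal (C ^ (1 - 2 / r)) * M t ∧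
      ∀ ψ : 𝓢(EuclideanSpace ℝ (Fin d), ℂ), ∫ x, ψ x * g x =
        {t | M t ≠ ⊤}.indicator (fun t ↦ duhamelPairing G t₀ t (𝓕⁻ ψ)) t := by
    intro t
    by_cases ht : M t = ⊤
    · exact ⟨0, MemLp.zero, by simp, fun ψ ↦ by simp [ht]⟩
    · obtain ⟨Λ, hΛ⟩ := exists_linearMap_duhamelPairing hr hrr hG hA hA1 t₀ t
      obtain ⟨g, h1, h2, h3⟩ := exists_eLpNorm_le_of_schwartz_bound hr hrr
        (Λ ∘ₗ (FourierTransform.fourierInvCLM ℂ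
          𝓢(EuclideanSpace ℝ (Fin d), ℂ)).toLinearMap)
        (M := C ^ (1 - 2 / r) * (M t).toReal) (by positivity) (fun ψ ↦ by
          simp only [LinearMap.comp_apply]
          rw [hΛ]
          exact hbound t ht ψ)
      refine ⟨g, ⟨h1, h2.trans_lt ENNReal.ofReal_lt_top⟩, ?_, fun ψ ↦ ?_⟩
      · rwa [ENNReal.ofReal_mul (by positivity), ENNReal.ofReal_toReal ht] at h2
      · rw [← h3, indicator_of_mem (by exact ht)]
        exact hΛ _
  choose g hgm hgn hgi using hex
  have hr1 : (1 : ℝ≥0∞) ≤ ENNReal.ofReal r := by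
    rw [← ENNReal.ofReal_one]; exact ENNReal.ofReal_le_ofReal hrr.lt.le
  obtain ⟨U, hU, hUg⟩ := exists_stronglyMeasurable_uncurry_ae_eq
    (fun t ↦ (hgm t).locallyIntegrable hr1) (fun ψ ↦ by
      simp_rw [hgi]
      exact (stronglyMeasurable_duhamelPairing hG t₀ _).indicator
        (hMm (measurableSet_singleton ⊤)).compl)
  refine ⟨U, hU, fun t ↦ ⟨?_, fun ht ↦ ⟨(memLp_congr_ae (hUg t)).2 (hgm t), fun ψ ↦ ?_⟩⟩⟩
  · rw [eLpNorm_congr_ae (hUg t)]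
    exact hgn t
  · have h1 := hgi t ψ
    rw [indicator_of_mem (by exact ht)] at h1
    rw [← h1]
    refine integral_congr_ae ?_
    filter_upwards [hUg t] with x hx
    rw [hx]

end DuhamelPairing

/-! ### Fractional derivatives of Duhamel's integral -/

section FracDeriv

open Filter Topology

variable {d : ℕ}

theorem isGivenBy_of_memLp {r r' : ℝ} (hrr : r.HolderConjugate r')
    {T : 𝓢'(EuclideanSpace ℝ (Fin d), ℂ)} {g : EuclideanSpace ℝ (Fin d) → ℂ}
    (hg : MemLp g (ENNReal.ofReal r) volume) (h : ∀ φ, T φ = ∫ x, φ x * g x) : IsGivenBy T g := by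
  have : (ENNReal.ofReal r').HolderConjugate (ENNReal.ofReal r) := hrr.symm.ennrealOfReal
  exact fun φ ↦ ⟨(φ.memLp (ENNReal.ofReal r')).integrable_mul hg, h φ⟩

theorem isGivenBy_congr_ae {T : 𝓢'(EuclideanSpace ℝ (Fin d), ℂ)}
    {g h : EuclideanSpace ℝ (Fin d) → ℂ} (hg : IsGivenBy T g) (hgh : g =ᵐ[volume] h) :
    IsGivenBy T h := by
  intro φ
  have e : (fun x ↦ φ x * g x) =ᵐ[volume] fun x ↦ φ x * h x := by
    filter_upwards [hgh] with x hx
    rw [hx]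
  exact ⟨(hg φ).1.congr e, (hg φ).2.trans (integral_congr_ae e)⟩

theorem isFracDeriv_congr_ae {σ : ℝ} {f : 𝓢'(EuclideanSpace ℝ (Fin d), ℂ)}
    {g h : EuclideanSpace ℝ (Fin d) → ℂ} (hg : IsFracDeriv σ f g) (hgh : g =ᵐ[volume] h) :
    IsFracDeriv σ f h := by
  obtain ⟨w, T, h1, h2, h3⟩ := hg
  exact ⟨w, T, h1, h2, isGivenBy_congr_ae h3 hgh⟩

theorem ae_ne_zero_euclideanSpace (hd : 0 < d) :
    ∀ᵐ ξ : EuclideanSpace ℝ (Fin d), ξ ≠ 0 := by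
  have : Nonempty (Fin d) := ⟨⟨0, hd⟩⟩
  simp [ae_iff]

theorem rpow_mul_rpow_neg_eq_one (σ : ℝ) {ξ : EuclideanSpace ℝ (Fin d)} (hξ : ξ ≠ 0) :
    (2 * Real.pi * ‖ξ‖) ^ σ * (2 * Real.pi * ‖ξ‖) ^ (-σ) = 1 := by
  have h0 : 0 < 2 * Real.pi * ‖ξ‖ := by positivity
  rw [← Real.rpow_add h0, add_neg_cancel, Real.rpow_zero]

/-- A distribution is recovered from its fractional derivative through the regularised Riesz
potentials. -/
theorem tendsto_propagatorPairing_of_isFracDeriv (hd : 0 < d) {σ : ℝ} (hσ : 0 < σ)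
    {f : 𝓢'(EuclideanSpace ℝ (Fin d), ℂ)} {g : EuclideanSpace ℝ (Fin d) → ℂ}
    (hfg : IsFracDeriv σ f g) (τ : ℝ) (φ : 𝓢(EuclideanSpace ℝ (Fin d), ℂ)) :
    Tendsto (fun n ↦ propagatorPairing g τ (SchwartzMap.smulLeftCLM ℂ (regRieszSymbol σ n) φ)) atTop
      (𝓝 (f (𝓕 (SchwartzMap.smulLeftCLM ℂ (biharmonicSymbol d τ) φ)))) := by
  obtain ⟨w, T, hw, hT, hg⟩ := hfg
  set χ := SchwartzMap.smulLeftCLM ℂ (biharmonicSymbol d τ) φ with hχ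
  have hm := biharmonicSymbol_hasTemperateGrowth d τ
  have hκ := fun n ↦ regRieszSymbol_hasTemperateGrowth (V := EuclideanSpace ℝ (Fin d)) σ n
  rw [← TemperedDistribution.fourier_apply, (hw χ).2]
  have e : ∀ n, propagatorPairing g τ (SchwartzMap.smulLeftCLM ℂ (regRieszSymbol σ n) φ) =
      ∫ ξ, regRieszSymbol σ n ξ * (((2 * Real.pi * ‖ξ‖) ^ σ : ℝ) : ℂ) * (χ ξ * w ξ) := by
    intro n
    rw [propagatorPairing, ← (hg _).2, ← TemperedDistribution.fourier_apply, (hT _).2]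
    refine integral_congr_ae (Eventually.of_forall fun ξ ↦ ?_)
    simp only [hχ]
    rw [SchwartzMap.smulLeftCLM_apply_apply hm, SchwartzMap.smulLeftCLM_apply_apply (hκ n),
      SchwartzMap.smulLeftCLM_apply_apply hm]
    simp only [smul_eq_mul]
    ring
  simp_rw [e]
  -- The regularised symbol times |2πξ|^σ is at most 1 and tends to 1 away from the origin.
  refine tendsto_integral_of_dominated_convergence (fun ξ ↦ ‖χ ξ * w ξ‖) (fun n ↦ ?_)
    (hw χ).1.norm (fun n ↦ ?_) ?_
  · refine AEStronglyMeasurable.mul ?_ (hw χ).1.1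
    refine (hκ n).1.continuous.aestronglyMeasurable.mul ?_
    exact (by fun_prop : Measurable fun ξ : EuclideanSpace ℝ (Fin d) ↦
      (((2 * Real.pi * ‖ξ‖) ^ σ : ℝ) : ℂ)).aestronglyMeasurable
  · filter_upwards [ae_ne_zero_euclideanSpace hd] with ξ hξ
    rw [norm_mul, norm_mul, Complex.norm_real, Real.norm_of_nonneg (by positivity)]
    refine mul_le_of_le_one_left (norm_nonneg _) ?_
    calc _ ≤ (2 * Real.pi * ‖ξ‖) ^ (-σ) * (2 * Real.pi * ‖ξ‖) ^ σ := by
          gcongr; exact norm_regRieszSymbol_le hσ n hξ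
      _ = 1 := by rw [mul_comm, rpow_mul_rpow_neg_eq_one σ hξ]
  · filter_upwards [ae_ne_zero_euclideanSpace hd] with ξ hξ
    have h1 := ((tendsto_regRieszSymbol σ hξ).mul_const
      ((((2 * Real.pi * ‖ξ‖) ^ σ : ℝ) : ℂ))).mul_const (χ ξ * w ξ)
    rwa [← Complex.ofReal_mul, mul_comm ((2 * Real.pi * ‖ξ‖) ^ (-σ)),
      rpow_mul_rpow_neg_eq_one σ hξ, Complex.ofReal_one, one_mul] at h1

theorem eLpNorm_smulLeftCLM_regRieszSymbol_le (hd : 0 < d) {σ : ℝ} (hσ : 0 < σ) (n : ℕ)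
    (φ : 𝓢(EuclideanSpace ℝ (Fin d), ℂ)) (q : ℝ≥0∞) :
    eLpNorm (SchwartzMap.smulLeftCLM ℂ (regRieszSymbol σ n) φ) q volume ≤
      eLpNorm (fun ξ ↦ (((2 * Real.pi * ‖ξ‖) ^ (-σ) : ℝ) : ℂ) * φ ξ) q volume := by
  refine eLpNorm_mono_ae ?_
  filter_upwards [ae_ne_zero_euclideanSpace hd] with ξ hξ
  rw [SchwartzMap.smulLeftCLM_apply_apply (regRieszSymbol_hasTemperateGrowth σ n), norm_smul,
    norm_mul, Complex.norm_real, Real.norm_of_nonneg (by positivity)]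
  gcongr
  exact norm_regRieszSymbol_le hσ n hξ

section Duhamel

variable {r r' σ : ℝ} (hd : 0 < d) (hr : 2 < r) (hrr : r.HolderConjugate r') (hσ : 0 < σ)
  (hσr : σ * r' < d)
  {G : ℝ → EuclideanSpace ℝ (Fin d) → ℂ} (hG : StronglyMeasurable (Function.uncurry G))
  (hA : ∀ s, MemLp (G s) (ENNReal.ofReal r') volume)
  (hA1 : ∫⁻ s, eLpNorm (G s) (ENNReal.ofReal r') volume ≠ ⊤)
  {F : ℝ → 𝓢'(EuclideanSpace ℝ (Fin d), ℂ)} {t₀ t : ℝ}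
  (hF : ∀ᵐ s, s ∈ uIoc t₀ t → IsFracDeriv σ (F s) (G s))
include hd hr hrr hσ hσr hG hA hA1 hF

/-- At almost every s the regularised pairings of G(s) converge to the pairing of F(s). They are
dominated, uniformly in n, by ‖G(s)‖_{r'} times the norm of |2πξ|^{-σ}φ in L^{r'}, finite because
σr' < d. Measurability in s of the pairing of F is inherited from the limit. -/
theorem intervalIntegrable_and_tendsto_duhamelPairing (φ : 𝓢(EuclideanSpace ℝ (Fin d), ℂ)) :
    IntervalIntegrable (fun s ↦ F s (𝓕 (SchwartzMap.smulLeftCLM ℂ (biharmonicSymbol d (t - s)) φ)))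
      volume t₀ t ∧
    Tendsto (fun n ↦ duhamelPairing G t₀ t (SchwartzMap.smulLeftCLM ℂ (regRieszSymbol σ n) φ)) atTop
      (𝓝 (∫ s in t₀..t, F s (𝓕 (SchwartzMap.smulLeftCLM ℂ (biharmonicSymbol d (t - s)) φ)))) := by
  have hk : MemLp (fun ξ ↦ (((2 * Real.pi * ‖ξ‖) ^ (-σ) : ℝ) : ℂ) * φ ξ) (ENNReal.ofReal r')
      volume := memLp_rieszSymbol_mul_schwartz hσ hrr.symm.lt.le (by simpa using hσr) φ
  set N := (eLpNorm (fun ξ ↦ (((2 * Real.pi * ‖ξ‖) ^ (-σ) : ℝ) : ℂ) * φ ξ) (ENNReal.ofReal r')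
      volume).toReal with hN
  have hb : ∀ n s, ‖propagatorPairing (G s) (t - s)
      (SchwartzMap.smulLeftCLM ℂ (regRieszSymbol σ n) φ)‖ ≤
        (eLpNorm (G s) (ENNReal.ofReal r') volume).toReal * N := by
    intro n s
    refine (norm_propagatorPairing_le hr hrr (hA s) _ _).trans ?_
    gcongr
    exact ENNReal.toReal_mono hk.2.ne (eLpNorm_smulLeftCLM_regRieszSymbol_le hd hσ n φ _)
  have hbi : Integrable fun s ↦ (eLpNorm (G s) (ENNReal.ofReal r') volume).toReal * N :=
    (integrable_toReal_eLpNorm hrr hG hA1).mul_const N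
  have hint := fun n ↦ integrable_propagatorPairing hr hrr hG hA hA1 t
    (SchwartzMap.smulLeftCLM ℂ (regRieszSymbol σ n) φ)
  have hlim : ∀ᵐ s, s ∈ uIoc t₀ t → Tendsto (fun n ↦ propagatorPairing (G s) (t - s)
      (SchwartzMap.smulLeftCLM ℂ (regRieszSymbol σ n) φ)) atTop
      (𝓝 (F s (𝓕 (SchwartzMap.smulLeftCLM ℂ (biharmonicSymbol d (t - s)) φ)))) := by
    filter_upwards [hF] with s hs hst
    exact tendsto_propagatorPairing_of_isFracDeriv hd hσ (hs hst) _ φ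
  have hlim' := (ae_restrict_iff' measurableSet_uIoc).2 hlim
  refine ⟨?_, ?_⟩
  · rw [intervalIntegrable_iff]
    refine Integrable.mono' hbi.integrableOn
      (aestronglyMeasurable_of_tendsto_ae atTop (fun n ↦ (hint n).1.restrict) hlim') ?_
    filter_upwards [hlim'] with s hs
    exact le_of_tendsto hs.norm (Eventually.of_forall fun n ↦ hb n s)
  · exact intervalIntegral.tendsto_integral_filter_of_dominated_convergence _
      (Eventually.of_forall fun n ↦ (hint n).1.restrict)
      (Eventually.of_forall fun n ↦ Eventually.of_forall fun s _ ↦ hb n s)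
      hbi.intervalIntegrable hlim

/-- Duhamel's integral exists as a tempered distribution, and its fractional derivative is the
Duhamel integral of the fractional derivatives. -/
theorem exists_duhamel_isFracDeriv :
    ∃ u : 𝓢'(EuclideanSpace ℝ (Fin d), ℂ),
      (∀ ψ, IntervalIntegrable (fun s ↦ biharmonicPropagator d (t - s) (F s) ψ) volume t₀ t ∧
        u ψ = ∫ s in t₀..t, biharmonicPropagator d (t - s) (F s) ψ) ∧
      ∀ g : EuclideanSpace ℝ (Fin d) → ℂ, MemLp g (ENNReal.ofReal r) volume →
        (∀ ψ : 𝓢(EuclideanSpace ℝ (Fin d), ℂ), duhamelPairing G t₀ t (𝓕⁻ ψ) = ∫ x, ψ x * g x) →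
        IsFracDeriv σ u g := by
  obtain ⟨W, hW, hGW⟩ := exists_memLp_duhamelPairing hr hrr hG hA hA1 t₀ t
  obtain ⟨S, hS⟩ := exists_temperedDistribution_rieszSymbol_mul hσ hrr (by simpa using hσr) hW
  have : Fact ((1 : ℝ≥0∞) ≤ ENNReal.ofReal r) := ⟨by
    rw [← ENNReal.ofReal_one]; exact ENNReal.ofReal_le_ofReal hrr.lt.le⟩
  -- S is the function |2πξ|^{-σ}W. Both the pairing of S and the weak integral of F are limits of
  -- the same regularised Duhamel pairings, hence equal.
  refine ⟨𝓕⁻ S, fun ψ ↦ ?_, fun g hg hgψ ↦ ?_⟩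
  · have h := intervalIntegrable_and_tendsto_duhamelPairing hd hr hrr hσ hσr hG hA hA1 hF (𝓕⁻ ψ)
    simp only [biharmonicPropagator, TemperedDistribution.fourierMultiplierCLM_apply_apply]
    refine ⟨h.1, tendsto_nhds_unique ?_ h.2⟩
    rw [TemperedDistribution.fourierInv_apply, (hS _).2]
    simp_rw [hGW, SchwartzMap.smulLeftCLM_apply_apply (regRieszSymbol_hasTemperateGrowth σ _)]
    refine tendsto_integral_of_dominated_convergence _ (fun n ↦ ?_) (hS (𝓕⁻ ψ)).1.norm
      (fun n ↦ ?_) ?_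
    · exact ((regRieszSymbol_hasTemperateGrowth σ n).1.continuous.smul
        (𝓕⁻ ψ : 𝓢(EuclideanSpace ℝ (Fin d), ℂ)).continuous).aestronglyMeasurable.mul hW.1
    · filter_upwards [ae_ne_zero_euclideanSpace hd] with ξ hξ
      simp only [smul_eq_mul, norm_mul, Complex.norm_real]
      rw [Real.norm_of_nonneg (by positivity)]
      calc _ ≤ (2 * Real.pi * ‖ξ‖) ^ (-σ) * ‖(𝓕⁻ ψ : 𝓢(EuclideanSpace ℝ (Fin d), ℂ)) ξ‖ * ‖W ξ‖ := by
            gcongr; exact norm_regRieszSymbol_le hσ n hξ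
        _ = _ := by ring
    · filter_upwards [ae_ne_zero_euclideanSpace hd] with ξ hξ
      have h1 := ((tendsto_regRieszSymbol σ hξ).mul_const
        ((𝓕⁻ ψ : 𝓢(EuclideanSpace ℝ (Fin d), ℂ)) ξ)).mul_const (W ξ)
      have e : ∀ a b c : ℂ, a * (b * c) = b * a * c := fun a b c ↦ by ring
      rw [e]
      exact h1
  -- Multiplying by |2πξ|^σ gives back W, so the fractional derivative is the inverse transform of
  -- W. Any g representing the Duhamel pairing in physical space is that distribution.
  · refine ⟨fun ξ ↦ (((2 * Real.pi * ‖ξ‖) ^ (-σ) : ℝ) : ℂ) * W ξ,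
      𝓕⁻ (Lp.toTemperedDistribution (hW.toLp W)), ?_, ?_, ?_⟩
    · rw [FourierTransform.fourier_fourierInv_eq]
      exact hS
    · rw [FourierTransform.fourier_fourierInv_eq]
      refine isGivenBy_congr_ae (isGivenBy_of_memLp hrr (Lp.memLp (hW.toLp W)) fun φ ↦ ?_) ?_
      · rw [Lp.toTemperedDistribution_apply]; rfl
      · filter_upwards [ae_ne_zero_euclideanSpace hd, hW.coeFn_toLp] with ξ hξ hx
        rw [hx, ← mul_assoc, ← Complex.ofReal_mul, rpow_mul_rpow_neg_eq_one σ hξ,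
          Complex.ofReal_one, one_mul]
    · refine isGivenBy_of_memLp hrr hg fun φ ↦ ?_
      rw [TemperedDistribution.fourierInv_apply, Lp.toTemperedDistribution_apply, ← hgψ, hGW]
      refine integral_congr_ae ?_
      filter_upwards [hW.coeFn_toLp] with ξ hx
      rw [hx, smul_eq_mul]

end Duhamel

end FracDeriv

/-! ### The Strichartz estimate -/

section Strichartz

open Filter Topology

variable {d : ℕ}

theorem mixedNorm_eq_lintegral {q r : ℝ} (hq : 0 < q) (I : Set ℝ)
    (G : ℝ → EuclideanSpace ℝ (Fin d) → ℂ) :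
    mixedNorm q r I G = (∫⁻ t in I, eLpNorm (G t) (ENNReal.ofReal r) volume ^ q) ^ (1 / q) := by
  rw [mixedNorm, eLpNorm_eq_lintegral_rpow_enorm_toReal (by simpa using hq) ENNReal.ofReal_ne_top,
    ENNReal.toReal_ofReal hq.le]
  simp only [enorm_eq_self]

theorem fracMixedNorm_le_of_eqOn {σ q r : ℝ} {I : Set ℝ} (hI : MeasurableSet I)
    {u v : ℝ → 𝓢'(EuclideanSpace ℝ (Fin d), ℂ)} (h : ∀ t ∈ I, u t = v t) :
    fracMixedNorm σ q r I u ≤ fracMixedNorm σ q r I v := by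
  refine le_iInf₂ fun G hG ↦ iInf₂_le G ⟨hG.1, ?_⟩
  filter_upwards [hG.2, ae_restrict_mem hI] with t h1 h2
  rwa [h t h2]

theorem eqOn_of_isDuhamelIntegral {I : Set ℝ} {t₀ : ℝ}
    {F u v : ℝ → 𝓢'(EuclideanSpace ℝ (Fin d), ℂ)} (hu : IsDuhamelIntegral I t₀ F u)
    (hv : IsDuhamelIntegral I t₀ F v) : ∀ t ∈ I, u t = v t := by
  intro t ht
  ext φ
  rw [(hu t ht φ).2, (hv t ht φ).2]

theorem ENNReal_le_one_add_rpow {a : ℝ} (ha : 1 ≤ a) (x : ℝ≥0∞) : x ≤ 1 + x ^ a := by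
  rcases le_total x 1 with hx | hx
  · exact hx.trans le_self_add
  · calc x = x ^ (1 : ℝ) := (ENNReal.rpow_one x).symm
      _ ≤ x ^ a := ENNReal.rpow_le_rpow_of_exponent_le hx ha
      _ ≤ _ := le_add_self

/-- A fractional derivative in a mixed space on `I`, replaced by a strongly measurable function on
`ℝ × ℝ^d` that vanishes outside of `I`. -/
theorem exists_stronglyMeasurable_of_isFracDerivPath {σ q r : ℝ} (hq : 1 ≤ q) (hr : 0 < r)
    {I : Set ℝ} (hI : MeasurableSet I) (hIf : volume I ≠ ⊤)
    {F : ℝ → 𝓢'(EuclideanSpace ℝ (Fin d), ℂ)} {G : ℝ → EuclideanSpace ℝ (Fin d) → ℂ}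
    (hG : IsFracDerivPath σ I F G) (hGn : mixedNorm q r I G < ⊤) :
    ∃ G' : ℝ → EuclideanSpace ℝ (Fin d) → ℂ, StronglyMeasurable (Function.uncurry G') ∧
      (∀ s, MemLp (G' s) (ENNReal.ofReal r) volume) ∧
      ∫⁻ s, eLpNorm (G' s) (ENNReal.ofReal r) volume ≠ ⊤ ∧
      (∀ᵐ s, s ∈ I → IsFracDeriv σ (F s) (G' s)) ∧
      (∫⁻ s, eLpNorm (G' s) (ENNReal.ofReal r) volume ^ q) ^ (1 / q) ≤ mixedNorm q r I G := by
  have hq0 : 0 < q := by linarith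
  set G₁ := hG.1.mk (Function.uncurry G) with hG₁
  have hG₁m : StronglyMeasurable G₁ := hG.1.stronglyMeasurable_mk
  set A : ℝ → ℝ≥0∞ := fun s ↦ eLpNorm (fun x ↦ G₁ (s, x)) (ENNReal.ofReal r) volume with hA
  have hAm : Measurable A :=
    measurable_eLpNorm_of_stronglyMeasurable_uncurry (G := fun s x ↦ G₁ (s, x)) hG₁m hr
  -- Slices of infinite norm form a null set of times and are replaced by 0, so that every slice
  -- lies in L^r.
  set N : Set ℝ := I ∩ {s | A s < ⊤} with hN
  have hNm : MeasurableSet N := hI.inter (hAm measurableSet_Iio)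
  have hae : ∀ᵐ s ∂(volume.restrict I), G s =ᵐ[volume] fun x ↦ G₁ (s, x) :=
    Measure.ae_ae_of_ae_prod hG.1.ae_eq_mk
  have hAG : ∫⁻ s in I, A s ^ q = ∫⁻ s in I, eLpNorm (G s) (ENNReal.ofReal r) volume ^ q := by
    refine lintegral_congr_ae ?_
    filter_upwards [hae] with s hs
    rw [hA, eLpNorm_congr_ae hs]
  have hfin : ∫⁻ s in I, A s ^ q ≠ ⊤ := by
    rw [hAG]
    rw [mixedNorm_eq_lintegral hq0] at hGn
    intro h
    rw [h, ENNReal.top_rpow_of_pos (by positivity)] at hGn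
    exact lt_irrefl _ hGn
  have hAfin : ∀ᵐ s ∂(volume.restrict I), A s < ⊤ := by
    filter_upwards [ae_lt_top (hAm.pow_const q) hfin] with s hs
    exact (ENNReal.rpow_lt_top_iff_of_pos hq0).1 hs
  set G' : ℝ → EuclideanSpace ℝ (Fin d) → ℂ := fun s ↦
    N.indicator (fun s x ↦ G₁ (s, x)) s with hG'
  have hG'A : ∀ s, eLpNorm (G' s) (ENNReal.ofReal r) volume = N.indicator A s := by
    intro s
    by_cases hs : s ∈ N <;> simp [hG', hs, hA]
  have hle : ∫⁻ s, eLpNorm (G' s) (ENNReal.ofReal r) volume ^ q ≤ ∫⁻ s in I, A s ^ q := by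
    rw [← lintegral_indicator hI]
    refine lintegral_mono fun s ↦ ?_
    rw [hG'A]
    by_cases hs : s ∈ N
    · rw [indicator_of_mem hs, indicator_of_mem hs.1]
    · rw [indicator_of_notMem hs, ENNReal.zero_rpow_of_pos hq0]
      exact zero_le
  refine ⟨G', ?_, fun s ↦ ⟨?_, ?_⟩, ?_, ?_, ?_⟩
  · convert hG₁m.indicator (hNm.prod (MeasurableSet.univ (α := EuclideanSpace ℝ (Fin d)))) using 1
    funext z
    obtain ⟨s, x⟩ := z
    by_cases hs : s ∈ N <;> simp [hG', hs, Function.uncurry]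
  · by_cases hs : s ∈ N
    · simp only [hG', indicator_of_mem hs]
      exact (hG₁m.comp_measurable measurable_prodMk_left).aestronglyMeasurable
    · simp only [hG', indicator_of_notMem hs]
      exact aestronglyMeasurable_const
  · rw [hG'A]
    by_cases hs : s ∈ N
    · rw [indicator_of_mem hs]; exact hs.2
    · rw [indicator_of_notMem hs]; simp
  -- L^q in time gives L¹ because I has finite measure; only finiteness is used, so the length of I
  -- does not enter the constant.
  · have h1 : ∫⁻ s, eLpNorm (G' s) (ENNReal.ofReal r) volume ≤ ∫⁻ s in I, (1 + A s ^ q) := by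
      rw [← lintegral_indicator hI]
      refine lintegral_mono fun s ↦ ?_
      rw [hG'A]
      by_cases hs : s ∈ N
      · rw [indicator_of_mem hs, indicator_of_mem hs.1]
        exact ENNReal_le_one_add_rpow hq _
      · rw [indicator_of_notMem hs]
        exact zero_le
    refine ne_top_of_le_ne_top ?_ h1
    rw [lintegral_add_left measurable_const]
    simp [hIf, hfin]
  · have h2 : ∀ᵐ s ∂(volume.restrict I), IsFracDeriv σ (F s) (G' s) := by
      filter_upwards [hG.2, hae, hAfin, ae_restrict_mem hI] with s h1 h2 h3 h4
      have hs : s ∈ N := ⟨h4, h3⟩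
      refine isFracDeriv_congr_ae h1 ?_
      simp only [hG', indicator_of_mem hs]
      exact h2
    exact (ae_restrict_iff' hI).1 h2
  · rw [mixedNorm_eq_lintegral hq0, ← hAG]
    gcongr

/-- The inhomogeneous Strichartz estimate for `e^{itΔ²}` with general exponents. -/
theorem exists_duhamel_fracMixedNorm_le (hd : 3 ≤ d) {r r' σ q₁ q₂ : ℝ} (hr : 2 < r)
    (hrr : r.HolderConjugate r') (hσ : 0 < σ) (hσr : σ * r' < d) (hq₁ : 1 < q₁) (hq : q₁ < q₂)
    (hα : d / 4 * (1 - 2 / r) = 1 - 1 / q₁ + 1 / q₂) :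
    ∃ C : ℝ≥0, ∀ a b t₀ : ℝ, t₀ ∈ Icc a b →
      ∀ (F : ℝ → 𝓢'(EuclideanSpace ℝ (Fin d), ℂ)) (G : ℝ → EuclideanSpace ℝ (Fin d) → ℂ),
        IsFracDerivPath σ (Icc a b) F G → mixedNorm q₁ r' (Icc a b) G < ⊤ →
        ∃ u : ℝ → 𝓢'(EuclideanSpace ℝ (Fin d), ℂ),
          IsDuhamelIntegral (Icc a b) t₀ F u ∧
          fracMixedNorm σ q₂ r (Icc a b) u ≤ C * mixedNorm q₁ r' (Icc a b) G := by
  obtain ⟨C₁, hC₁, hHLS⟩ := hardy_littlewood_sobolev hq₁ hq hα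
  obtain ⟨C₂, hdisp⟩ := exists_stronglyMeasurable_duhamelPairing_fourierInv hd hr hrr
  have hq₁0 : 0 < q₁ := by linarith
  have hq₂0 : 0 < q₂ := by linarith
  refine ⟨C₂ * C₁.toNNReal, fun a b t₀ ht₀ F G hG hGn ↦ ?_⟩
  obtain ⟨G', hGm, hGL, hG1, hGF, hGle⟩ := exists_stronglyMeasurable_of_isFracDerivPath hq₁.le
    hrr.symm.pos measurableSet_Icc measure_Icc_lt_top.ne hG hGn
  obtain ⟨U, hUm, hU⟩ := hdisp G' t₀ hGm hGL hG1
  -- The distribution u(t) is built at every t of the interval, independently of the dispersive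
  -- bound.
  have hex : ∀ t ∈ Icc a b, _ := fun t ht ↦ exists_duhamel_isFracDeriv (t₀ := t₀) (t := t)
    (by lia) hr hrr hσ hσr hGm hGL hG1 (F := F) (by
      filter_upwards [hGF] with s hs hst
      exact hs (uIcc_subset_Icc ht₀ ht (uIoc_subset_uIcc hst)))
  choose! u hu hufrac using hex
  set M : ℝ → ℝ≥0∞ := fun t ↦ ∫⁻ s, ENNReal.ofReal (|t - s| ^ (-(d / 4 * (1 - 2 / r) : ℝ))) *
    eLpNorm (G' s) (ENNReal.ofReal r') volume with hM
  have hAm := measurable_eLpNorm_of_stronglyMeasurable_uncurry (μ := volume) hGm hrr.symm.pos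
  have hMm : Measurable M := by
    refine Measurable.lintegral_prod_right' (f := fun z : ℝ × ℝ ↦
      ENNReal.ofReal (|z.1 - z.2| ^ (-(d / 4 * (1 - 2 / r) : ℝ))) *
        eLpNorm (G' z.2) (ENNReal.ofReal r') volume) ?_
    exact Measurable.mul (by fun_prop) (hAm.comp measurable_snd)
  have hMn : (∫⁻ t, M t ^ q₂) ^ (1 / q₂) ≤ C₁ * mixedNorm q₁ r' (Icc a b) G :=
    (hHLS _ hAm).trans (by gcongr)
  -- The Hardy-Littlewood-Sobolev bound makes the majorant finite almost everywhere; only at those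
  -- times is U t identified with |∇|^σ u(t).
  have hMfin : ∀ᵐ t, M t < ⊤ := by
    have h1 : ∫⁻ t, M t ^ q₂ ≠ ⊤ := by
      intro h
      rw [h, ENNReal.top_rpow_of_pos (by positivity), top_le_iff] at hMn
      exact ENNReal.mul_ne_top hC₁ hGn.ne hMn
    filter_upwards [ae_lt_top (hMm.pow_const q₂) h1] with t ht
    exact (ENNReal.rpow_lt_top_iff_of_pos hq₂0).1 ht
  refine ⟨u, fun t ht φ ↦ hu t ht φ, ?_⟩
  have hpath : IsFracDerivPath σ (Icc a b) u U := by
    refine ⟨hUm.aestronglyMeasurable, ?_⟩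
    filter_upwards [ae_restrict_of_ae hMfin, ae_restrict_mem measurableSet_Icc] with t h1 h2
    exact hufrac t h2 _ ((hU t).2 h1.ne).1 ((hU t).2 h1.ne).2
  calc fracMixedNorm σ q₂ r (Icc a b) u ≤ mixedNorm q₂ r (Icc a b) U := iInf₂_le U hpath
    _ = (∫⁻ t in Icc a b, eLpNorm (U t) (ENNReal.ofReal r) volume ^ q₂) ^ (1 / q₂) :=
        mixedNorm_eq_lintegral hq₂0 _ _
    _ ≤ (∫⁻ t, (C₂ * M t) ^ q₂) ^ (1 / q₂) := by
        refine ENNReal.rpow_le_rpow ?_ (by positivity)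
        refine (setLIntegral_le_lintegral _ _).trans (lintegral_mono fun t ↦ ?_)
        gcongr
        exact (hU t).1
    _ = C₂ * (∫⁻ t, M t ^ q₂) ^ (1 / q₂) := by
        simp_rw [ENNReal.mul_rpow_of_nonneg _ _ hq₂0.le]
        rw [lintegral_const_mul _ (hMm.pow_const _), ENNReal.mul_rpow_of_nonneg _ _ (by positivity),
          ← ENNReal.rpow_mul, mul_one_div_cancel hq₂0.ne', ENNReal.rpow_one]
    _ ≤ C₂ * (C₁ * mixedNorm q₁ r' (Icc a b) G) := by gcongr
    _ = ↑(C₂ * C₁.toNNReal) * mixedNorm q₁ r' (Icc a b) G := by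
        rw [ENNReal.coe_mul, ENNReal.coe_toNNReal hC₁, mul_assoc]

/-! ### Arithmetic of the exponents. -/

section Exponents

variable {p : ℝ} (hd : 9 ≤ d) (hp : 0 < p)
include hd hp

/-- The critical index cancels: the denominator of r₁ is d(2d+p²) over that of r₀. -/
theorem expR1_eq (hr₀ : 2 < expR0 d p) : expR1 d p = 2 * d * (p + 2) / (2 * d + p ^ 2) := by
  have hD : (0 : ℝ) < d := by exact_mod_cast (by lia : 0 < d)
  set s := critIndex d p with hs
  set Q := (d : ℝ) - p + s * (p + 2) with hQ
  -- Otherwise r₀ would be a division by zero, hence 0, against 2 < r₀.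
  have hQ0 : Q ≠ 0 := by
    intro h
    rw [expR0, ← hs, ← hQ, h, div_zero] at hr₀
    linarith
  have hX : 2 * (d : ℝ) - expR0 d p * (2 * s - p) = d * (2 * d + p ^ 2) / Q := by
    rw [expR0, ← hs, ← hQ]
    field_simp
    rw [hQ]
    ring
  have h2 : 2 * (d : ℝ) + p ^ 2 ≠ 0 := by positivity
  rw [expR1, ← hs, hX, expR0, ← hs, ← hQ]
  field_simp

theorem expQ0_pos (hq₀ : ((d : ℝ) + 4) / 4 * p < expQ0 d p) : 0 < expQ0 d p :=
  lt_trans (by positivity) hq₀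

/-- This is the kernel exponent α demanded by Hardy-Littlewood-Sobolev for q₀/(1+p) → q₀. Positivity
of q₀ rules out a zero denominator. -/
theorem one_sub_div_expQ0 (hq₀ : ((d : ℝ) + 4) / 4 * p < expQ0 d p) :
    1 - p / expQ0 d p = p * (d - p) / (4 * (p + 2)) := by
  have h0 := expQ0_pos hd hp hq₀
  have hden : p ^ 2 - p * ((d : ℝ) - 4) + 8 ≠ 0 := by
    intro h
    rw [expQ0, h, div_zero] at h0
    exact lt_irrefl _ h0
  rw [expQ0]
  field_simp
  ring

/-- The lower bound on q₀ gives p < q₀, so 1 - p/q₀ = p(d-p)/(4(p+2)) is positive. The resulting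
bound on p yields both r₁ > 2 and the local integrability of the Riesz weight. -/
theorem lt_dim (hq₀ : ((d : ℝ) + 4) / 4 * p < expQ0 d p) : p < d := by
  have h0 := expQ0_pos hd hp hq₀
  have hD : (0 : ℝ) < d := by exact_mod_cast (by lia : 0 < d)
  have h1 : p / expQ0 d p < 1 := by
    rw [div_lt_one h0]
    refine lt_of_le_of_lt ?_ hq₀
    nlinarith
  have h2 := one_sub_div_expQ0 hd hp hq₀
  have h3 : 0 < p * (d - p) / (4 * (p + 2)) := by rw [← h2]; linarith
  have h4 : 0 < p * (d - p) := (div_pos_iff_of_pos_right (by positivity)).1 h3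
  have := (mul_pos_iff_of_pos_left hp).1 h4
  linarith

end Exponents

end Strichartz

/-! ### The exotic Strichartz estimate. -/

theorem lemma5p3 (d : ℕ) (hd : 9 ≤ d) (p : ℝ) (hp : 0 < p)
    (hsc : 1 ≤ critIndex d p)
    (hr₀ : 2 < expR0 d p) (hr₀' : expR0 d p < d / critIndex d p)
    (hq₀ : ((d : ℝ) + 4) / 4 * p < expQ0 d p) :
    ∃ C : ℝ≥0, ∀ a b t₀ : ℝ, t₀ ∈ Icc a b →
      ∀ F : ℝ → 𝓢'(EuclideanSpace ℝ (Fin d), ℂ),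
        YNorm d p (Icc a b) F < ⊤ →
        ∃ u : ℝ → 𝓢'(EuclideanSpace ℝ (Fin d), ℂ),
          IsDuhamelIntegral (Icc a b) t₀ F u ∧
          XNorm d p (Icc a b) u ≤ C * YNorm d p (Icc a b) F := by
  have hD : (9 : ℝ) ≤ d := by exact_mod_cast hd
  have hr1 := expR1_eq hd hp hr₀
  have hpd := lt_dim hd hp hq₀
  have hq0 := expQ0_pos hd hp hq₀
  have hinv : (expR1 d p)⁻¹ = (2 * d + p ^ 2) / (2 * d * (p + 2)) := by rw [hr1, inv_div]
  have hr : 2 < expR1 d p := by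
    rw [hr1, lt_div_iff₀ (by positivity)]
    nlinarith
  have hrr : (expR1 d p).HolderConjugate (expR1' d p) := by
    rw [Real.holderConjugate_iff]
    exact ⟨by linarith, by rw [expR1', inv_inv]; ring⟩
  -- After clearing denominators this is p(p+1) < d(p+1).
  have hσr : p / 2 * expR1' d p < d := by
    have h1 : 1 - (expR1 d p)⁻¹ = (2 * d * p + 2 * d - p ^ 2) / (2 * d * (p + 2)) := by
      rw [hinv]; field_simp; ring
    have h2 : 0 < 2 * (d : ℝ) * p + 2 * d - p ^ 2 := by nlinarith
    rw [expR1', h1, inv_div, ← mul_div_assoc, div_lt_iff₀ h2]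
    nlinarith [mul_pos (by linarith : (0 : ℝ) < d) (by linarith : 0 < p + 1)]
  -- It suffices that 1 + p ≤ (d+4)p/4, that is dp ≥ 4; s_c ≥ 1 gives even dp ≥ 8 + 2p.
  have hq₁ : 1 < expQ0 d p / (1 + p) := by
    rw [lt_div_iff₀ (by positivity)]
    refine lt_of_le_of_lt ?_ hq₀
    have h1 : 4 / p * p = 4 := div_mul_cancel₀ _ hp.ne'
    rw [critIndex] at hsc
    nlinarith
  have hq : expQ0 d p / (1 + p) < expQ0 d p := div_lt_self hq0 (by linarith)
  -- The scaling identity: both sides equal p(d-p)/(4(p+2)).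
  have hα : (d : ℝ) / 4 * (1 - 2 / expR1 d p) =
      1 - 1 / (expQ0 d p / (1 + p)) + 1 / expQ0 d p := by
    have h1 : 1 - 1 / (expQ0 d p / (1 + p)) + 1 / expQ0 d p = 1 - p / expQ0 d p := by
      field_simp; ring
    rw [h1, one_sub_div_expQ0 hd hp hq₀, div_eq_mul_inv 2, hinv]
    field_simp
    ring
  obtain ⟨C, hC⟩ := exists_duhamel_fracMixedNorm_le (by lia) hr hrr (half_pos hp) hσr hq₁ hq hα
  -- A nonzero constant can be moved inside the infimum defining the norm of F.
  refine ⟨C + 1, fun a b t₀ ht₀ F hF ↦ ?_⟩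
  obtain ⟨G, hG, hGn⟩ : ∃ G, ∃ _ : IsFracDerivPath (p / 2) (Icc a b) F G,
      mixedNorm (expQ0 d p / (1 + p)) (expR1' d p) (Icc a b) G < ⊤ := by
    simpa only [YNorm, fracMixedNorm, iInf_lt_iff] using hF
  -- u is fixed from one representative of |∇|^{p/2}F, without its estimate. For any other
  -- representative the weak integral determines the same distribution on the interval, so each
  -- competitor in the infimum bounds the norm of this u.
  obtain ⟨u, hu, -⟩ := hC a b t₀ ht₀ F G hG hGn
  refine ⟨u, hu, ?_⟩
  have h0 : ((C + 1 : ℝ≥0) : ℝ≥0∞) ≠ 0 := by simp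
  rw [YNorm, fracMixedNorm, ENNReal.mul_iInf_of_ne h0 ENNReal.coe_ne_top]
  refine le_iInf fun G' ↦ ?_
  rw [ENNReal.mul_iInf_of_ne h0 ENNReal.coe_ne_top]
  refine le_iInf fun hG' ↦ ?_
  rcases eq_or_ne (mixedNorm (expQ0 d p / (1 + p)) (expR1' d p) (Icc a b) G') ⊤ with h | h
  · rw [h, ENNReal.mul_top h0]
    exact le_top
  · obtain ⟨v, hv, hvn⟩ := hC a b t₀ ht₀ F G' hG' h.lt_top
    refine (fracMixedNorm_le_of_eqOn measurableSet_Icc (eqOn_of_isDuhamelIntegral hu hv)).trans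
      (hvn.trans ?_)
    gcongr
    simp
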